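/- **Private $k$-median algorithm.** Input: points $p_1,\dots,p_n\in\mathbb R^d$ in the open ball $B(0,\Lambda)$, a number $k$, and $\varepsilon>0$. Set $\tau=2d\log n/\varepsilon$ ($\log$ is the natural logarithm). (1) Build a random quadtree: the root is the cube $[-\Lambda,\Lambda]^d$; a cell at depth $di+j$ ($0\le j<d$), whose $j$-th side is $[m,M]$, is cut along coordinate $j$ at an independent uniform position in $[m+\frac{M-m}3,M-\frac{M-m}3]$ into the child $c_1$ (coordinate at most the cut) and the child $c_2$ (the rest). (2) The root is put in a queue. For each cell $c$ taken from the queue with $\mathrm{diam}(c)>\Lambda/n$, let $w(c)=|\{i:p_i\in c\}|+\mathrm{Lap}(d\log n/\varepsilon)$ with independent noises, and if $w(c)>\tau$ put both children of $c$ in the queue. All other weights are $0$. (3) Recursively from the root, compute for each visited cell $c$ values $v_0,\dots,v_k$ and center sequences $S_0,\dots,S_k$: $v_0=w(c)\,\mathrm{diam}(c)$ and $S_0=\emptyset$; for $k'\ge1$, if $w(c)<\tau$ then $v_{k'}=0$ and $S_{k'}$ is $k'$ copies of the center of the box $c$; otherwise, with $v^1,S^1$ and $v^2,S^2$ the results at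 the children $c_1$ and $c_2$, and with $k_1+k_2=k'$ minimizing $v^1_{k_1}+v^2_{k_2}$ (least $k_1$ in case of ties), $v_{k'}=v^1_{k_1}+v^2_{k_2}$ and $S_{k'}$ is $S^1_{k_1}$ followed by $S^2_{k_2}$. The output is $S_k$ at the root. For a set $F\subseteq\mathbb R$ of representable numbers and a measurable rounding map $\rho:\mathbb R\to F$ that fixes $F$, the *$\rho$-rounded* algorithm applies $\rho$ to each $v_{k'}$ when it is computed (also to the sums that are compared in the minimization) and to each coordinate of each center; for $F=\mathbb R$, $\rho=\mathrm{id}$ this is the algorithm above in exact arithmetic. **MPC model.** There are $m$ machines with memory $s$ words each; a word is an integer in $\{0,\dots,(ms)^C-1\}$ (that is, $O(\log(ms))$ bits) or an element of $F$ (so it can hold one coordinate of an input point). The machines share a random source. In each round each machine, by arbitrary local computation, sends words to the machines, receives the words sent to it, and updates its memory; at all times each memory holds at most $s$ words, and in each round each machine sends at most $s$ and receives at most $s$ words. Initially the points are distributed arbitrarily over the machines, at most $\lceil n^\delta\rceil$ points on each. The output is read from the memory of the first machine after the last round, as $kd$ words. **Theorem.** Let $0<\gamma<\delta<1$. There is a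 constant $C\ge1$, depending only on $\delta$ and $\gamma$, such that for all $n\ge2$, $d\ge1$, $k\le n^\gamma$, $\varepsilon>0$, $\Lambda>0$ and all $F,\rho$ as above (in particular $F=\mathbb R$, $\rho=\mathrm{id}$), there is an MPC algorithm with $m=\lceil C\,n^{1-\delta+\gamma}\rceil$ machines, memory $s=\lceil C\,n^\delta d\log n\rceil$ words per machine and at most $C\,d\log n$ rounds which, for every input of $n$ points in $B(0,\Lambda)$ with coordinates in $F$ and every initial distribution of the points, never violates the space bounds and has an output with exactly the same distribution as the output of the ($\rho$-rounded) private $k$-median algorithm. -/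

import Mathlib

open MeasureTheory ProbabilityTheory

noncomputable section

namespace PrivateKMedian

/-! ### Random quadtrees

A cell of the (infinite) binary quadtree is named by the path from the root to it, the most recent
step being the head of the list: `[]` is the root, `false :: c` and `true :: c` are the two children
of `c`. The depth of `c` is `c.length`. -/

/-- Names of the cells of a quadtree. -/
abbrev Cell := List Bool

/-- A realization of the random choices: for each cell, the relative position in `[0, 1]` of the
cut inside the middle third, and the noise that is added to the count of the cell. -/
abbrev Coins := Cell → unitInterval × ℝ

section Quadtree

variable (d : ℕ) (Λ : ℝ) (ω : Coins)

/-- Given the lower and upper ends `m`, `M` of the side of the cell `c` that is cut, the position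
of the cut: it ranges over `[m + (M - m) / 3, M - (M - m) / 3]`. -/
def cutPos (c : Cell) (m M : ℝ) : ℝ := m + (M - m) / 3 + ((ω c).1 : ℝ) * ((M - m) / 3)

/-- The lower and upper ends of the sides of the cells. The root is the cube `[-Λ, Λ]^d`; a cell at
depth `d * i + j` with `j < d` is cut along coordinate `j`. -/
def box : Cell → (Fin d → ℝ) × (Fin d → ℝ)
  | [] => (fun _ => -Λ, fun _ => Λ)
  | b :: c =>
    ((fun j => if (j : ℕ) = c.length % d ∧ b = true
        then cutPos ω c ((box c).1 j) ((box c).2 j) else (box c).1 j),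
     (fun j => if (j : ℕ) = c.length % d ∧ b = false
        then cutPos ω c ((box c).1 j) ((box c).2 j) else (box c).2 j))

/-- The region `T(c)` of a cell. The first child takes the points of the cell whose coordinate is
at most the cut, the second child the remaining ones. -/
def region : Cell → Set (Fin d → ℝ)
  | [] => {p | ∀ j, -Λ ≤ p j ∧ p j ≤ Λ}
  | false :: c => {p ∈ region c | ∀ j : Fin d, (j : ℕ) = c.length % d →
      p j ≤ cutPos ω c ((box d Λ ω c).1 j) ((box d Λ ω c).2 j)}
  | true :: c => {p ∈ region c | ∀ j : Fin d, (j : ℕ) = c.length % d →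
      cutPos ω c ((box d Λ ω c).1 j) ((box d Λ ω c).2 j) < p j}

/-- The Euclidean diameter of a cell (the length of the diagonal of its box). -/
def diam (c : Cell) : ℝ := √(∑ j, ((box d Λ ω c).2 j - (box d Λ ω c).1 j) ^ 2)

/-- The center of a cell. -/
def center (c : Cell) : Fin d → ℝ := fun j => ((box d Λ ω c).1 j + (box d Λ ω c).2 j) / 2

end Quadtree

/-! ### The private `k`-median algorithm

`rnd : ℝ → ℝ` is applied to each number that has to be stored in a memory word: to the entries of
the dynamic program and to the coordinates of the centers. For `rnd = id` this is the algorithm in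
exact real arithmetic. -/

/-- The threshold `2 d log n / ε`. -/
def threshold (n d : ℕ) (ε : ℝ) : ℝ := 2 * (d * Real.log n / ε)

section Algorithm

variable {n d : ℕ} (ε Λ : ℝ) (ω : Coins) (P : Fin n → Fin d → ℝ)

open Classical in
/-- The number `|T(c) ∩ P|` of input points in a cell. -/
def count (c : Cell) : ℕ := (Finset.univ.filter fun i => P i ∈ region d Λ ω c).card

/-- The noisy count computed when the cell is taken from the queue. -/
def noisyCount (c : Cell) : ℝ := count Λ ω P c + (ω c).2

/-- Whether the cell enters the queue of `MakePrivate`: the root does, and the children of a cell do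
if that cell entered the queue, has diameter larger than `Λ / n`, and has a noisy count above the
threshold. -/
def Queued : Cell → Prop
  | [] => True
  | _ :: c => Queued c ∧ Λ / n < diam d Λ ω c ∧ threshold n d ε < noisyCount Λ ω P c

open Classical in
/-- The weights computed by `MakePrivate`. -/
def weight (c : Cell) : ℝ :=
  if Queued ε Λ ω P c ∧ Λ / n < diam d Λ ω c then noisyCount Λ ω P c else 0

/-- The result of the dynamic program at a cell: `val k'` is the value `v_{k'}`, and
`sol k' 0, …, sol k' (k' - 1)` are the centers of the solution `S_{k'}`, with repetitions. -/
structure Table (d : ℕ) where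
  val : ℕ → ℝ
  sol : ℕ → ℕ → Fin d → ℝ

variable (rnd : ℝ → ℝ)

/-- The entry for `k' = 0`, which is the same at every cell. -/
def zeroVal (c : Cell) : ℝ := rnd (weight ε Λ ω P c * diam d Λ ω c)

/-- The result at a cell where the recursion stops: for `k' ≥ 1` the value is `0` and the solution
consists of `k'` copies of the center of the cell. -/
def leafTable (c : Cell) : Table d where
  val k' := if k' = 0 then zeroVal ε Λ ω P rnd c else rnd 0
  sol _ _ := fun j => rnd (center d Λ ω c j)

/-- The least `k₁ ≤ k'` that minimizes `v¹_{k₁} + v²_{k' - k₁}`. -/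
def bestSplit {d : ℕ} (rnd : ℝ → ℝ) (t₁ t₂ : Table d) (k' : ℕ) : ℕ :=
  sInf {k₁ | k₁ ≤ k' ∧
    ∀ j ≤ k', rnd (t₁.val k₁ + t₂.val (k' - k₁)) ≤ rnd (t₁.val j + t₂.val (k' - j))}

/-- The result at a cell with children results `t₁` and `t₂`. -/
def nodeTable (c : Cell) (t₁ t₂ : Table d) : Table d where
  val k' := if k' = 0 then zeroVal ε Λ ω P rnd c else
    rnd (t₁.val (bestSplit rnd t₁ t₂ k') + t₂.val (k' - bestSplit rnd t₁ t₂ k'))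
  sol k' a :=
    if a < bestSplit rnd t₁ t₂ k' then t₁.sol (bestSplit rnd t₁ t₂ k') a
    else t₂.sol (k' - bestSplit rnd t₁ t₂ k') (a - bestSplit rnd t₁ t₂ k')

open Classical in
/-- The dynamic program, with the recursion cut off at height `h`. -/
def dynamicProgramAux : ℕ → Cell → Table d
  | 0, c => leafTable ε Λ ω P rnd c
  | h + 1, c =>
    if weight ε Λ ω P c < threshold n d ε then leafTable ε Λ ω P rnd c
    else nodeTable ε Λ ω P rnd c
      (dynamicProgramAux h (false :: c)) (dynamicProgramAux h (true :: c))

/-- A depth at which all cells have diameter at most `Λ / n`. -/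
def maxDepth (n d : ℕ) : ℕ := d * ⌈Real.logb (3 / 2) (2 * √d * n)⌉₊

/-- The dynamic program. The cut-off plays no role: see `dynamicProgram_eq`. -/
def dynamicProgram (c : Cell) : Table d :=
  dynamicProgramAux ε Λ ω P rnd (maxDepth n d - c.length) c

/-- The output `S_k` of the private `k`-median algorithm, for given random choices. -/
def privateKMedian (k : ℕ) : Fin k → Fin d → ℝ :=
  fun a => (dynamicProgram ε Λ ω P rnd []).sol k a

end Algorithm

/-! ### The distribution of the random choices -/

/-- The Laplace distribution `Lap(b)`, with density `x ↦ exp (-|x| / b) / (2 b)`. -/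
def laplace (b : ℝ) : Measure ℝ :=
  volume.withDensity fun x => ENNReal.ofReal (1 / (2 * b) * Real.exp (-|x| / b))

/-- The random choices: all cuts are uniform, all noises are `Lap(d log n / ε)`, and all these
variables are independent. -/
def coinLaw (n d : ℕ) (ε : ℝ) : Measure Coins :=
  Measure.infinitePi fun _ : Cell =>
    (volume : Measure unitInterval).prod (laplace (d * Real.log n / ε))

/-! ### Sanity facts -/

theorem isProbabilityMeasure_laplace {b : ℝ} (hb : 0 < b) : IsProbabilityMeasure (laplace b) := by
  have key : ∫ x : ℝ, 1 / (2 * b) * Real.exp (-|x| / b) = 1 := by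
    rw [integral_const_mul]
    have h1 : ∫ x : ℝ, Real.exp (-|x| / b) = 2 * ∫ x in Set.Ioi (0 : ℝ), Real.exp (-x / b) :=
      integral_comp_abs (f := fun x => Real.exp (-x / b))
    have h2 : ∫ x in Set.Ioi (0 : ℝ), Real.exp (-x / b) = b := by
      have := integral_exp_mul_Ioi (a := -(1 / b)) (by simpa using hb) 0
      have h3 : ∀ x : ℝ, -x / b = -(1 / b) * x := fun x => by ring
      simp only [h3, this]
      simp
    rw [h1, h2]
    field_simp
  constructor
  rw [laplace, withDensity_apply _ MeasurableSet.univ, Measure.restrict_univ,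
    ← ofReal_integral_eq_lintegral_ofReal, key, ENNReal.ofReal_one]
  · by_contra h
    rw [integral_undef h] at key
    norm_num at key
  · exact Filter.Eventually.of_forall fun x => by positivity

theorem isProbabilityMeasure_coinLaw {n d : ℕ} {ε : ℝ} (hn : 2 ≤ n) (hd : 1 ≤ d) (hε : 0 < ε) :
    IsProbabilityMeasure (coinLaw n d ε) := by
  have hlog : 0 < Real.log n := Real.log_pos (by exact_mod_cast hn)
  have hd' : (0 : ℝ) < d := by exact_mod_cast hd
  have := isProbabilityMeasure_laplace (b := d * Real.log n / ε) (by positivity)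
  unfold coinLaw
  infer_instance

theorem splits_succ {d t j : ℕ} (hj : j < d) :
    (t + 1) / d + (if j < (t + 1) % d then 1 else 0) =
      t / d + (if j < t % d then 1 else 0) + if j = t % d then 1 else 0 := by
  have hr := Nat.mod_lt t (Nat.zero_lt_of_lt hj)
  have ht := Nat.div_add_mod t d
  by_cases hw : t % d + 1 = d
  · have e : t + 1 = d * (t / d + 1) := by rw [Nat.mul_add, Nat.mul_one]; omega
    rw [e, Nat.mul_div_cancel_left _ (by omega), Nat.mul_mod_right]
    split_ifs <;> omega
  · have e : t + 1 = (t % d + 1) + d * (t / d) := by omega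
    have e1 : (t + 1) / d = t / d := by
      conv_lhs => rw [e]
      rw [Nat.add_mul_div_left _ _ (by omega), Nat.div_eq_of_lt (by omega), Nat.zero_add]
    have e2 : (t + 1) % d = t % d + 1 := by
      conv_lhs => rw [e]
      rw [Nat.add_mul_mod_self_left, Nat.mod_eq_of_lt (by omega)]
    rw [e1, e2]
    split_ifs <;> omega

theorem side_le {d : ℕ} {Λ : ℝ} (hΛ : 0 < Λ) (ω : Coins) (j : Fin d) (c : Cell) :
    0 ≤ (box d Λ ω c).2 j - (box d Λ ω c).1 j ∧
    (box d Λ ω c).2 j - (box d Λ ω c).1 j ≤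
      2 * Λ * (2 / 3) ^ (c.length / d + if (j : ℕ) < c.length % d then 1 else 0) := by
  induction c with
  | nil => simp [box]; constructor <;> linarith
  | cons b c ih =>
    obtain ⟨h0, h1⟩ := ih
    have hu := (ω c).1.2
    rw [List.length_cons, splits_succ j.2, pow_add, ← mul_assoc]
    set q := 2 * Λ * (2 / 3) ^ (c.length / d + if (j : ℕ) < c.length % d then 1 else 0) with hq
    by_cases hc : (j : ℕ) = c.length % d
    · set s := (box d Λ ω c).2 j - (box d Λ ω c).1 j with hs
      have hmul : 0 ≤ ((ω c).1 : ℝ) * s := mul_nonneg hu.1 h0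
      have hmul' : ((ω c).1 : ℝ) * s ≤ s := mul_le_of_le_one_left h0 hu.2
      rw [if_pos hc, pow_one]
      cases b
      · have : (box d Λ ω (false :: c)).2 j - (box d Λ ω (false :: c)).1 j
            = s / 3 + ((ω c).1 : ℝ) * s / 3 := by
          simp [box, hc, cutPos, hs]; ring
        rw [this]; constructor <;> linarith
      · have : (box d Λ ω (true :: c)).2 j - (box d Λ ω (true :: c)).1 j
            = 2 * s / 3 - ((ω c).1 : ℝ) * s / 3 := by
          simp [box, hc, cutPos, hs]; ring
        rw [this]; constructor <;> linarith
    · have : (box d Λ ω (b :: c)).2 j - (box d Λ ω (b :: c)).1 j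
          = (box d Λ ω c).2 j - (box d Λ ω c).1 j := by simp [box, hc]
      rw [this, if_neg hc, pow_zero, mul_one]
      exact ⟨h0, h1⟩

theorem diam_le_of_maxDepth_le {n d : ℕ} {Λ : ℝ} (hn : 2 ≤ n) (hd : 1 ≤ d) (hΛ : 0 < Λ)
    (ω : Coins) {c : Cell} (hc : maxDepth n d ≤ c.length) : diam d Λ ω c ≤ Λ / n := by
  set q := ⌈Real.logb (3 / 2) (2 * √d * n)⌉₊ with hq
  have hn' : (0 : ℝ) < n := by exact_mod_cast (by omega : 0 < n)
  have hd' : (0 : ℝ) < √d := Real.sqrt_pos.2 (by exact_mod_cast hd)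
  have hside : ∀ j : Fin d, ((box d Λ ω c).2 j - (box d Λ ω c).1 j) ^ 2
      ≤ (2 * Λ * (2 / 3) ^ q) ^ 2 := fun j => by
    obtain ⟨h0, h1⟩ := side_le hΛ ω j c
    refine pow_le_pow_left₀ h0 (h1.trans ?_) 2
    refine mul_le_mul_of_nonneg_left ?_ (by positivity)
    refine pow_le_pow_of_le_one (by norm_num) (by norm_num) ?_
    have : q ≤ c.length / d := by
      rw [Nat.le_div_iff_mul_le (by omega), Nat.mul_comm]; exact hc
    omega
  have h1 : diam d Λ ω c ≤ √d * (2 * Λ * (2 / 3) ^ q) := by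
    unfold diam
    refine (Real.sqrt_le_sqrt (Finset.sum_le_sum fun j _ => hside j)).trans ?_
    rw [Finset.sum_const, Finset.card_univ, Fintype.card_fin, nsmul_eq_mul,
      Real.sqrt_mul (by positivity), Real.sqrt_sq (by positivity)]
  have h2 : 2 * √d * n ≤ (3 / 2 : ℝ) ^ q := by
    have := Nat.le_ceil (Real.logb (3 / 2) (2 * √d * n))
    rw [Real.logb_le_iff_le_rpow (by norm_num) (by positivity), Real.rpow_natCast] at this
    exact this
  have h3 : (2 / 3 : ℝ) ^ q = ((3 / 2 : ℝ) ^ q)⁻¹ := by rw [← inv_pow]; norm_num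
  refine h1.trans ?_
  rw [h3, le_div_iff₀ hn']
  have hp : (0 : ℝ) < (3 / 2 : ℝ) ^ q := by positivity
  calc √d * (2 * Λ * ((3 / 2 : ℝ) ^ q)⁻¹) * n = Λ * ((2 * √d * n) * ((3 / 2 : ℝ) ^ q)⁻¹) := by ring
    _ ≤ Λ * 1 := by
        refine mul_le_mul_of_nonneg_left ?_ hΛ.le
        rw [← div_eq_mul_inv, div_le_one hp]
        exact h2
    _ = Λ := mul_one _

open Classical in
/-- The recursion of the dynamic program holds at every cell: the cut-off height is harmless. -/
theorem dynamicProgram_eq {n d : ℕ} {ε Λ : ℝ} (hn : 2 ≤ n) (hd : 1 ≤ d) (hε : 0 < ε) (hΛ : 0 < Λ)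
    (ω : Coins) (P : Fin n → Fin d → ℝ) (rnd : ℝ → ℝ) (c : Cell) :
    dynamicProgram ε Λ ω P rnd c =
      if weight ε Λ ω P c < threshold n d ε then leafTable ε Λ ω P rnd c
      else nodeTable ε Λ ω P rnd c
        (dynamicProgram ε Λ ω P rnd (false :: c)) (dynamicProgram ε Λ ω P rnd (true :: c)) := by
  unfold dynamicProgram
  rcases Nat.lt_or_ge c.length (maxDepth n d) with h | h
  · rw [show maxDepth n d - c.length = (maxDepth n d - (c.length + 1)) + 1 by omega]
    rfl
  · have hw : weight ε Λ ω P c < threshold n d ε := by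
      have hlog : 0 < Real.log n := Real.log_pos (by exact_mod_cast hn)
      have hd' : (0 : ℝ) < d := by exact_mod_cast hd
      rw [weight, if_neg (fun h' => absurd (diam_le_of_maxDepth_le hn hd hΛ ω h) (not_le.2 h'.2))]
      unfold threshold
      positivity
    rw [if_pos hw, show maxDepth n d - c.length = 0 by omega]
    rfl

/-! ### Massively parallel computation -/

/-- A memory word is either an index in `{0, …, B - 1}`, or a number of the set `F` of numbers that
fit in one word. -/
abbrev Word (B : ℕ) (F : Set ℝ) := Fin B ⊕ F

/-- A (randomized) MPC algorithm for `m` machines with words from `W`. The random source is shared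
by the machines. In each round a machine computes, from its memory and the random source, the
sequences of words that it sends to the machines; then it receives the messages sent to it, and
computes its new memory. Local computation is unrestricted. -/
structure MPCAlgorithm (m : ℕ) (W : Type) where
  /-- the shared random source -/
  Ω : Type
  /-- its events -/
  mΩ : MeasurableSpace Ω
  /-- its distribution -/
  μ : Measure Ω
  /-- it is a probability distribution -/
  isProb : IsProbabilityMeasure μ
  /-- the number of rounds -/
  rounds : ℕ
  /-- `send t ω i mem i'`: the message of machine `i` to machine `i'` in round `t` -/
  send : ℕ → Ω → Fin m → List W → Fin m → List W
  /-- `update t ω i mem inbox`: the memory of machine `i` after round `t`, where `inbox i'` is the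
  message received from machine `i'` -/
  update : ℕ → Ω → Fin m → List W → (Fin m → List W) → List W

namespace MPCAlgorithm

variable {m : ℕ} {W : Type} (A : MPCAlgorithm m W)

/-- The memory of each machine after `t` rounds, started from the memories `init`. -/
def memory (ω : A.Ω) (init : Fin m → List W) : ℕ → Fin m → List W
  | 0 => init
  | t + 1 => fun i => A.update t ω i (memory ω init t i)
      (fun i' => A.send t ω i' (memory ω init t i') i)

/-- The message from machine `i` to machine `i'` in round `t`. -/
def message (ω : A.Ω) (init : Fin m → List W) (t : ℕ) (i i' : Fin m) : List W :=
  A.send t ω i (A.memory ω init t i) i'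

/-- The run respects the space bound `s`: at all times the memory of each machine has at most `s`
words, and in each round each machine sends at most `s` words and receives at most `s` words. -/
def RunsInSpace (s : ℕ) (ω : A.Ω) (init : Fin m → List W) : Prop :=
  (∀ t ≤ A.rounds, ∀ i, (A.memory ω init t i).length ≤ s) ∧
  ∀ t < A.rounds, ∀ i,
    ∑ i', (A.message ω init t i i').length ≤ s ∧ ∑ i', (A.message ω init t i' i).length ≤ s

end MPCAlgorithm

/-- The number held by a word. -/
def Word.toReal {B : ℕ} {F : Set ℝ} : Word B F → ℝ := Sum.elim (fun i => (i : ℕ)) (fun x => x)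

/-- The initial memories when input point `p` is given to machine `loc p`: each machine holds the
coordinates of its points, one after the other. -/
def initialMemory {n d m B : ℕ} {F : Set ℝ} (P : Fin n → Fin d → F) (loc : Fin n → Fin m) :
    Fin m → List (Word B F) :=
  fun i => ((List.finRange n).filter fun p => loc p = i).flatMap fun p =>
    List.ofFn fun j => Sum.inr (P p j)

/-- The `k` points of `ℝ^d` written, coordinate after coordinate and point after point, in the
memory of the first machine at the end of the computation. -/
def outputPoints {m B : ℕ} {F : Set ℝ} (k d : ℕ) (A : MPCAlgorithm m (Word B F)) (ω : A.Ω)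
    (init : Fin m → List (Word B F)) : Fin k → Fin d → ℝ :=
  fun a j => if h : 0 < m then
    (((A.memory ω init A.rounds ⟨0, h⟩)[(a : ℕ) * d + j]?).map Word.toReal).getD 0 else 0

/-- The algorithm `A` simulates the private `k`-median algorithm (with numbers rounded by `ρ`) on
the input `P`, distributed by `loc`, within space `s`: every run respects the space bound, and
the output has exactly the distribution of the output of the private `k`-median algorithm. -/
def Simulates {n d m B : ℕ} {F : Set ℝ} (A : MPCAlgorithm m (Word B F)) (s k : ℕ) (ε Λ : ℝ)
    (ρ : ℝ → F) (P : Fin n → Fin d → F) (loc : Fin n → Fin m) : Prop :=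
  (∀ ω, A.RunsInSpace s ω (initialMemory P loc)) ∧
  @IdentDistrib A.Ω Coins (Fin k → Fin d → ℝ) A.mΩ inferInstance inferInstance
    (fun ω => outputPoints k d A ω (initialMemory P loc))
    (fun ω => privateKMedian ε Λ ω (fun i j => (P i j : ℝ)) (fun x => (ρ x : ℝ)) k)
    A.μ (coinLaw n d ε)

end PrivateKMedian

end

/-!
The machines simulate the sequential algorithm with shared coins: for every outcome `ω` of the
cuts and noises they compute exactly the output that the sequential algorithm has for `ω`, so the
two outputs have the same distribution as soon as the sequential output is measurable
(`measurable_privateKMedian`). What remains is a deterministic problem for each fixed `ω`. Since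
local computation is arbitrary, a round is described by what the machines know: it suffices that
the memory of a machine determines the packets it sends, and that the memory and the packets
received determine the new memory, uniformly in the input (`Step.of_packets`). Chains of such
rounds are algorithms (`exists_algorithm_of_reach`).

Given `ω`, every machine knows the whole geometry and all noises of the quadtree, but not the
numbers of points in its cells. These are made accessible by sorting the points by the leaves of
the quadtree, with a network of comparators that sort a block of points inside one machine.
A Columnsort step (`columnsort`) sorts `r * c` positions with four passes of sorters for `r`
positions, and `J` such steps give a sorter with `4 ^ J` layers and `c ^ J` machines (`sorter_pow`).
With `J ≥ 2 / δ` this is a constant number of rounds.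

Once the points are sorted, the leaf paths, extended by the binary digits of the rank to make them
distinct, form an increasing sequence of keys, that is, a binary trie. The points of a cell are an
interval of ranks, and a cell both of whose children contain points is named by the gap between two
consecutive ranks, so there are at most `n - 1` of them and each is kept as a record of size
`O(d + k)` on one of the machines. A chain of cells with the same points is not stored: the dynamic
program on it needs only the number of points and the noises, and empty subtrees need no data at
all, so a branching cell that knows the value tables of its two children computes everything up to
the cell below the next branching cell by itself (`GapAgree.table_val_walk`). To whom it reports is
decided by comparing the heights of separation at the two ends of its interval
(`Trie.of_gap_child`). Hence the value tables are complete after as many rounds as the compressed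
trie is high (`step_tree`), and only the tables, with `k + 1` entries, travel. The centers are then
recovered in the opposite direction: `k` tokens, one for each center, start at the root and each
follows the optimal splits, one branching cell per round, until it comes to the cell whose center
is wanted (`NodeData.token_spec`, `step_token`). The ties and the rounding are those of the
sequential algorithm, since the same table is computed.

The height of the compressed trie is at most the depth `O(d log (d n))` of the quadtree plus
`⌈log₂ n⌉`, which is `O(d log n)` if `d ≤ n`; it is also at most `n`, which is `O(d log n)` if
`n ≤ d` (`min_maxDepth_le`). For the space,
about `n ^ (δ - γ)` records of size `O(d + n ^ γ)` fit into `O(n ^ δ * d * log n)` words, and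
`n ^ (1 - δ + γ)` machines are enough to hold all the records (`parameter_bounds`).
-/

noncomputable section

namespace PrivateKMedian

/-! ### Lists of words of a fixed length -/

theorem flatMap_eq_flatMap {ι W : Type*} {l : List ι} {f f' : ι → List W}
    (hlen : ∀ p ∈ l, (f p).length = (f' p).length) (h : l.flatMap f = l.flatMap f') :
    ∀ p ∈ l, f p = f' p := by
  induction l with
  | nil => simp
  | cons a l ih =>
    rw [List.flatMap_cons, List.flatMap_cons] at h
    obtain ⟨h1, h2⟩ := List.append_inj h (hlen a (by simp))
    intro p hp
    rcases List.mem_cons.1 hp with rfl | hp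
    · exact h1
    · exact ih (fun p hp => hlen p (List.mem_cons_of_mem _ hp)) h2 p hp

theorem length_flatMap_of_length_eq {ι W : Type*} {l : List ι} {f : ι → List W} {L : ℕ}
    (hlen : ∀ p ∈ l, (f p).length = L) : (l.flatMap f).length = L * l.length := by
  induction l with
  | nil => simp
  | cons a l ih =>
    rw [List.flatMap_cons, List.length_append, hlen a (by simp),
      ih fun p hp => hlen p (List.mem_cons_of_mem _ hp), List.length_cons]
    ring

theorem flatten_injective {W : Type*} {L : ℕ} (hL : 0 < L) {l l' : List (List W)}
    (hl : ∀ w ∈ l, w.length = L) (hl' : ∀ w ∈ l', w.length = L) (h : l.flatten = l'.flatten) :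
    l = l' := by
  induction l generalizing l' with
  | nil =>
    cases l' with
    | nil => rfl
    | cons a l' =>
      have := hl' a (by simp)
      have h2 := congrArg List.length h
      rw [List.flatten_cons, List.length_append, List.flatten_nil, List.length_nil] at h2
      omega
  | cons a l ih =>
    cases l' with
    | nil =>
      have := hl a (by simp)
      have h2 := congrArg List.length h
      rw [List.flatten_cons, List.length_append, List.flatten_nil, List.length_nil] at h2
      omega
    | cons a' l' =>
      rw [List.flatten_cons, List.flatten_cons] at h
      obtain ⟨h1, h2⟩ := List.append_inj h ((hl a (by simp)).trans (hl' a' (by simp)).symm)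
      rw [h1, ih (fun w hw => hl w (List.mem_cons_of_mem _ hw))
        (fun w hw => hl' w (List.mem_cons_of_mem _ hw)) h2]

/-! ### Runs described by what each machine knows -/

section Framework

variable {X : Type*} {m : ℕ} {W : Type}

/-- The message that consists of a set of packets. -/
def packetWords (S : Finset (List W)) : List W := S.toList.flatten

theorem packetWords_injective {L : ℕ} (hL : 0 < L) {S S' : Finset (List W)}
    (hS : ∀ w ∈ S, w.length = L) (hS' : ∀ w ∈ S', w.length = L)
    (h : packetWords S = packetWords S') : S = S' := by
  classical
  have := flatten_injective hL (by simpa using hS) (by simpa using hS') h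
  rw [← Finset.toList_toFinset S, this, Finset.toList_toFinset]

theorem length_packetWords {L : ℕ} {S : Finset (List W)} (hS : ∀ w ∈ S, w.length = L) :
    (packetWords S).length = L * S.card := by
  rw [packetWords, ← List.flatMap_id, length_flatMap_of_length_eq (L := L) (by simpa using hS),
    Finset.length_toList]

/-- One round of communication, described for all inputs `x : X` at once: `M x i` and `M' x i` are
the memories of machine `i` before and after the round on the input `x`, and `Pk x i i'` is the set
of packets, all of length `L`, sent from `i` to `i'`. A machine can carry out such a round because
the packets it sends depend on the input only through its memory, and its new memory only through
its old memory and the received packets. -/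
def Step (s : ℕ) (M M' : X → Fin m → List W) : Prop :=
  ∃ (L : ℕ) (Pk : X → Fin m → Fin m → Finset (List W)), 0 < L ∧
    (∀ x i i', ∀ w ∈ Pk x i i', w.length = L) ∧
    (∀ x x' i, M x i = M x' i → ∀ i', Pk x i i' = Pk x' i i') ∧
    (∀ x x' i, M x i = M x' i → (∀ i', Pk x i' i = Pk x' i' i) → M' x i = M' x' i) ∧
    (∀ x i, L * ∑ i', (Pk x i i').card ≤ s) ∧ (∀ x i, L * ∑ i', (Pk x i' i).card ≤ s) ∧
    ∀ x i, (M' x i).length ≤ s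

/-- `Reach s r M M'`: the memories `M` can be turned into the memories `M'` in `r` rounds. -/
inductive Reach (s : ℕ) : ℕ → (X → Fin m → List W) → (X → Fin m → List W) → Prop
  | refl (M) : Reach s 0 M M
  | head {r M M' M''} : Step s M M' → Reach s r M' M'' → Reach s (r + 1) M M''

theorem Reach.trans {s r r' : ℕ} {M M' M'' : X → Fin m → List W} (h : Reach s r M M')
    (h' : Reach s r' M' M'') : Reach s (r + r') M M'' := by
  induction h with
  | refl => rwa [Nat.zero_add]
  | head h1 _ ih =>
    rw [Nat.add_right_comm]
    exact .head h1 (ih h')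

theorem Step.reach {s : ℕ} {M M' : X → Fin m → List W} (h : Step s M M') : Reach s 1 M M' :=
  .head h (.refl _)

theorem Reach.of_steps {s : ℕ} (M : ℕ → X → Fin m → List W) (R : ℕ)
    (h : ∀ t < R, Step s (M t) (M (t + 1))) : Reach s R (M 0) (M R) := by
  induction R with
  | zero => exact .refl _
  | succ R ih => exact (ih fun t ht => h t (by omega)).trans (h R (by omega)).reach

theorem Reach.exists_steps {s R : ℕ} {M M' : X → Fin m → List W} (h : Reach s R M M') :
    ∃ Ms : ℕ → X → Fin m → List W, Ms 0 = M ∧ Ms R = M' ∧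
      ∀ t < R, Step s (Ms t) (Ms (t + 1)) := by
  induction h with
  | refl M => exact ⟨fun _ => M, rfl, rfl, by simp⟩
  | @head r M M' M'' h1 _ ih =>
    obtain ⟨Ms, h0, hR, hs⟩ := ih
    refine ⟨fun t => match t with | 0 => M | t + 1 => Ms t, rfl, hR, ?_⟩
    rintro (_ | t) ht
    · simpa [h0] using h1
    · exact hs t (by omega)

/-- A round given by a family of packets with sources, destinations and contents. It suffices that
the memory of a machine determines which packets the machine sends, and that its memory and the
received packets determine its new memory. -/
theorem Step.of_packets {ι : Type*} {s : ℕ} {M M' : X → Fin m → List W} (L : ℕ) (hL : 0 < L)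
    (A : X → Finset ι) (src dst : X → ι → Fin m) (pay : X → ι → List W)
    (hlen : ∀ x, ∀ p ∈ A x, (pay x p).length = L)
    (hsend : ∀ x x' i, M x i = M x' i → ∀ p ∈ A x, src x p = i →
      ∃ p' ∈ A x', src x' p' = i ∧ dst x' p' = dst x p ∧ pay x' p' = pay x p)
    (hrecv : ∀ x x' i, M x i = M x' i →
      (∀ p ∈ A x, dst x p = i → ∃ p' ∈ A x', dst x' p' = i ∧ pay x' p' = pay x p) →
      (∀ p ∈ A x', dst x' p = i → ∃ p' ∈ A x, dst x p' = i ∧ pay x p' = pay x' p) →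
      M' x i = M' x' i)
    (hout : ∀ x i, L * ((A x).filter fun p => src x p = i).card ≤ s)
    (hin : ∀ x i, L * ((A x).filter fun p => dst x p = i).card ≤ s)
    (hmem : ∀ x i, (M' x i).length ≤ s) : Step s M M' := by
  classical
  have hsend' : ∀ x x' i i', M x i = M x' i →
      ((A x).filter fun p => src x p = i ∧ dst x p = i').image (pay x) ⊆
      ((A x').filter fun p => src x' p = i ∧ dst x' p = i').image (pay x') := by
    intro x x' i i' h w hw
    simp only [Finset.mem_image, Finset.mem_filter] at hw ⊢
    obtain ⟨p, ⟨hp, hs, hd⟩, rfl⟩ := hw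
    obtain ⟨p', hp', hs', hd', hw'⟩ := hsend x x' i h p hp hs
    exact ⟨p', ⟨hp', hs', hd'.trans hd⟩, hw'⟩
  have hrecv' : ∀ x x' i, (∀ i', ((A x).filter fun p => src x p = i' ∧ dst x p = i).image (pay x) =
      ((A x').filter fun p => src x' p = i' ∧ dst x' p = i).image (pay x')) →
      ∀ p ∈ A x, dst x p = i → ∃ p' ∈ A x', dst x' p' = i ∧ pay x' p' = pay x p := by
    intro x x' i h p hp hd
    have hm : pay x p ∈ ((A x).filter fun q => src x q = src x p ∧ dst x q = i).image (pay x) :=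
      Finset.mem_image_of_mem _ (Finset.mem_filter.2 ⟨hp, rfl, hd⟩)
    rw [h, Finset.mem_image] at hm
    obtain ⟨p', hp', hw⟩ := hm
    exact ⟨p', (Finset.mem_filter.1 hp').1, (Finset.mem_filter.1 hp').2.2, hw⟩
  refine ⟨L, fun x i i' => ((A x).filter fun p => src x p = i ∧ dst x p = i').image (pay x), hL,
    ?_, ?_, ?_, ?_, ?_, hmem⟩
  · intro x i i' w hw
    obtain ⟨p, hp, rfl⟩ := Finset.mem_image.1 hw
    exact hlen x p (Finset.mem_filter.1 hp).1
  · exact fun x x' i h i' => (hsend' x x' i i' h).antisymm (hsend' x' x i i' h.symm)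
  · exact fun x x' i h hp => hrecv x x' i h (hrecv' x x' i hp)
      (hrecv' x' x i fun i' => (hp i').symm)
  · refine fun x i => (Nat.mul_le_mul_left L ?_).trans (hout x i)
    rw [Finset.card_eq_sum_card_fiberwise (f := dst x) (t := Finset.univ) (by simp [Set.MapsTo])]
    refine Finset.sum_le_sum fun i' _ => Finset.card_image_le.trans ?_
    rw [Finset.filter_filter]
  · refine fun x i => (Nat.mul_le_mul_left L ?_).trans (hin x i)
    rw [Finset.card_eq_sum_card_fiberwise (f := src x) (t := Finset.univ) (by simp [Set.MapsTo])]
    refine Finset.sum_le_sum fun i' _ => Finset.card_image_le.trans ?_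
    rw [Finset.filter_filter]
    simp only [and_comm, le_refl]

open Classical in
/-- If, for all outcomes of the random source, the memories `init` can be turned into `fin` in `R`
rounds, then an algorithm does so. -/
theorem exists_algorithm_of_reach {s R : ℕ} (Ω : Type) (mΩ : MeasurableSpace Ω) (μ : Measure Ω)
    (hμ : IsProbabilityMeasure μ) (init : X → Fin m → List W) (fin : Ω → X → Fin m → List W)
    (hinit : ∀ x i, (init x i).length ≤ s) (h : ∀ ω, Reach s R init (fin ω)) :
    ∃ (send : ℕ → Ω → Fin m → List W → Fin m → List W)
      (update : ℕ → Ω → Fin m → List W → (Fin m → List W) → List W),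
      let A : MPCAlgorithm m W := ⟨Ω, mΩ, μ, hμ, R, send, update⟩
      ∀ ω x, A.RunsInSpace s ω (init x) ∧ A.memory ω (init x) R = fin ω x := by
  choose Ms h0 hR hstep using fun ω => (h ω).exists_steps
  have hstep' : ∀ ω t, ∃ (L : ℕ) (Pk : X → Fin m → Fin m → Finset (List W)), t < R → (0 < L ∧
    (∀ x i i', ∀ w ∈ Pk x i i', w.length = L) ∧
    (∀ x x' i, Ms ω t x i = Ms ω t x' i → ∀ i', Pk x i i' = Pk x' i i') ∧
    (∀ x x' i, Ms ω t x i = Ms ω t x' i → (∀ i', Pk x i' i = Pk x' i' i) →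
      Ms ω (t + 1) x i = Ms ω (t + 1) x' i) ∧
    (∀ x i, L * ∑ i', (Pk x i i').card ≤ s) ∧ (∀ x i, L * ∑ i', (Pk x i' i).card ≤ s) ∧
    ∀ x i, (Ms ω (t + 1) x i).length ≤ s) := fun ω t => by
    by_cases ht : t < R
    · obtain ⟨L, Pk, h⟩ := hstep ω t ht
      exact ⟨L, Pk, fun _ => h⟩
    · exact ⟨0, fun _ _ _ => ∅, fun h => absurd h ht⟩
  choose L Pk hPk using hstep'
  let send : ℕ → Ω → Fin m → List W → Fin m → List W := fun t ω i mem i' =>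
    if hx : t < R ∧ ∃ x, Ms ω t x i = mem then packetWords (Pk ω t hx.2.choose i i') else []
  let update : ℕ → Ω → Fin m → List W → (Fin m → List W) → List W := fun t ω i mem inbox =>
    if hx : ∃ x, Ms ω t x i = mem ∧ ∀ i', packetWords (Pk ω t x i' i) = inbox i'
    then Ms ω (t + 1) hx.choose i else []
  have hsend : ∀ t < R, ∀ ω x i i',
      send t ω i (Ms ω t x i) i' = packetWords (Pk ω t x i i') := by
    intro t ht ω x i i'
    have hx : t < R ∧ ∃ x', Ms ω t x' i = Ms ω t x i := ⟨ht, x, rfl⟩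
    simp only [send]
    rw [dif_pos hx, (hPk ω t ht).2.2.1 _ _ i hx.2.choose_spec]
  have hupdate : ∀ t < R, ∀ ω x i,
      update t ω i (Ms ω t x i) (fun i' => packetWords (Pk ω t x i' i)) = Ms ω (t + 1) x i := by
    intro t ht ω x i
    have hx : ∃ x', Ms ω t x' i = Ms ω t x i ∧
        ∀ i', packetWords (Pk ω t x' i' i) = packetWords (Pk ω t x i' i) := ⟨x, rfl, fun _ => rfl⟩
    simp only [update]
    rw [dif_pos hx]
    obtain ⟨hL, hlen, -, hdet, -⟩ := hPk ω t ht
    exact hdet _ _ i hx.choose_spec.1 fun i' =>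
      packetWords_injective hL (hlen _ _ _) (hlen _ _ _) (hx.choose_spec.2 i')
  refine ⟨send, update, ?_⟩
  intro A ω x
  have hmem : ∀ t ≤ R, A.memory ω (init x) t = Ms ω t x := by
    intro t ht
    induction t with
    | zero => rw [h0]; rfl
    | succ t ih =>
      funext i
      have h1 : A.memory ω (init x) (t + 1) i = update t ω i (A.memory ω (init x) t i)
        (fun i' => send t ω i' (A.memory ω (init x) t i') i) := rfl
      rw [h1, ih (by omega)]
      simp only [hsend t ht]
      exact hupdate t ht ω x i
  have hmsg : ∀ t < R, ∀ i i', A.message ω (init x) t i i' = packetWords (Pk ω t x i i') := by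
    intro t ht i i'
    have h1 : A.message ω (init x) t i i' = send t ω i (A.memory ω (init x) t i) i' := rfl
    rw [h1, hmem t ht.le, hsend t ht]
  refine ⟨⟨fun t ht i => ?_, fun t ht i => ?_⟩, by rw [hmem R le_rfl, hR]⟩
  · rw [hmem t ht]
    rcases t with _ | t
    · rw [h0]; exact hinit x i
    · exact (hPk ω t ht).2.2.2.2.2.2 x i
  · obtain ⟨hL, hlen, -, -, hout, hin, -⟩ := hPk ω t ht
    simp only [hmsg t ht, length_packetWords (hlen _ _ _), ← Finset.mul_sum]
    exact ⟨hout x i, hin x i⟩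

end Framework

/-! ### Sorting networks of block sorters -/

/-- A layer of a sorting network on the positions `0, 1, …`: the positions are distributed over
machines by `mach`, and each machine `v` with `flag v` sorts the items at its positions, in place. -/
structure Layer where
  mach : ℕ → ℕ
  flag : ℕ → Prop

namespace Layer

open Classical in
/-- The positions below `N` that are held by machine `v`. -/
def fiber (l : Layer) (N v : ℕ) : Finset ℕ := (Finset.range N).filter fun p => l.mach p = v

theorem mem_fiber {l : Layer} {N v p : ℕ} : p ∈ l.fiber N v ↔ p < N ∧ l.mach p = v := by
  simp [fiber]

open Classical in
/-- The effect of a layer on the set of positions whose item is below a fixed threshold: `Z` before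
the layer, `Z'` after it. By the 0-1 principle, this is all that matters for sorting. -/
def Rel (l : Layer) (N : ℕ) (Z Z' : Set ℕ) : Prop := ∀ v,
  ((l.fiber N v).filter (· ∈ Z')).card = ((l.fiber N v).filter (· ∈ Z)).card ∧
  (l.flag v → ∀ p ∈ l.fiber N v, ∀ q ∈ l.fiber N v, p < q → q ∈ Z' → p ∈ Z') ∧
  (¬ l.flag v → ∀ p ∈ l.fiber N v, (p ∈ Z' ↔ p ∈ Z))

variable {l : Layer} {N v p : ℕ} {Z Z' : Set ℕ}

theorem Rel.mem_of_forall_le (h : l.Rel N Z Z') (hp : p ∈ l.fiber N v)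
    (hZ : ∀ q ∈ l.fiber N v, q ≤ p → q ∈ Z) : p ∈ Z' := by
  classical
  obtain ⟨hc, hs, hn⟩ := h v
  by_cases hf : l.flag v
  · by_contra hpZ
    have h1 : (l.fiber N v).filter (· ∈ Z') ⊂ (l.fiber N v).filter (· ≤ p) := by
      rw [Finset.ssubset_iff_of_subset]
      · exact ⟨p, by simp [hp], by simp [hpZ]⟩
      · intro q hq
        rw [Finset.mem_filter] at hq ⊢
        refine ⟨hq.1, ?_⟩
        by_contra hlt
        exact hpZ (hs hf p hp q hq.1 (by omega) hq.2)
    have h2 : (l.fiber N v).filter (· ≤ p) ⊆ (l.fiber N v).filter (· ∈ Z) := by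
      intro q hq
      rw [Finset.mem_filter] at hq ⊢
      exact ⟨hq.1, hZ q hq.1 hq.2⟩
    have := Finset.card_lt_card h1
    have := Finset.card_le_card h2
    omega
  · exact (hn hf p hp).2 (hZ p hp le_rfl)

theorem Rel.notMem_of_forall_ge (h : l.Rel N Z Z') (hp : p ∈ l.fiber N v)
    (hZ : ∀ q ∈ l.fiber N v, p ≤ q → q ∉ Z) : p ∉ Z' := by
  classical
  obtain ⟨hc, hs, hn⟩ := h v
  by_cases hf : l.flag v
  · intro hpZ
    have h1 : (l.fiber N v).filter (· ∈ Z) ⊆ (l.fiber N v).filter (· < p) := by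
      intro q hq
      rw [Finset.mem_filter] at hq ⊢
      refine ⟨hq.1, ?_⟩
      by_contra hlt
      exact hZ q hq.1 (by omega) hq.2
    have h2 : (l.fiber N v).filter (· < p) ⊂ (l.fiber N v).filter (· ∈ Z') := by
      rw [Finset.ssubset_iff_of_subset]
      · exact ⟨p, by simp [hp, hpZ], by simp⟩
      · intro q hq
        rw [Finset.mem_filter] at hq ⊢
        exact ⟨hq.1, hs hf q hq.1 p hp hq.2 hpZ⟩
    have := Finset.card_lt_card h2
    have := Finset.card_le_card h1
    omega
  · exact fun hpZ => hZ p hp le_rfl ((hn hf p hp).1 hpZ)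

open Classical in
theorem Rel.card_eq (h : l.Rel N Z Z') :
    ((Finset.range N).filter (· ∈ Z')).card = ((Finset.range N).filter (· ∈ Z)).card := by
  rw [Finset.card_eq_sum_card_fiberwise (f := l.mach) (t := (Finset.range N).image l.mach),
    Finset.card_eq_sum_card_fiberwise (f := l.mach) (s := (Finset.range N).filter (· ∈ Z))
      (t := (Finset.range N).image l.mach)]
  · refine Finset.sum_congr rfl fun v _ => ?_
    have := (h v).1
    simp only [fiber, Finset.filter_filter] at this ⊢
    simpa only [and_comm] using this
  all_goals
    intro p hp
    exact Finset.mem_coe.2 (Finset.mem_image_of_mem _ (Finset.mem_filter.1 hp).1)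

end Layer

/-- The effect of several layers on the set of positions whose item is below a threshold. -/
inductive Run (N : ℕ) : List Layer → Set ℕ → Set ℕ → Prop
  | nil (Z) : Run N [] Z Z
  | cons {l ls Z Z' Z''} : l.Rel N Z Z' → Run N ls Z' Z'' → Run N (l :: ls) Z Z''

theorem Run.append {N : ℕ} {ls ls' : List Layer} {Z Z'' : Set ℕ} (h : Run N (ls ++ ls') Z Z'') :
    ∃ Z', Run N ls Z Z' ∧ Run N ls' Z' Z'' := by
  induction ls generalizing Z with
  | nil => exact ⟨Z, .nil Z, h⟩
  | cons l ls ih =>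
    rcases h with _ | ⟨h1, h2⟩
    obtain ⟨Z', h3, h4⟩ := ih h2
    exact ⟨Z', .cons h1 h3, h4⟩

open Classical in
theorem Run.card_eq {N : ℕ} {ls : List Layer} {Z Z' : Set ℕ} (h : Run N ls Z Z') :
    ((Finset.range N).filter (· ∈ Z')).card = ((Finset.range N).filter (· ∈ Z)).card := by
  induction h with
  | nil => rfl
  | cons h _ ih => exact ih.trans h.card_eq

/-- There is a network of `T` layers that sorts the positions below `N`, with `M` machines that hold
at most `b` positions each. -/
def Sorter (N M b T : ℕ) : Prop :=
  ∃ ls : List Layer, ls.length = T ∧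
    (∀ l ∈ ls, (∀ p < N, l.mach p < M) ∧ ∀ v, (l.fiber N v).card ≤ b) ∧
    ∀ Z Z', Run N ls Z Z' → ∀ p q, p < q → q < N → q ∈ Z' → p ∈ Z'

theorem sorter_self (N : ℕ) : Sorter N 1 N 1 := by
  refine ⟨[⟨fun _ => 0, fun _ => True⟩], rfl, ?_, ?_⟩
  · simp only [List.mem_singleton, forall_eq, Nat.lt_one_iff, implies_true, true_and]
    intro v
    exact (Finset.card_filter_le _ _).trans (by simp)
  · rintro Z Z' h p q hpq hq hZ
    rcases h with _ | ⟨h, h'⟩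
    cases h'
    exact (h 0).2.1 trivial p (by simp [Layer.mem_fiber]; omega) q (by simp [Layer.mem_fiber, hq])
      hpq hZ

/-- A division of the positions below `N` into `c` classes of `r` positions each: the `j`-th
position of the class `q` is `pos q j`. The positions in a class `q` with `on q` are enumerated in
increasing order. -/
structure Division (N r c : ℕ) where
  cls : ℕ → ℕ
  rk : ℕ → ℕ
  pos : ℕ → ℕ → ℕ
  on : ℕ → Prop
  cls_lt : ∀ p < N, cls p < c
  rk_lt : ∀ p < N, rk p < r
  pos_cls_rk : ∀ p < N, pos (cls p) (rk p) = p
  pos_lt : ∀ q < c, ∀ j < r, pos q j < N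
  cls_pos : ∀ q < c, ∀ j < r, cls (pos q j) = q
  rk_pos : ∀ q < c, ∀ j < r, rk (pos q j) = j
  pos_strictMono : ∀ q < c, on q → ∀ j j', j < j' → j' < r → pos q j < pos q j'

namespace Division

variable {N r c M : ℕ} (D : Division N r c)

/-- The layer in which each machine holds one class. -/
def layer : Layer := ⟨D.cls, D.on⟩

/-- The layer that, in parallel, applies the layer `l` to each class that is `on`; the class `q` uses
the machines `q * M, …, q * M + M - 1`. -/
def lift (M : ℕ) (l : Layer) : Layer :=
  ⟨fun p => D.cls p * M + l.mach (D.rk p), fun v => D.on (v / M) ∧ l.flag (v % M)⟩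

theorem fiber_lift {l : Layer} (hl : ∀ p < r, l.mach p < M) {q v : ℕ} (hq : q < c) (hv : v < M) :
    (D.lift M l).fiber N (q * M + v) = (l.fiber r v).image (D.pos q) := by
  classical
  ext p
  simp only [Layer.mem_fiber, Finset.mem_image, lift]
  constructor
  · rintro ⟨hp, he⟩
    have h1 := hl _ (D.rk_lt p hp)
    have h2 : D.cls p = q := by
      have := congrArg (· / M) he
      simpa [Nat.mul_comm _ M, Nat.mul_add_div (by omega : 0 < M), Nat.div_eq_of_lt h1,
        Nat.div_eq_of_lt hv] using this
    subst h2
    exact ⟨D.rk p, ⟨D.rk_lt p hp, by omega⟩, D.pos_cls_rk p hp⟩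
  · rintro ⟨j, ⟨hj, rfl⟩, rfl⟩
    exact ⟨D.pos_lt q hq j hj, by rw [D.cls_pos q hq j hj, D.rk_pos q hq j hj]⟩

theorem pos_injOn {q : ℕ} (hq : q < c) : Set.InjOn (D.pos q) (Set.Iio r) := fun j hj j' hj' h => by
  rw [← D.rk_pos q hq j hj, h, D.rk_pos q hq j' hj']

theorem card_fiber_lift_le {l : Layer} {b : ℕ} (hl : ∀ p < r, l.mach p < M)
    (hb : ∀ v, (l.fiber r v).card ≤ b) (w : ℕ) : ((D.lift M l).fiber N w).card ≤ b := by
  classical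
  rcases Finset.eq_empty_or_nonempty ((D.lift M l).fiber N w) with h | ⟨p, hp⟩
  · simp [h]
  · obtain ⟨hpN, rfl⟩ := Layer.mem_fiber.1 hp
    have : (D.lift M l).mach p = D.cls p * M + l.mach (D.rk p) := rfl
    rw [this, D.fiber_lift hl (D.cls_lt p hpN) (hl _ (D.rk_lt p hpN))]
    exact Finset.card_image_le.trans (hb _)

open Classical in
theorem card_filter_image {q : ℕ} (hq : q < c) (S : Finset ℕ) (hS : ∀ j ∈ S, j < r) (Z : Set ℕ) :
    ((S.image (D.pos q)).filter (· ∈ Z)).card = (S.filter (· ∈ {j | D.pos q j ∈ Z})).card := by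
  rw [Finset.filter_image, Finset.card_image_of_injOn]
  · rfl
  · exact (D.pos_injOn hq).mono fun j hj => hS j (Finset.mem_filter.1 hj).1

theorem rel_of_lift {l : Layer} (hl : ∀ p < r, l.mach p < M) {Z Z' : Set ℕ}
    (h : (D.lift M l).Rel N Z Z') {q : ℕ} (hq : q < c) (hon : D.on q) :
    l.Rel r {j | D.pos q j ∈ Z} {j | D.pos q j ∈ Z'} := by
  classical
  intro v
  rcases Nat.lt_or_ge v M with hv | hv
  · have hM : 0 < M := by omega
    obtain ⟨h1, h2, h3⟩ := h (q * M + v)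
    have hS : ∀ j ∈ l.fiber r v, j < r := fun j hj => (Layer.mem_fiber.1 hj).1
    have hflag : (D.lift M l).flag (q * M + v) ↔ l.flag v := by
      simp [lift, Nat.mul_comm q M, Nat.mul_add_div hM, Nat.div_eq_of_lt hv, Nat.mod_eq_of_lt hv,
        hon]
    rw [D.fiber_lift hl hq hv] at h1 h2 h3
    rw [hflag] at h2 h3
    rw [D.card_filter_image hq _ hS, D.card_filter_image hq _ hS] at h1
    refine ⟨h1, fun hf p hp p' hp' hlt => ?_, fun hf p hp => ?_⟩
    · exact h2 hf _ (Finset.mem_image_of_mem _ hp) _ (Finset.mem_image_of_mem _ hp')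
        (D.pos_strictMono q hq hon p p' hlt (hS _ hp'))
    · exact h3 hf _ (Finset.mem_image_of_mem _ hp)
  · have : l.fiber r v = ∅ := by
      ext j
      simp only [Layer.mem_fiber, Finset.notMem_empty, iff_false, not_and]
      intro hj
      have := hl j hj
      omega
    simp [this]

theorem mem_iff_of_lift {l : Layer} (hl : ∀ p < r, l.mach p < M) {Z Z' : Set ℕ}
    (h : (D.lift M l).Rel N Z Z') {q j : ℕ} (hq : q < c) (hon : ¬ D.on q) (hj : j < r) :
    D.pos q j ∈ Z' ↔ D.pos q j ∈ Z := by
  have hm := hl j hj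
  refine (h (q * M + l.mach j)).2.2 ?_ _ ?_
  · simp [lift, Nat.mul_comm q M, Nat.mul_add_div (by omega : 0 < M), Nat.div_eq_of_lt hm, hon]
  · rw [Layer.mem_fiber]
    refine ⟨D.pos_lt q hq j hj, ?_⟩
    simp only [lift]
    rw [D.cls_pos q hq j hj, D.rk_pos q hq j hj]

theorem run_of_lift {ls : List Layer} (hls : ∀ l ∈ ls, ∀ p < r, l.mach p < M) {Z Z' : Set ℕ}
    (h : Run N (ls.map (D.lift M)) Z Z') {q : ℕ} (hq : q < c) :
    (D.on q → Run r ls {j | D.pos q j ∈ Z} {j | D.pos q j ∈ Z'}) ∧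
    (¬ D.on q → ∀ j < r, (D.pos q j ∈ Z' ↔ D.pos q j ∈ Z)) := by
  induction ls generalizing Z with
  | nil =>
    cases h
    exact ⟨fun _ => .nil _, fun _ _ _ => Iff.rfl⟩
  | cons l ls ih =>
    rcases h with _ | ⟨h1, h2⟩
    obtain ⟨h3, h4⟩ := ih (fun l hl => hls l (List.mem_cons_of_mem _ hl)) h2
    have hl := hls l (by simp)
    exact ⟨fun hon => .cons (D.rel_of_lift hl h1 hq hon) (h3 hon), fun hon j hj =>
      (h4 hon j hj).trans (D.mem_iff_of_lift hl h1 hq hon hj)⟩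

/-- If `ls` sorts, then applying it to all classes sorts each class. -/
theorem rel_layer_of_run {ls : List Layer} (hls : ∀ l ∈ ls, ∀ p < r, l.mach p < M)
    (hsort : ∀ Z Z', Run r ls Z Z' → ∀ p q, p < q → q < r → q ∈ Z' → p ∈ Z') {Z Z' : Set ℕ}
    (h : Run N (ls.map (D.lift M)) Z Z') : D.layer.Rel N Z Z' := by
  classical
  intro q
  rcases Nat.lt_or_ge q c with hq | hq
  · have hfib : D.layer.fiber N q = (Finset.range r).image (D.pos q) := by
      ext p
      simp only [Layer.mem_fiber, Finset.mem_image, Finset.mem_range, layer]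
      constructor
      · rintro ⟨hp, rfl⟩
        exact ⟨D.rk p, D.rk_lt p hp, D.pos_cls_rk p hp⟩
      · rintro ⟨j, hj, rfl⟩
        exact ⟨D.pos_lt q hq j hj, D.cls_pos q hq j hj⟩
    obtain ⟨h1, h2⟩ := D.run_of_lift hls h hq
    refine ⟨?_, fun hon => ?_, fun hon => ?_⟩
    · rw [hfib, D.card_filter_image hq _ (by simp), D.card_filter_image hq _ (by simp)]
      by_cases hon : D.on q
      · exact (h1 hon).card_eq
      · congr 1
        exact Finset.filter_congr fun j hj => h2 hon j (Finset.mem_range.1 hj)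
    · rw [hfib]
      intro p hp p' hp' hlt hZ
      obtain ⟨j, hj, rfl⟩ := Finset.mem_image.1 hp
      obtain ⟨j', hj', rfl⟩ := Finset.mem_image.1 hp'
      rw [Finset.mem_range] at hj hj'
      refine hsort _ _ (h1 hon) j j' ?_ hj' hZ
      by_contra hle
      rcases Nat.eq_or_lt_of_le (not_lt.1 hle) with h | h
      · rw [h] at hlt; exact absurd hlt (lt_irrefl _)
      · exact absurd (D.pos_strictMono q hq hon j' j h hj) (by omega)
    · rw [hfib]
      intro p hp
      obtain ⟨j, hj, rfl⟩ := Finset.mem_image.1 hp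
      exact h2 hon j (Finset.mem_range.1 hj)
  · have : D.layer.fiber N q = ∅ := by
      ext p
      simp only [Layer.mem_fiber, Finset.notMem_empty, iff_false, not_and, layer]
      intro hp
      have := D.cls_lt p hp
      omega
    simp [this]

/-- The division into blocks of consecutive positions. -/
def blocks (r c : ℕ) : Division (r * c) r c where
  cls p := p / r
  rk p := p % r
  pos q j := q * r + j
  on _ := True
  cls_lt p hp := Nat.div_lt_of_lt_mul hp
  rk_lt p hp := Nat.mod_lt _ (Nat.pos_of_ne_zero (by rintro rfl; simp at hp))
  pos_cls_rk p _ := by rw [Nat.mul_comm]; exact Nat.div_add_mod p r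
  pos_lt q hq j hj := by nlinarith
  cls_pos q _ j hj := by
    rw [Nat.mul_comm, Nat.mul_add_div (by omega), Nat.div_eq_of_lt hj, Nat.add_zero]
  rk_pos q _ j hj := by rw [Nat.mul_comm, Nat.mul_add_mod, Nat.mod_eq_of_lt hj]
  pos_strictMono q _ _ j j' h _ := by omega

/-- The division into residue classes. -/
def residues (r c : ℕ) : Division (r * c) r c where
  cls p := p % c
  rk p := p / c
  pos q j := j * c + q
  on _ := True
  cls_lt p hp := Nat.mod_lt _ (Nat.pos_of_ne_zero (by rintro rfl; simp at hp))
  rk_lt p hp := Nat.div_lt_of_lt_mul (by rwa [Nat.mul_comm])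
  pos_cls_rk p _ := by rw [Nat.mul_comm]; exact Nat.div_add_mod p c
  pos_lt q hq j hj := by nlinarith
  cls_pos q hq j _ := by rw [Nat.mul_comm, Nat.mul_add_mod, Nat.mod_eq_of_lt hq]
  rk_pos q hq j _ := by
    rw [Nat.mul_comm, Nat.mul_add_div (by omega), Nat.div_eq_of_lt hq, Nat.add_zero]
  pos_strictMono q _ _ j j' h _ := by
    have := Nat.mul_lt_mul_of_pos_right h (by omega : 0 < c)
    omega

/-- The blocks shifted cyclically by `h` positions. The last one, which wraps around, is not
sorted. -/
def shifted (r c h : ℕ) (hh : h ≤ r) : Division (r * c) r c where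
  cls p := ((p + (r * c - h)) % (r * c)) / r
  rk p := ((p + (r * c - h)) % (r * c)) % r
  pos q j := (q * r + j + h) % (r * c)
  on q := q + 1 < c
  cls_lt p hp := Nat.div_lt_of_lt_mul (Nat.mod_lt _ (by omega))
  rk_lt p hp := Nat.mod_lt _ (Nat.pos_of_ne_zero (by rintro rfl; simp at hp))
  pos_cls_rk p hp := by
    have hc : 1 ≤ c := Nat.pos_of_ne_zero (by rintro rfl; simp at hp)
    have : h ≤ r * c := hh.trans (Nat.le_mul_of_pos_right r hc)
    rw [Nat.mul_comm (_ / r), Nat.div_add_mod, Nat.mod_add_mod,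
      show p + (r * c - h) + h = p + r * c by omega, Nat.add_mod_right, Nat.mod_eq_of_lt hp]
  pos_lt q hq j hj := Nat.mod_lt _ (Nat.mul_pos (by omega) (by omega))
  cls_pos q hq j hj := by
    have : h ≤ r * c := hh.trans (Nat.le_mul_of_pos_right r (by omega))
    have : q * r + j < r * c := by nlinarith
    rw [Nat.mod_add_mod, show q * r + j + h + (r * c - h) = q * r + j + r * c by omega,
      Nat.add_mod_right, Nat.mod_eq_of_lt this,
      Nat.mul_comm, Nat.mul_add_div (by omega), Nat.div_eq_of_lt hj, Nat.add_zero]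
  rk_pos q hq j hj := by
    have : h ≤ r * c := hh.trans (Nat.le_mul_of_pos_right r (by omega))
    have : q * r + j < r * c := by nlinarith
    rw [Nat.mod_add_mod, show q * r + j + h + (r * c - h) = q * r + j + r * c by omega,
      Nat.add_mod_right, Nat.mod_eq_of_lt this, Nat.mul_comm, Nat.mul_add_mod, Nat.mod_eq_of_lt hj]
  pos_strictMono q hq hon j j' hlt hj' := by
    have : (q + 2) * r ≤ c * r := Nat.mul_le_mul_right r hon
    have : q * r + j' + h < r * c := by nlinarith
    rw [Nat.mod_eq_of_lt this, Nat.mod_eq_of_lt (by omega)]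
    omega

end Division

theorem card_Ico_filter_mod (a z c ρ : ℕ) (hρ : ρ < c) :
    z / c ≤ ((Finset.Ico a (a + z)).filter fun p => p % c = ρ).card ∧
    ((Finset.Ico a (a + z)).filter fun p => p % c = ρ).card ≤ z / c + 1 := by
  have hc : (0 : ℚ) < c := by exact_mod_cast (by omega : 0 < c)
  have h := Nat.Ico_filter_modEq_card a (a + z) (r := c) (by omega) ρ
  have h1 : (Finset.Ico a (a + z)).filter (fun p => p % c = ρ) =
      (Finset.Ico a (a + z)).filter (· ≡ ρ [MOD c]) :=
    Finset.filter_congr fun p _ => by rw [Nat.ModEq, Nat.mod_eq_of_lt hρ]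
  rw [← h1] at h
  set x : ℚ := ((a : ℕ) - (ρ : ℕ) : ℚ) / (c : ℕ) with hx
  have h2 : (((a + z : ℕ) : ℚ) - (ρ : ℕ)) / (c : ℕ) = x + z / c := by
    rw [hx]; push_cast; ring
  rw [h2] at h
  have h3 : ((z / c : ℕ) : ℚ) ≤ z / c := Nat.cast_div_le
  have h4 : (z : ℚ) / c ≤ (z / c : ℕ) + 1 := by
    rw [div_le_iff₀ hc]
    have := Nat.lt_div_mul_add (a := z) (b := c) (by omega)
    have h5 : z ≤ (z / c + 1) * c := by nlinarith
    exact_mod_cast h5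
  have h5 : ⌈x⌉ + (z / c : ℕ) ≤ ⌈x + z / c⌉ := by
    rw [← Int.ceil_add_natCast]; exact Int.ceil_le_ceil (by linarith)
  have h6 : ⌈x + z / c⌉ ≤ ⌈x⌉ + ((z / c + 1 : ℕ)) := by
    rw [← Int.ceil_add_natCast]; exact Int.ceil_le_ceil (by push_cast; linarith)
  generalize z / c = y at h5 h6 ⊢
  omega

theorem eq_Ico_of_initial {A : Finset ℕ} {a b : ℕ} (hA : A ⊆ Finset.Ico a b)
    (h : ∀ p p', a ≤ p → p < p' → p' ∈ A → p ∈ A) : A = Finset.Ico a (a + A.card) := by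
  have hex : ∃ p, a ≤ p ∧ p ∉ A :=
    ⟨max a b, le_max_left _ _, fun hm => by have := Finset.mem_Ico.1 (hA hm); omega⟩
  have hs := Nat.find_spec hex
  have hA' : A = Finset.Ico a (Nat.find hex) := by
    ext p
    rw [Finset.mem_Ico]
    constructor
    · intro hp
      refine ⟨(Finset.mem_Ico.1 (hA hp)).1, ?_⟩
      by_contra hle
      rcases Nat.eq_or_lt_of_le (not_lt.1 hle) with he | hlt
      · exact hs.2 (he ▸ hp)
      · exact hs.2 (h _ p hs.1 hlt hp)
    · rintro ⟨h1, h2⟩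
      by_contra hp
      exact Nat.find_min hex h2 ⟨h1, hp⟩
  have hcard : A.card = Nat.find hex - a := (congrArg Finset.card hA').trans (Nat.card_Ico _ _)
  rw [hcard, Nat.add_sub_cancel' hs.1]
  exact hA'

open Classical in
/-- After the blocks have been sorted, all residue classes contain roughly the same number of
items below the threshold. -/
theorem exists_window {r c : ℕ} {Z Z₁ Z₂ : Set ℕ}
    (h₁ : (Division.blocks r c).layer.Rel (r * c) Z Z₁)
    (h₂ : (Division.residues r c).layer.Rel (r * c) Z₁ Z₂) :
    ∃ w, (∀ p < r * c, p < w → p ∈ Z₂) ∧ ∀ p < r * c, w + c * c ≤ p → p ∉ Z₂ := by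
  have hfib₁ : ∀ q < c, (Division.blocks r c).layer.fiber (r * c) q =
      Finset.Ico (q * r) (q * r + r) := fun q hq => by
    ext p
    rw [Layer.mem_fiber, Finset.mem_Ico]
    change p < r * c ∧ p / r = q ↔ _
    constructor
    · rintro ⟨hp, rfl⟩
      have h0 : 0 < r := Nat.pos_of_ne_zero (by rintro rfl; simp at hp)
      have := Nat.div_add_mod p r
      have := Nat.mod_lt p h0
      rw [Nat.mul_comm r] at *
      omega
    · rintro ⟨h1, h2⟩
      have h0 : (q + 1) * r ≤ c * r := Nat.mul_le_mul_right r hq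
      refine ⟨by nlinarith, ?_⟩
      rw [Nat.div_eq_iff (by omega)]
      omega
  -- the number of items of block `q` below the threshold
  set z : ℕ → ℕ := fun q => ((Finset.Ico (q * r) (q * r + r)).filter (· ∈ Z₁)).card with hz
  have hblock : ∀ q < c, (Finset.Ico (q * r) (q * r + r)).filter (· ∈ Z₁) =
      Finset.Ico (q * r) (q * r + z q) := fun q hq => by
    refine eq_Ico_of_initial (Finset.filter_subset _ _) fun p p' h1 h2 h3 => ?_
    rw [Finset.mem_filter, Finset.mem_Ico] at h3 ⊢
    refine ⟨⟨h1, by omega⟩, (h₁ q).2.1 trivial p ?_ p' ?_ h2 h3.2⟩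
    · rw [hfib₁ q hq, Finset.mem_Ico]; omega
    · rw [hfib₁ q hq, Finset.mem_Ico]; omega
  set y : ℕ → ℕ := fun ρ =>
    (((Division.residues r c).layer.fiber (r * c) ρ).filter (· ∈ Z₁)).card with hy
  set Y := ∑ q ∈ Finset.range c, z q / c with hY
  have hyY : ∀ ρ < c, Y ≤ y ρ ∧ y ρ ≤ Y + c := fun ρ hρ => by
    have h3 : y ρ = ∑ q ∈ Finset.range c,
        ((Finset.Ico (q * r) (q * r + z q)).filter fun p => p % c = ρ).card := by
      rw [hy]
      simp only
      rw [Finset.card_eq_sum_card_fiberwise (f := (· / r)) (t := Finset.range c)]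
      · refine Finset.sum_congr rfl fun q hq => ?_
        rw [← hblock q (Finset.mem_range.1 hq), ← hfib₁ q (Finset.mem_range.1 hq)]
        congr 1
        ext p
        simp only [Finset.mem_filter, Layer.mem_fiber, Division.layer, Division.blocks,
          Division.residues]
        tauto
      · intro p hp
        have := (Layer.mem_fiber.1 (Finset.mem_filter.1 hp).1).1
        exact Finset.mem_coe.2 (Finset.mem_range.2 (Nat.div_lt_of_lt_mul this))
    rw [h3]
    constructor
    · exact Finset.sum_le_sum fun q _ => (card_Ico_filter_mod _ _ _ _ hρ).1
    · refine (Finset.sum_le_sum fun q _ => (card_Ico_filter_mod _ _ _ _ hρ).2).trans ?_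
      rw [Finset.sum_add_distrib]
      simp [hY]
  -- the residue class `ρ` is sorted, and has `y ρ` items below the threshold
  have hZ₂ : ∀ p < r * c, (p ∈ Z₂ ↔ p / c < y (p % c)) := fun p hp => by
    have hc0 : 0 < c := Nat.pos_of_ne_zero (by rintro rfl; simp at hp)
    have hρ : p % c < c := Nat.mod_lt _ hc0
    obtain ⟨hcard, hs, -⟩ := h₂ (p % c)
    set D := Division.residues r c
    have hmem : ∀ j, j < r → j * c + p % c ∈ D.layer.fiber (r * c) (p % c) := fun j hj => by
      rw [Layer.mem_fiber]
      exact ⟨D.pos_lt _ hρ j hj, D.cls_pos _ hρ j hj⟩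
    have himg : ((D.layer.fiber (r * c) (p % c)).filter (· ∈ Z₂)).image (· / c) =
        Finset.Ico 0 (0 + y (p % c)) := by
      have hyc : y (p % c) =
          (((D.layer.fiber (r * c) (p % c)).filter (· ∈ Z₂)).image (· / c)).card := by
        rw [Finset.card_image_of_injOn, hcard]
        intro a ha b hb hab
        have ha' := (Layer.mem_fiber.1 (Finset.mem_filter.1 ha).1).2
        have hb' := (Layer.mem_fiber.1 (Finset.mem_filter.1 hb).1).2
        change a % c = _ at ha'
        change b % c = _ at hb'
        change a / c = b / c at hab
        rw [← Nat.div_add_mod a c, ← Nat.div_add_mod b c, ha', hb', hab]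
      rw [hyc]
      refine eq_Ico_of_initial (b := r) ?_ ?_
      · intro j hj
        obtain ⟨a, ha, rfl⟩ := Finset.mem_image.1 hj
        have := (Layer.mem_fiber.1 (Finset.mem_filter.1 ha).1).1
        exact Finset.mem_Ico.2 ⟨Nat.zero_le _, Nat.div_lt_of_lt_mul (by rwa [Nat.mul_comm])⟩
      · intro j j' _ hlt hj'
        obtain ⟨a, ha, rfl⟩ := Finset.mem_image.1 hj'
        obtain ⟨ha1, ha2⟩ := Finset.mem_filter.1 ha
        have ha3 := (Layer.mem_fiber.1 ha1).1
        have ha4 : a / c < r := Nat.div_lt_of_lt_mul (by rwa [Nat.mul_comm])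
        refine Finset.mem_image.2 ⟨j * c + p % c, Finset.mem_filter.2 ⟨hmem j (by omega), ?_⟩, ?_⟩
        · refine hs trivial _ (hmem j (by omega)) a ha1 ?_ ha2
          have h5 : a % c = p % c := (Layer.mem_fiber.1 ha1).2
          have := Nat.mul_lt_mul_of_pos_right hlt hc0
          have h6 := Nat.div_add_mod a c
          rw [Nat.mul_comm c] at h6
          omega
        · exact D.rk_pos _ hρ j (by omega)
    have := Finset.ext_iff.1 himg (p / c)
    rw [Finset.mem_image, Finset.mem_Ico] at this
    constructor
    · intro hpZ
      have := this.1 ⟨p, Finset.mem_filter.2 ⟨Layer.mem_fiber.2 ⟨hp, rfl⟩, hpZ⟩, rfl⟩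
      omega
    · intro hlt
      obtain ⟨a, ha, hap⟩ := this.2 ⟨Nat.zero_le _, by omega⟩
      obtain ⟨ha1, ha2⟩ := Finset.mem_filter.1 ha
      have h5 : a % c = p % c := (Layer.mem_fiber.1 ha1).2
      rwa [← Nat.div_add_mod p c, ← hap, ← h5, Nat.div_add_mod]
  refine ⟨Y * c, fun p hp hlt => ?_, fun p hp hle => ?_⟩
  · have hc0 : 0 < c := Nat.pos_of_ne_zero (by rintro rfl; simp at hp)
    rw [hZ₂ p hp]
    have := (hyY (p % c) (Nat.mod_lt _ hc0)).1
    exact (Nat.div_lt_of_lt_mul (by rwa [Nat.mul_comm])).trans_le this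
  · have hc0 : 0 < c := Nat.pos_of_ne_zero (by rintro rfl; simp at hp)
    rw [hZ₂ p hp, not_lt]
    refine (hyY (p % c) (Nat.mod_lt _ hc0)).2.trans ?_
    rw [Nat.le_div_iff_mul_le hc0, Nat.add_mul]
    exact hle

/-- Columnsort: sorting the blocks, the residue classes, the blocks, and the shifted blocks sorts
everything. After the second phase the items are in order except in a window of length `c * c`,
which is contained in a block or in a shifted block. -/
theorem columnsort {r c h : ℕ} (hh : h ≤ r) (h1 : c * c ≤ h) (h2 : c * c ≤ r - h)
    {Z Z₁ Z₂ Z₃ Z₄ : Set ℕ} (h₁ : (Division.blocks r c).layer.Rel (r * c) Z Z₁)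
    (h₂ : (Division.residues r c).layer.Rel (r * c) Z₁ Z₂)
    (h₃ : (Division.blocks r c).layer.Rel (r * c) Z₂ Z₃)
    (h₄ : (Division.shifted r c h hh).layer.Rel (r * c) Z₃ Z₄) {p q : ℕ} (hpq : p < q)
    (hq : q < r * c) (hqZ : q ∈ Z₄) : p ∈ Z₄ := by
  have hc0 : 0 < c := Nat.pos_of_ne_zero (by rintro rfl; simp at hq)
  have hr0 : 0 < r := Nat.pos_of_ne_zero (by rintro rfl; simp at hq)
  obtain ⟨w, hw1, hw2⟩ := exists_window h₁ h₂
  have hmem : ∀ (D : Division (r * c) r c) (p : ℕ), p < r * c →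
      p ∈ D.layer.fiber (r * c) (D.cls p) := fun D p hp => Layer.mem_fiber.2 ⟨hp, rfl⟩
  have hw1' : ∀ p < r * c, p < w → p ∈ Z₃ := fun p hp hlt =>
    h₃.mem_of_forall_le (hmem _ p hp) fun q hq hle =>
      hw1 q (Layer.mem_fiber.1 hq).1 (by omega)
  have hw2' : ∀ p < r * c, w + c * c ≤ p → p ∉ Z₃ := fun p hp hlt =>
    h₃.notMem_of_forall_ge (hmem _ p hp) fun q hq hle =>
      hw2 q (Layer.mem_fiber.1 hq).1 (by omega)
  have hs3 : ∀ p q, p < q → q < r * c → p / r = q / r → q ∈ Z₃ → p ∈ Z₃ := fun p q hpq hq hd =>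
    (h₃ (p / r)).2.1 trivial p (Layer.mem_fiber.2 ⟨by omega, rfl⟩) q
      (Layer.mem_fiber.2 ⟨by omega, hd.symm⟩) hpq
  -- nothing happens in the last phase if everything is sorted after the third one
  by_cases hsorted : ∀ p q, p < q → q < r * c → q ∈ Z₃ → p ∈ Z₃
  · have hq3 : q ∈ Z₃ := by
      by_contra hn
      refine h₄.notMem_of_forall_ge (hmem _ q hq) (fun a ha hle haZ => hn ?_) hqZ
      rcases Nat.eq_or_lt_of_le hle with rfl | hlt
      · exact haZ
      · exact hsorted q a hlt (Layer.mem_fiber.1 ha).1 haZ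
    exact h₄.mem_of_forall_le (hmem _ p (by omega)) fun a ha hle => hsorted a q (by omega) hq hq3
  -- otherwise the window contains a boundary between blocks
  push Not at hsorted
  obtain ⟨a, a', haa, ha', ha'Z, haZ⟩ := hsorted
  have hwa : w ≤ a := by
    by_contra hlt
    exact haZ (hw1' a (by omega) (by omega))
  have hwa' : a' < w + c * c := by
    by_contra hle
    exact hw2' a' ha' (by omega) ha'Z
  have hne : a / r ≠ a' / r := fun he => haZ (hs3 a a' haa ha' he ha'Z)
  have hlt : a / r < a' / r := lt_of_le_of_ne (Nat.div_le_div_right haa.le) hne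
  set k := a / r with hk
  have hk1 : a < (k + 1) * r := by
    have := Nat.lt_div_mul_add (a := a) hr0
    rw [← hk] at this
    rw [Nat.add_mul]; omega
  have hk2 : (k + 1) * r ≤ a' := (Nat.le_div_iff_mul_le hr0).1 hlt
  have hkc : k + 1 < c := by
    by_contra hle
    have := Nat.mul_le_mul_right r (not_lt.1 hle)
    rw [Nat.mul_comm c] at this
    omega
  have hkr : (k + 1) * r = k * r + r := by ring
  have hkc' : (k + 2) * r ≤ c * r := Nat.mul_le_mul_right r hkc
  have hkr' : (k + 2) * r = k * r + r + r := by ring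
  rw [Nat.mul_comm c] at hkc'
  -- the window is contained in the shifted block number `k`
  set D := Division.shifted r c h hh with hD
  have hin : ∀ p, w ≤ p → p < w + c * c → p ∈ D.layer.fiber (r * c) k := fun p hp1 hp2 => by
    have he : p = D.pos k (p - (k * r + h)) := by
      change p = (k * r + (p - (k * r + h)) + h) % (r * c)
      rw [Nat.mod_eq_of_lt (by omega)]
      omega
    rw [he]
    exact Layer.mem_fiber.2 ⟨D.pos_lt k (by omega) _ (by omega), D.cls_pos k (by omega) _ (by omega)⟩
  rcases Nat.lt_or_ge p w with hpw | hpw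
  · exact h₄.mem_of_forall_le (hmem _ p (by omega)) fun a ha hle =>
      hw1' a (Layer.mem_fiber.1 ha).1 (by omega)
  · have hqw : q < w + c * c := by
      by_contra hle
      exact h₄.notMem_of_forall_ge (hmem _ q hq) (fun a ha hle =>
        hw2' a (Layer.mem_fiber.1 ha).1 (by omega)) hqZ
    exact (h₄ k).2.1 hkc p (hin p hpw (by omega)) q (hin q (by omega) hqw) hpq hqZ

/-- One Columnsort step: four passes of a sorter with `r` positions sort `r * c` positions. In each
pass it runs simultaneously on `c` classes, with a separate group of `M` machines for each. -/
theorem Sorter.mul {r M b T c : ℕ} (hS : Sorter r M b T) (hc : c * c ≤ r / 2) :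
    Sorter (r * c) (c * M) b (4 * T) := by
  obtain ⟨ls, hT, hls, hsort⟩ := hS
  have hh : r / 2 ≤ r := Nat.div_le_self r 2
  have hls1 : ∀ l ∈ ls, ∀ p < r, l.mach p < M := fun l hl => (hls l hl).1
  refine ⟨ls.map ((Division.blocks r c).lift M) ++ (ls.map ((Division.residues r c).lift M) ++
    (ls.map ((Division.blocks r c).lift M) ++ ls.map ((Division.shifted r c (r / 2) hh).lift M))),
    by simp; omega, ?_, ?_⟩
  · have key : ∀ D : Division (r * c) r c, ∀ l' ∈ ls.map (D.lift M),
        (∀ p < r * c, l'.mach p < c * M) ∧ ∀ v, (l'.fiber (r * c) v).card ≤ b := by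
      intro D l' hl'
      obtain ⟨l, hl, rfl⟩ := List.mem_map.1 hl'
      refine ⟨fun p hp => ?_, D.card_fiber_lift_le (hls l hl).1 (hls l hl).2⟩
      have h1 := D.cls_lt p hp
      have h2 := (hls l hl).1 _ (D.rk_lt p hp)
      change D.cls p * M + l.mach (D.rk p) < c * M
      nlinarith
    intro l hl
    simp only [List.mem_append] at hl
    rcases hl with hl | hl | hl | hl <;> exact key _ l hl
  · intro Z Z₄ hrun p q hpq hq hqZ
    obtain ⟨Z₁, h1, hrun⟩ := hrun.append
    obtain ⟨Z₂, h2, hrun⟩ := hrun.append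
    obtain ⟨Z₃, h3, h4⟩ := hrun.append
    exact columnsort hh hc (by omega) (Division.rel_layer_of_run _ hls1 hsort h1)
      (Division.rel_layer_of_run _ hls1 hsort h2) (Division.rel_layer_of_run _ hls1 hsort h3)
      (Division.rel_layer_of_run _ hls1 hsort h4) hpq hq hqZ

/-- With machines that sort `b` items, and `c` at most `√(b / 2)`, the number of layers depends on `J`
only. -/
theorem sorter_pow {b c : ℕ} (hc : 1 ≤ c) (hb : 2 * (c * c) ≤ b) (J : ℕ) :
    Sorter (b * c ^ J) (c ^ J) b (4 ^ J) := by
  induction J with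
  | zero => simpa using sorter_self b
  | succ J ih =>
    have h1 : b ≤ b * c ^ J := Nat.le_mul_of_pos_right b (pow_pos hc J)
    have := ih.mul (c := c) (by omega)
    rwa [mul_assoc, ← pow_succ, ← pow_succ', ← pow_succ'] at this

/-! ### Applying a sorting network to an array -/

section Arrays

variable {α : Type*} (key : α → ℕ)

/-- The array obtained from `a` by sorting the entries at the positions in `S` by their keys. -/
def sortOn (S : Finset ℕ) (a : ℕ → α) (p : ℕ) : α :=
  if h : p ∈ S then
    a (S.orderIsoOfFin rfl (Tuple.sort (fun j => key (a (S.orderIsoOfFin rfl j)))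
      ((S.orderIsoOfFin rfl).symm ⟨p, h⟩)))
  else a p

variable {key} {S : Finset ℕ} {a a' : ℕ → α}

theorem sortOn_congr (h : ∀ p ∈ S, a p = a' p) {p : ℕ} (hp : p ∈ S) :
    sortOn key S a p = sortOn key S a' p := by
  have h1 : (fun j => key (a (S.orderIsoOfFin rfl j))) =
      fun j => key (a' (S.orderIsoOfFin rfl j)) :=
    funext fun j => by rw [h _ (S.orderIsoOfFin rfl j).2]
  rw [sortOn, sortOn, dif_pos hp, dif_pos hp, h1]
  exact h _ (Subtype.prop _)

theorem key_sortOn_le {p q : ℕ} (hp : p ∈ S) (hq : q ∈ S) (hpq : p ≤ q) :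
    key (sortOn key S a p) ≤ key (sortOn key S a q) := by
  rw [sortOn, sortOn, dif_pos hp, dif_pos hq]
  have := Tuple.monotone_sort (fun j => key (a (S.orderIsoOfFin rfl j)))
  exact this ((S.orderIsoOfFin rfl).symm.monotone (a := ⟨p, hp⟩) (b := ⟨q, hq⟩) hpq)

open Classical in
theorem card_filter_sortOn (Q : α → Prop) :
    (S.filter fun p => Q (sortOn key S a p)).card = (S.filter fun p => Q (a p)).card := by
  set e := S.orderIsoOfFin rfl
  set σ := Tuple.sort (fun j => key (a (e j)))
  have hval : ∀ p (hp : p ∈ S), sortOn key S a p = a (e (σ (e.symm ⟨p, hp⟩))) := fun p hp => by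
    rw [sortOn, dif_pos hp]
  refine Finset.card_bij' (fun p hp => (e (σ (e.symm ⟨p, (Finset.mem_filter.1 hp).1⟩)) : ℕ))
    (fun p hp => (e (σ.symm (e.symm ⟨p, (Finset.mem_filter.1 hp).1⟩)) : ℕ)) ?_ ?_ ?_ ?_
  · intro p hp
    obtain ⟨h1, h2⟩ := Finset.mem_filter.1 hp
    rw [hval p h1] at h2
    exact Finset.mem_filter.2 ⟨Subtype.prop _, h2⟩
  · intro p hp
    obtain ⟨h1, h2⟩ := Finset.mem_filter.1 hp
    refine Finset.mem_filter.2 ⟨Subtype.prop _, ?_⟩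
    rw [hval _ (Subtype.prop _)]
    simpa using h2
  · intro p hp
    simp
  · intro p hp
    simp

end Arrays

namespace Layer

variable {α : Type*} (l : Layer) (N : ℕ) (key : α → ℕ)

open Classical in
/-- The array after a layer of a sorting network. -/
def apply (a : ℕ → α) (p : ℕ) : α :=
  if l.flag (l.mach p) then sortOn key (l.fiber N (l.mach p)) a p else a p

variable {l N key} {a a' : ℕ → α}

theorem apply_congr {v : ℕ} (h : ∀ p ∈ l.fiber N v, a p = a' p) {p : ℕ} (hp : p ∈ l.fiber N v) :
    l.apply N key a p = l.apply N key a' p := by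
  obtain rfl := (mem_fiber.1 hp).2
  unfold apply
  split_ifs
  · exact sortOn_congr h hp
  · exact h p hp

open Classical in
theorem card_fiber_filter_apply (v : ℕ) (Q : α → Prop) :
    ((l.fiber N v).filter fun p => Q (l.apply N key a p)).card =
      ((l.fiber N v).filter fun p => Q (a p)).card := by
  by_cases hf : l.flag v
  · have h : ∀ p ∈ l.fiber N v, l.apply N key a p = sortOn key (l.fiber N v) a p := fun p hp => by
      rw [apply, (mem_fiber.1 hp).2, if_pos hf]
    rw [← card_filter_sortOn (key := key) (a := a)]
    exact congrArg _ (Finset.filter_congr fun p hp => by rw [h p hp])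
  · have h : ∀ p ∈ l.fiber N v, l.apply N key a p = a p := fun p hp => by
      rw [apply, (mem_fiber.1 hp).2, if_neg hf]
    exact congrArg _ (Finset.filter_congr fun p hp => by rw [h p hp])

theorem rel_apply (x : ℕ) :
    l.Rel N {p | key (a p) < x} {p | key (l.apply N key a p) < x} := by
  classical
  intro v
  refine ⟨?_, fun hf p hp q hq hpq hZ => ?_, fun hf p hp => ?_⟩
  · exact card_fiber_filter_apply v fun y => key y < x
  · rw [Set.mem_ofPred_eq] at hZ ⊢
    refine lt_of_le_of_lt ?_ hZ
    unfold apply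
    rw [(mem_fiber.1 hp).2, (mem_fiber.1 hq).2, if_pos hf, if_pos hf]
    exact key_sortOn_le hp hq hpq.le
  · rw [Set.mem_ofPred_eq, Set.mem_ofPred_eq, apply, (mem_fiber.1 hp).2, if_neg hf]

open Classical in
theorem card_filter_apply (Q : α → Prop) :
    ((Finset.range N).filter fun p => Q (l.apply N key a p)).card =
      ((Finset.range N).filter fun p => Q (a p)).card := by
  rw [Finset.card_eq_sum_card_fiberwise (f := l.mach) (t := (Finset.range N).image l.mach),
    Finset.card_eq_sum_card_fiberwise (f := l.mach) (s := (Finset.range N).filter fun p => Q (a p))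
      (t := (Finset.range N).image l.mach)]
  · refine Finset.sum_congr rfl fun v _ => ?_
    have := card_fiber_filter_apply (l := l) (N := N) (key := key) (a := a) v Q
    simp only [fiber, Finset.filter_filter] at this ⊢
    simpa only [and_comm] using this
  all_goals
    intro p hp
    exact Finset.mem_coe.2 (Finset.mem_image_of_mem _ (Finset.mem_filter.1 hp).1)

end Layer

section Networks

variable {α : Type*} (N : ℕ) (key : α → ℕ)

/-- The array after a sequence of layers. -/
def applyLayers (ls : List Layer) (a : ℕ → α) : ℕ → α :=
  ls.foldl (fun a l => l.apply N key a) a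

variable {N key}

theorem applyLayers_take_succ {ls : List Layer} {t : ℕ} (ht : t < ls.length) (a : ℕ → α) :
    applyLayers N key (ls.take (t + 1)) a =
      ls[t].apply N key (applyLayers N key (ls.take t) a) := by
  rw [List.take_add_one, List.getElem?_eq_getElem ht, applyLayers, List.foldl_append]
  rfl

theorem run_applyLayers (ls : List Layer) (a : ℕ → α) (x : ℕ) :
    Run N ls {p | key (a p) < x} {p | key (applyLayers N key ls a p) < x} := by
  induction ls generalizing a with
  | nil => exact .nil _
  | cons l ls ih => exact .cons (l.rel_apply x) (ih _)

open Classical in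
theorem card_filter_applyLayers (ls : List Layer) (a : ℕ → α) (Q : α → Prop) :
    ((Finset.range N).filter fun p => Q (applyLayers N key ls a p)).card =
      ((Finset.range N).filter fun p => Q (a p)).card := by
  induction ls generalizing a with
  | nil => rfl
  | cons l ls ih => exact (ih _).trans (l.card_filter_apply Q)

theorem key_applyLayers_le {ls : List Layer}
    (hls : ∀ Z Z', Run N ls Z Z' → ∀ p q, p < q → q < N → q ∈ Z' → p ∈ Z') (a : ℕ → α) {p q : ℕ}
    (hpq : p < q) (hq : q < N) :
    key (applyLayers N key ls a p) ≤ key (applyLayers N key ls a q) := by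
  by_contra hlt
  have := hls _ _ (run_applyLayers ls a (key (applyLayers N key ls a p))) p q hpq hq
    (not_le.1 hlt)
  rw [Set.mem_ofPred_eq] at this
  exact lt_irrefl _ this

end Networks

/-! ### Words -/

section Words

variable {d B : ℕ} [NeZero B] {F : Set ℝ}

/-- The word that holds the number `v`, if `v < B`. -/
def natWord (v : ℕ) : Word B F := Sum.inl (Fin.ofNat B v)

theorem natWord_inj {v v' : ℕ} (hv : v < B) (hv' : v' < B)
    (h : (natWord v : Word B F) = natWord v') : v = v' := by
  have h1 := Fin.ext_iff.1 (Sum.inl_injective h)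
  rw [Fin.val_ofNat, Fin.val_ofNat, Nat.mod_eq_of_lt hv, Nat.mod_eq_of_lt hv'] at h1
  exact h1

/-- The `d` words that hold a point, or the information that there is none. -/
def pointWords (p : Option (Fin d → F)) : List (Word B F) :=
  p.elim (List.replicate d (natWord 0)) fun p => List.ofFn fun j => Sum.inr (p j)

theorem length_pointWords (p : Option (Fin d → F)) :
    (pointWords p : List (Word B F)).length = d := by
  cases p <;> simp [pointWords]

theorem pointWords_injective (hd : 0 < d) {p p' : Option (Fin d → F)}
    (h : (pointWords p : List (Word B F)) = pointWords p') : p = p' := by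
  have hne : ∀ p : Fin d → F, List.replicate d (natWord 0 : Word B F) ≠
      List.ofFn fun j => Sum.inr (p j) := fun p h => by
    have h1 : (Sum.inr (p ⟨0, hd⟩) : Word B F) ∈ List.ofFn fun j => (Sum.inr (p j) : Word B F) :=
      (List.mem_ofFn' _ _).2 ⟨_, rfl⟩
    rw [← h] at h1
    have := (List.mem_replicate.1 h1).2
    simp [natWord] at this
  rcases p with _ | p <;> rcases p' with _ | p'
  · rfl
  · exact absurd h (hne p')
  · exact absurd h.symm (hne p)
  · have := List.ofFn_injective h
    congr 1
    funext j
    exact Sum.inr_injective (congrFun this j)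

end Words

/-! ### Sorting the points -/

/-- A set of `n` points with coordinates in `F` and norm less than `Λ`, distributed over `m` machines
with at most `S` points on each. -/
structure Input (n d m S : ℕ) (Λ : ℝ) (F : Set ℝ) where
  pts : Fin n → Fin d → F
  loc : Fin n → Fin m
  norm_lt : ∀ i, ‖(WithLp.toLp 2 fun j => (pts i j : ℝ) : EuclideanSpace ℝ (Fin d))‖ < Λ
  card_le : ∀ i, (Finset.univ.filter fun p => loc p = i).card ≤ S

section Sorting

variable {n d m S B : ℕ} {Λ : ℝ} {F : Set ℝ}

namespace Input

variable (x : Input n d m S Λ F)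

/-- The names of the points that are initially at machine `i`. -/
def names (i : Fin m) : List (Fin n) := (List.finRange n).filter fun p => x.loc p = i

theorem length_names_le (i : Fin m) : (x.names i).length ≤ S := by
  refine le_trans (le_of_eq ?_) (x.card_le i)
  have h1 : (x.names i).Nodup := (List.nodup_finRange n).filter _
  rw [← List.toFinset_card_of_nodup h1]
  congr 1
  ext p
  simp [names]

theorem mem_names {i : Fin m} {p : Fin n} : p ∈ x.names i ↔ x.loc p = i := by simp [names]

/-- The initial array of points: the points of machine `i` are at the positions `i * S, …`. -/
def slots (p : ℕ) : Option (Fin d → F) :=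
  if h : p / S < m then ((x.names ⟨p / S, h⟩)[p % S]?).map x.pts else none

theorem slots_eq_of_initialMemory_eq (hd : 0 < d) {x x' : Input n d m S Λ F} {i : Fin m}
    (h : (initialMemory x.pts x.loc i : List (Word B F)) = initialMemory x'.pts x'.loc i) {p : ℕ}
    (hp : p / S = i) : x.slots p = x'.slots p := by
  have h1 : ∀ x : Input n d m S Λ F, (initialMemory x.pts x.loc i : List (Word B F)) =
      (((x.names i).map x.pts).map fun q => List.ofFn fun j => Sum.inr (q j)).flatten := fun x => by
    rw [initialMemory, names, List.flatMap_def, List.map_map]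
    rfl
  rw [h1, h1] at h
  have h2 := flatten_injective hd (by simp) (by simp) h
  have h3 : (x.names i).map x.pts = (x'.names i).map x'.pts := by
    refine List.map_injective_iff.2 (fun q q' hq => ?_) h2
    have := List.ofFn_injective hq
    funext j
    exact Sum.inr_injective (congrFun this j)
  have hlt : p / S < m := hp ▸ i.2
  have hi : (⟨p / S, hlt⟩ : Fin m) = i := Fin.ext hp
  rw [slots, slots, dif_pos hlt, dif_pos hlt, hi, ← List.getElem?_map, ← List.getElem?_map, h3]

open Classical in
theorem card_filter_slots (hS : 0 < S) {N : ℕ} (hN : m * S ≤ N) (Q : (Fin d → F) → Prop) :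
    ((Finset.range N).filter fun p => ∃ q, x.slots p = some q ∧ Q q).card =
      (Finset.univ.filter fun i => Q (x.pts i)).card := by
  symm
  have hidx : ∀ i, (x.names (x.loc i)).idxOf i < S := fun i =>
    (List.idxOf_lt_length_of_mem (x.mem_names.2 rfl)).trans_le (x.length_names_le _)
  have hdiv : ∀ i, ((x.loc i : ℕ) * S + (x.names (x.loc i)).idxOf i) / S = x.loc i := fun i => by
    rw [Nat.mul_comm, Nat.mul_add_div hS, Nat.div_eq_of_lt (hidx i), Nat.add_zero]
  have hmod : ∀ i, ((x.loc i : ℕ) * S + (x.names (x.loc i)).idxOf i) % S =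
      (x.names (x.loc i)).idxOf i := fun i => by
    rw [Nat.mul_comm, Nat.mul_add_mod, Nat.mod_eq_of_lt (hidx i)]
  refine Finset.card_bij (fun i _ => (x.loc i : ℕ) * S + (x.names (x.loc i)).idxOf i) ?_ ?_ ?_
  · intro i hi
    rw [Finset.mem_filter, Finset.mem_range]
    refine ⟨?_, x.pts i, ?_, (Finset.mem_filter.1 hi).2⟩
    · have h1 := hidx i
      have h2 := (x.loc i).2
      nlinarith
    · have hlt : ((x.loc i : ℕ) * S + (x.names (x.loc i)).idxOf i) / S < m := by
        rw [hdiv]; exact (x.loc i).2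
      rw [slots, dif_pos hlt]
      have : (⟨_, hlt⟩ : Fin m) = x.loc i := Fin.ext (hdiv i)
      rw [this, hmod, List.getElem?_idxOf (x.mem_names.2 rfl)]
      rfl
  · intro i _ i' _ h
    have h1 : x.loc i = x.loc i' := Fin.ext (by rw [← hdiv i, h, hdiv i'])
    have h2 := (hmod i).symm.trans ((congrArg (· % S) h).trans (hmod i'))
    rw [h1] at h2
    exact (List.idxOf_inj (x.mem_names.2 h1)).1 h2
  · intro p hp
    obtain ⟨hp, q, hq, hQ⟩ := Finset.mem_filter.1 hp
    rw [slots] at hq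
    split_ifs at hq with hlt
    obtain ⟨i, hi, rfl⟩ := Option.map_eq_some_iff.1 hq
    have hmem := List.mem_of_getElem? hi
    have hloc := x.mem_names.1 hmem
    refine ⟨i, Finset.mem_filter.2 ⟨Finset.mem_univ _, hQ⟩, ?_⟩
    rw [hloc]
    obtain ⟨hj, hji⟩ := List.getElem?_eq_some_iff.1 hi
    have hnd : (x.names ⟨p / S, hlt⟩).Nodup := (List.nodup_finRange n).filter _
    rw [← hji, hnd.idxOf_getElem]
    exact (by rw [Nat.mul_comm]; exact Nat.div_add_mod p S)

end Input

end Sorting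

/-! ### Sorting the points with the machines -/

section SortPhase

variable {n d m S B : ℕ} {Λ : ℝ} {F : Set ℝ} [NeZero B]

/-- The memory of machine `i`, which holds the items of the array `a` at its positions. -/
def slotMemory (B : ℕ) [NeZero B] (l : Layer) (N : ℕ) (a : ℕ → Option (Fin d → F)) (i : ℕ) :
    List (Word B F) :=
  ((l.fiber N i).sort).flatMap fun p => pointWords (a p)

theorem length_slotMemory (l : Layer) (N : ℕ) (a : ℕ → Option (Fin d → F)) (i : ℕ) :
    (slotMemory B l N a i).length = d * (l.fiber N i).card := by
  rw [slotMemory, length_flatMap_of_length_eq fun p _ => length_pointWords (a p),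
    Finset.length_sort]

theorem eq_of_slotMemory_eq (hd : 0 < d) {l : Layer} {N : ℕ} {a a' : ℕ → Option (Fin d → F)} {i : ℕ}
    (h : slotMemory B l N a i = slotMemory B l N a' i) : ∀ p ∈ l.fiber N i, a p = a' p := by
  intro p hp
  refine pointWords_injective (B := B) hd (flatMap_eq_flatMap ?_ h p ?_)
  · intro p _
    rw [length_pointWords, length_pointWords]
  · rwa [Finset.mem_sort]

theorem slotMemory_congr {l : Layer} {N : ℕ} {a a' : ℕ → Option (Fin d → F)} {i : ℕ}
    (h : ∀ p ∈ l.fiber N i, a p = a' p) : slotMemory B l N a i = slotMemory B l N a' i := by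
  unfold slotMemory
  rw [List.flatMap_def, List.flatMap_def]
  congr 1
  exact List.map_congr_left fun p hp => by rw [h p ((Finset.mem_sort _).1 hp)]

open Classical in
/-- If the item at position `p` is known to machine `src p`, the machines can in one round send the
items to the machines that hold them in the layer `l`, and carry out `l`. -/
theorem step_layer {X : Type*} {s b : ℕ} [NeZero m] (hd : 0 < d) (M : X → Fin m → List (Word B F))
    (l : Layer) (N : ℕ) (hNB : N ≤ B) (key : Option (Fin d → F) → ℕ)
    (a : X → ℕ → Option (Fin d → F)) (src : ℕ → ℕ)
    (hM : ∀ x x' i, M x i = M x' i → ∀ p < N, src p = i → a x p = a x' p)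
    (hsrc : ∀ x, ∀ p < N, a x p ≠ none → src p < m)
    (hload : ∀ v, ((Finset.range N).filter fun p => src p = v).card ≤ b)
    (hl : ∀ p < N, l.mach p < m) (hb : ∀ v, (l.fiber N v).card ≤ b) (hs : (d + 1) * b ≤ s) :
    Step s M (fun x (i : Fin m) => slotMemory B l N (l.apply N key (a x)) i) := by
  have hval : ∀ v < m, ((Fin.ofNat m v : Fin m) : ℕ) = v := fun v hv => by
    rw [Fin.val_ofNat, Nat.mod_eq_of_lt hv]
  refine Step.of_packets (d + 1) (by omega) (fun x => (Finset.range N).filter fun p => a x p ≠ none)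
    (fun _ p => Fin.ofNat m (src p)) (fun _ p => Fin.ofNat m (l.mach p))
    (fun x p => natWord p :: pointWords (a x p)) ?_ ?_ ?_ ?_ ?_ ?_
  · intro x p _
    rw [List.length_cons, length_pointWords]
  · intro x x' i h p hp hi
    obtain ⟨hp1, hp2⟩ := Finset.mem_filter.1 hp
    rw [Finset.mem_range] at hp1
    have hi' : src p = i := by rw [← hval (src p) (hsrc x p hp1 hp2), hi]
    have ha := hM x x' i h p hp1 hi'
    exact ⟨p, Finset.mem_filter.2 ⟨Finset.mem_range.2 hp1, ha ▸ hp2⟩, hi, rfl, by rw [ha]⟩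
  · intro x x' i _ h1 h2
    have key1 : ∀ x x' : X, (∀ p ∈ (Finset.range N).filter fun p => a x p ≠ none,
        Fin.ofNat m (l.mach p) = i → ∃ p' ∈ (Finset.range N).filter fun p => a x' p ≠ none,
        Fin.ofNat m (l.mach p') = i ∧ (natWord p' :: pointWords (a x' p') : List (Word B F)) =
          natWord p :: pointWords (a x p)) →
        ∀ p ∈ l.fiber N i, a x p ≠ none → a x' p = a x p := by
      intro x x' h p hp hne
      obtain ⟨hp1, hp2⟩ := Layer.mem_fiber.1 hp
      obtain ⟨p', hp', -, he⟩ := h p (Finset.mem_filter.2 ⟨Finset.mem_range.2 hp1, hne⟩)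
        (by rw [hp2]; exact Fin.ext (hval _ i.2))
      obtain ⟨he1, he2⟩ := List.cons.inj he
      have hp'N := Finset.mem_range.1 (Finset.mem_filter.1 hp').1
      have := natWord_inj (by omega) (by omega) he1
      subst this
      exact pointWords_injective hd he2
    refine slotMemory_congr fun p hp => Layer.apply_congr (fun p hp => ?_) hp
    by_cases hx : a x p = none
    · by_cases hx' : a x' p = none
      · rw [hx, hx']
      · exact key1 x' x h2 p hp hx'
    · exact (key1 x x' h1 p hp hx).symm
  · intro x i
    refine (Nat.mul_le_mul_left _ (le_trans ?_ (hload i))).trans hs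
    refine Finset.card_le_card fun p hp => ?_
    simp only [Finset.mem_filter, Finset.mem_range] at hp ⊢
    exact ⟨hp.1.1, by rw [← hp.2, hval _ (hsrc x p hp.1.1 hp.1.2)]⟩
  · intro x i
    refine (Nat.mul_le_mul_left _ (le_trans ?_ (hb i))).trans hs
    refine Finset.card_le_card fun p hp => ?_
    simp only [Finset.mem_filter, Finset.mem_range] at hp
    exact Layer.mem_fiber.2 ⟨hp.1.1, by rw [← hp.2, hval _ (hl p hp.1.1)]⟩
  · intro x i
    rw [length_slotMemory]
    exact (Nat.mul_le_mul (by omega) (hb i)).trans hs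

/-- The array of points after the layers `ls`. -/
def sorted (N : ℕ) (key : Option (Fin d → F) → ℕ) (ls : List Layer) (x : Input n d m S Λ F) :
    ℕ → Option (Fin d → F) :=
  applyLayers N key ls x.slots

theorem reach_sorted {s b N : ℕ} [NeZero m] (hd : 0 < d) (hS : 0 < S) (hSb : S ≤ b) (hNB : N ≤ B)
    (key : Option (Fin d → F) → ℕ) (ls : List Layer) (hne : ls ≠ [])
    (hls : ∀ l ∈ ls, (∀ p < N, l.mach p < m) ∧ ∀ v, (l.fiber N v).card ≤ b)
    (hs : (d + 1) * b ≤ s) :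
    Reach s ls.length (fun x : Input n d m S Λ F => initialMemory x.pts x.loc)
      (fun x (i : Fin m) => slotMemory B (ls.getLast hne) N (sorted N key ls x) i) := by
  classical
  have hpos : 0 < ls.length := List.length_pos_iff.2 hne
  let M : ℕ → Input n d m S Λ F → Fin m → List (Word B F) := fun t x i =>
    if t = 0 then initialMemory x.pts x.loc i
    else slotMemory B (ls.getD (t - 1) (ls.getLast hne)) N (sorted N key (ls.take t) x) i
  have h := Reach.of_steps (s := s) M ls.length ?_
  · have h1 : M ls.length = fun x (i : Fin m) =>
        slotMemory B (ls.getLast hne) N (sorted N key ls x) i := by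
      funext x i
      simp only [M]
      rw [if_neg (by omega), List.take_length, List.getD_eq_getElem _ _ (by omega),
        List.getLast_eq_getElem]
    rw [h1] at h
    exact h
  intro t ht
  have hM1 : M (t + 1) = fun x (i : Fin m) =>
      slotMemory B ls[t] N (ls[t].apply N key (sorted N key (ls.take t) x)) i := by
    funext x i
    simp only [M]
    rw [if_neg (by omega), Nat.add_sub_cancel, List.getD_eq_getElem _ _ ht, sorted,
      applyLayers_take_succ ht]
    rfl
  have hlt := hls ls[t] (List.getElem_mem ht)
  rw [hM1]
  rcases t with _ | t
  · refine step_layer hd _ _ N hNB key _ (fun p => p / S) ?_ ?_ ?_ hlt.1 hlt.2 hs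
    · intro x x' i hx p _ hpi
      exact Input.slots_eq_of_initialMemory_eq hd hx hpi
    · intro x p _ hp
      by_contra hm
      refine hp ?_
      change x.slots p = none
      rw [Input.slots, dif_neg hm]
    · intro v
      refine le_trans ?_ hSb
      have h2 : ((Finset.range N).filter fun p => p / S = v) ⊆ Finset.Ico (v * S) (v * S + S) := by
        intro p hp
        have := (Finset.mem_filter.1 hp).2
        rw [Nat.div_eq_iff hS] at this
        rw [Finset.mem_Ico]
        omega
      refine (Finset.card_le_card h2).trans ?_
      simp
  · have htl : t < ls.length := by omega
    have hlt' := hls ls[t] (List.getElem_mem htl)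
    refine step_layer hd _ _ N hNB key _ ls[t].mach ?_ ?_ ?_ hlt.1 hlt.2 hs
    · intro x x' i hx p hp hpi
      simp only [M] at hx
      rw [if_neg (by omega), if_neg (by omega), Nat.add_sub_cancel,
        List.getD_eq_getElem _ _ htl] at hx
      exact eq_of_slotMemory_eq hd hx p (Layer.mem_fiber.2 ⟨hp, hpi⟩)
    · intro x p hp _
      exact hlt'.1 p hp
    · exact hlt'.2

end SortPhase

section SortedPoints

variable {n d m S : ℕ} {Λ : ℝ} {F : Set ℝ}

/-- A sorting key for array entries: empty entries come last. -/
def slotKey (key : (Fin d → F) → ℕ) (top : ℕ) (p : Option (Fin d → F)) : ℕ := p.elim top key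

/-- After sorting, the first `n` positions hold the input points, in order. -/
theorem exists_sorted_points (q₀ : Fin d → F) (x : Input n d m S Λ F) (hS : 0 < S) {N : ℕ}
    (hN : m * S ≤ N)
    (key : (Fin d → F) → ℕ) (top : ℕ) (hkey : ∀ p, key p < top) (ls : List Layer)
    (hls : ∀ Z Z', Run N ls Z Z' → ∀ p q, p < q → q < N → q ∈ Z' → p ∈ Z') :
    ∃ q : ℕ → Fin d → F, n ≤ N ∧ (∀ r < n, sorted N (slotKey key top) ls x r = some (q r)) ∧
      (∀ r r', r < r' → r' < n → key (q r) ≤ key (q r')) ∧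
      ∀ Q : (Fin d → F) → Prop, Nat.card {r // r < n ∧ Q (q r)} = Nat.card {i // Q (x.pts i)} := by
  classical
  set a := sorted N (slotKey key top) ls x with ha
  have hmono : ∀ p q, p < q → q < N → slotKey key top (a p) ≤ slotKey key top (a q) :=
    fun p q => key_applyLayers_le hls _
  have hcard : ∀ Q : (Fin d → F) → Prop,
      ((Finset.range N).filter fun p => ∃ q, a p = some q ∧ Q q).card =
        (Finset.univ.filter fun i => Q (x.pts i)).card := fun Q => by
    rw [← x.card_filter_slots hS hN Q]
    convert card_filter_applyLayers (N := N) (key := slotKey key top) ls x.slots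
      (fun o => ∃ q, o = some q ∧ Q q) using 4
    simp only [ha, sorted]
  have hfull : (Finset.range N).filter (fun p => ∃ q, a p = some q ∧ True) = Finset.range n := by
    have h1 : ((Finset.range N).filter (fun p => ∃ q, a p = some q ∧ True)).card = n := by
      convert hcard fun _ => True
      simp
    have h2 := eq_Ico_of_initial (A := (Finset.range N).filter fun p => ∃ q, a p = some q ∧ True)
      (a := 0) (b := N) (fun p hp => by
        rw [Finset.mem_Ico]
        exact ⟨Nat.zero_le _, Finset.mem_range.1 (Finset.mem_filter.1 hp).1⟩) ?_
    · rw [Nat.zero_add, ← Finset.range_eq_Ico] at h2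
      convert h2
      exact (by convert h1.symm)
    · intro p p' _ hlt hp'
      obtain ⟨hp'N, q, hq, -⟩ := Finset.mem_filter.1 hp'
      rw [Finset.mem_range] at hp'N
      refine Finset.mem_filter.2 ⟨Finset.mem_range.2 (by omega), ?_⟩
      have := hmono p p' hlt hp'N
      rcases h : a p with _ | q'
      · rw [h, hq] at this
        exact absurd (hkey q) (not_lt.2 this)
      · exact ⟨q', rfl, trivial⟩
  have hnN : n ≤ N := by
    have := Finset.card_filter_le (Finset.range N) fun p => ∃ q, a p = some q ∧ True
    rw [hfull] at this
    simpa using this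
  have hq : ∃ q : ℕ → Fin d → F, ∀ r < n, a r = some (q r) := by
    refine ⟨fun r => (a r).getD q₀, fun r hr => ?_⟩
    have : r ∈ (Finset.range N).filter (fun p => ∃ q, a p = some q ∧ True) := by
      rw [hfull]; exact Finset.mem_range.2 hr
    obtain ⟨-, q, hq, -⟩ := Finset.mem_filter.1 this
    simp [hq]
  obtain ⟨q, hq⟩ := hq
  refine ⟨q, hnN, hq, fun r r' hrr hr' => ?_, fun Q => ?_⟩
  · have := hmono r r' hrr (by omega)
    rwa [hq r (by omega), hq r' hr'] at this
  · rw [Nat.card_eq_fintype_card (α := {i // Q (x.pts i)}), Fintype.card_subtype, ← hcard Q]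
    refine Nat.subtype_card _ fun r => ?_
    rw [Finset.mem_filter, Finset.mem_range]
    constructor
    · rintro ⟨hr, p, hp, hQ⟩
      have : r ∈ (Finset.range N).filter (fun p => ∃ q, a p = some q ∧ True) :=
        Finset.mem_filter.2 ⟨Finset.mem_range.2 hr, p, hp, trivial⟩
      rw [hfull, Finset.mem_range] at this
      refine ⟨this, ?_⟩
      rw [hq r this] at hp
      rwa [Option.some.inj hp]
    · rintro ⟨hr, hQ⟩
      exact ⟨by omega, q r, hq r hr, hQ⟩

end SortedPoints

/-! ### Compressed binary tries -/

/-- A binary trie of height `H`, given by an increasing sequence of `n` keys below `2 ^ H`. The node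
`(h, u)` has height `h` and contains the keys `K` with `K / 2 ^ h = u`; its children are
`(h - 1, 2 * u)` and `(h - 1, 2 * u + 1)`. Keys are referred to by their ranks `0, …, n - 1`. -/
structure Trie (n H : ℕ) where
  key : ℕ → ℕ
  key_lt_key : ∀ r r', r < r' → r' < n → key r < key r'
  key_lt : ∀ r < n, key r < 2 ^ H

namespace Trie

variable {n H : ℕ} (T : Trie n H)

/-- The number of keys in the node `(h, u)`. -/
def cnt (h u : ℕ) : ℕ := ((Finset.range n).filter fun r => T.key r / 2 ^ h = u).card

/-- The number of keys before the node `(h, u)`. -/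
def lo (h u : ℕ) : ℕ := ((Finset.range n).filter fun r => T.key r / 2 ^ h < u).card

theorem key_div_le {r r' : ℕ} (h : ℕ) (hr : r ≤ r') (hr' : r' < n) :
    T.key r / 2 ^ h ≤ T.key r' / 2 ^ h := by
  refine Nat.div_le_div_right ?_
  rcases Nat.eq_or_lt_of_le hr with rfl | hlt
  · exact le_rfl
  · exact (T.key_lt_key r r' hlt hr').le

theorem lo_le (h u : ℕ) : T.lo h u ≤ n := (Finset.card_filter_le _ _).trans (by simp)

theorem key_div_lt_iff {r h u : ℕ} (hr : r < n) : T.key r / 2 ^ h < u ↔ r < T.lo h u := by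
  have := eq_Ico_of_initial (A := (Finset.range n).filter fun r => T.key r / 2 ^ h < u) (a := 0)
    (b := n) (fun p hp => by
      rw [Finset.mem_Ico]
      exact ⟨Nat.zero_le _, Finset.mem_range.1 (Finset.mem_filter.1 hp).1⟩)
    fun p p' _ hlt hp' => by
      rw [Finset.mem_filter, Finset.mem_range] at hp' ⊢
      exact ⟨by omega, (T.key_div_le h hlt.le hp'.1).trans_lt hp'.2⟩
  have h2 := Finset.ext_iff.1 this r
  rw [Finset.mem_filter, Finset.mem_range, Finset.mem_Ico, Nat.zero_add] at h2
  exact ⟨fun h => (h2.1 ⟨hr, h⟩).2, fun h => (h2.2 ⟨Nat.zero_le _, h⟩).2⟩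

theorem lo_succ (h u : ℕ) : T.lo h (u + 1) = T.lo h u + T.cnt h u := by
  rw [lo, lo, cnt, ← Finset.card_union_of_disjoint, ← Finset.filter_or]
  · congr 1
    exact Finset.filter_congr fun r _ => by omega
  · rw [Finset.disjoint_filter]
    intro r _ h1 h2
    omega

theorem key_div_eq_iff {r h u : ℕ} (hr : r < n) :
    T.key r / 2 ^ h = u ↔ T.lo h u ≤ r ∧ r < T.lo h u + T.cnt h u := by
  rw [← lo_succ, ← T.key_div_lt_iff hr, ← not_lt, ← T.key_div_lt_iff hr]
  omega

theorem lo_add_cnt_le (h u : ℕ) : T.lo h u + T.cnt h u ≤ n := by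
  rw [← lo_succ]; exact T.lo_le _ _

theorem lo_two_mul (h u : ℕ) : T.lo h (2 * u) = T.lo (h + 1) u := by
  rw [lo, lo]
  congr 1
  refine Finset.filter_congr fun r _ => ?_
  rw [pow_succ, ← Nat.div_div_eq_div_mul]
  omega

theorem lo_two_mul_add_one (h u : ℕ) :
    T.lo h (2 * u + 1) = T.lo (h + 1) u + T.cnt h (2 * u) := by
  rw [lo_succ, lo_two_mul]

theorem cnt_succ (h u : ℕ) : T.cnt (h + 1) u = T.cnt h (2 * u) + T.cnt h (2 * u + 1) := by
  have h1 := T.lo_succ (h + 1) u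
  have h2 := T.lo_succ h (2 * u + 1)
  rw [lo_two_mul_add_one, show 2 * u + 1 + 1 = 2 * (u + 1) by ring, lo_two_mul] at h2
  omega

theorem key_div_pow_succ (r h : ℕ) : T.key r / 2 ^ (h + 1) = T.key r / 2 ^ h / 2 := by
  rw [pow_succ, Nat.div_div_eq_div_mul]

theorem key_div_of_le {r r' h h' : ℕ} (hh : h ≤ h') (he : T.key r / 2 ^ h = T.key r' / 2 ^ h) :
    T.key r / 2 ^ h' = T.key r' / 2 ^ h' := by
  obtain ⟨k, rfl⟩ := Nat.exists_eq_add_of_le hh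
  rw [pow_add, ← Nat.div_div_eq_div_mul, he, Nat.div_div_eq_div_mul]

theorem cnt_zero_le (u : ℕ) : T.cnt 0 u ≤ 1 := by
  refine Finset.card_le_one.2 fun a ha b hb => ?_
  rw [Finset.mem_filter, Finset.mem_range, pow_zero, Nat.div_one] at ha hb
  by_contra hne
  rcases lt_or_gt_of_ne hne with hlt | hlt
  · have := T.key_lt_key a b hlt hb.1; omega
  · have := T.key_lt_key b a hlt ha.1; omega

theorem cnt_root : T.cnt H 0 = n := by
  rw [cnt, Finset.filter_true_of_mem, Finset.card_range]
  intro r hr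
  exact Nat.div_eq_of_lt (T.key_lt r (Finset.mem_range.1 hr))

theorem lo_zero (h : ℕ) : T.lo h 0 = 0 := by
  simp [lo]

theorem cnt_le_of_le {r h h' : ℕ} (hh : h ≤ h') :
    T.cnt h (T.key r / 2 ^ h) ≤ T.cnt h' (T.key r / 2 ^ h') := by
  refine Finset.card_le_card fun a ha => ?_
  rw [Finset.mem_filter] at ha ⊢
  exact ⟨ha.1, T.key_div_of_le hh ha.2⟩

theorem cnt_pos {r : ℕ} (hr : r < n) (h : ℕ) : 0 < T.cnt h (T.key r / 2 ^ h) :=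
  Finset.card_pos.2 ⟨r, by simp [hr]⟩

/-- The height of the lowest node that contains the keys number `r - 1` and `r`; it is `H + 1` if
one of the two does not exist. -/
def sep (r : ℕ) : ℕ :=
  if 0 < r ∧ r < n then sInf {h | T.key (r - 1) / 2 ^ h = T.key r / 2 ^ h} else H + 1

theorem sep_of_not {r : ℕ} (h : ¬ (0 < r ∧ r < n)) : T.sep r = H + 1 := by
  rw [sep, if_neg h]

theorem sep_le_iff {r : ℕ} (h0 : 0 < r) (hr : r < n) (h : ℕ) :
    T.sep r ≤ h ↔ T.key (r - 1) / 2 ^ h = T.key r / 2 ^ h := by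
  have hne : {h | T.key (r - 1) / 2 ^ h = T.key r / 2 ^ h}.Nonempty := ⟨H, by
    rw [Set.mem_ofPred_eq, Nat.div_eq_of_lt (T.key_lt _ (by omega)),
      Nat.div_eq_of_lt (T.key_lt _ hr)]⟩
  rw [sep, if_pos ⟨h0, hr⟩]
  constructor
  · intro hle
    exact T.key_div_of_le hle (Nat.sInf_mem hne)
  · intro he
    exact Nat.sInf_le he

theorem sep_le {r : ℕ} (h0 : 0 < r) (hr : r < n) : T.sep r ≤ H := by
  rw [T.sep_le_iff h0 hr, Nat.div_eq_of_lt (T.key_lt _ (by omega)),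
    Nat.div_eq_of_lt (T.key_lt _ hr)]

theorem sep_le_succ (r : ℕ) : T.sep r ≤ H + 1 := by
  by_cases h : 0 < r ∧ r < n
  · exact (T.sep_le h.1 h.2).trans (Nat.le_succ _)
  · rw [T.sep_of_not h]

theorem pos_lt_of_sep_le {r : ℕ} (h : T.sep r ≤ H) : 0 < r ∧ r < n := by
  by_contra hn
  rw [T.sep_of_not hn] at h
  omega

/-- The keys number `r - 1` and `r` are in different children of the lowest node that contains
both. -/
theorem exists_sep_eq_succ {r : ℕ} (h0 : 0 < r) (hr : r < n) :
    ∃ h, T.sep r = h + 1 ∧ T.key (r - 1) / 2 ^ h = 2 * (T.key r / 2 ^ (h + 1)) ∧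
      T.key r / 2 ^ h = 2 * (T.key r / 2 ^ (h + 1)) + 1 := by
  have h1 : T.sep r ≠ 0 := fun h => by
    have := (T.sep_le_iff h0 hr 0).1 h.le
    rw [pow_zero, Nat.div_one, Nat.div_one] at this
    have := T.key_lt_key (r - 1) r (by omega) hr
    omega
  obtain ⟨h, hh⟩ := Nat.exists_eq_succ_of_ne_zero h1
  refine ⟨h, hh, ?_⟩
  have h2 := (T.sep_le_iff h0 hr (h + 1)).1 hh.le
  have h3 := mt (T.sep_le_iff h0 hr h).2 (by omega)
  have h4 := T.key_div_le h (Nat.sub_le r 1) hr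
  rw [key_div_pow_succ, key_div_pow_succ] at h2
  rw [key_div_pow_succ]
  omega

theorem lo_sep {r h : ℕ} (h0 : 0 < r) (hr : r < n) (hh : T.sep r = h + 1) :
    T.lo h (2 * (T.key r / 2 ^ (h + 1)) + 1) = r ∧
    0 < T.cnt h (2 * (T.key r / 2 ^ (h + 1))) ∧
    0 < T.cnt h (2 * (T.key r / 2 ^ (h + 1)) + 1) := by
  obtain ⟨h', hh', h1, h2⟩ := T.exists_sep_eq_succ h0 hr
  obtain rfl : h' = h := by omega
  refine ⟨?_, ?_, ?_⟩
  · have h3 := T.key_div_lt_iff (r := r - 1) (h := h') (u := 2 * (T.key r / 2 ^ (h' + 1)) + 1)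
      (by omega)
    have h4 := T.key_div_lt_iff (r := r) (h := h') (u := 2 * (T.key r / 2 ^ (h' + 1)) + 1) hr
    omega
  · have := T.cnt_pos (r := r - 1) (by omega) h'
    rwa [h1] at this
  · have := T.cnt_pos hr h'
    rwa [h2] at this

theorem lt_sep_lo {h u : ℕ} (hh : h ≤ H) (hc : 0 < T.cnt h u) : h < T.sep (T.lo h u) := by
  by_cases h0 : 0 < T.lo h u ∧ T.lo h u < n
  · rw [← not_le, T.sep_le_iff h0.1 h0.2]
    have h1 := (T.key_div_eq_iff (h := h) (u := u) h0.2).2 ⟨le_rfl, by omega⟩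
    have h2 := (T.key_div_lt_iff (r := T.lo h u - 1) (h := h) (u := u) (by omega)).2 (by omega)
    omega
  · rw [T.sep_of_not h0]; omega

theorem lt_sep_hi {h u : ℕ} (hh : h ≤ H) (hc : 0 < T.cnt h u) :
    h < T.sep (T.lo h u + T.cnt h u) := by
  set hi := T.lo h u + T.cnt h u with hhi
  by_cases h0 : 0 < hi ∧ hi < n
  · rw [← not_le, T.sep_le_iff h0.1 h0.2]
    have h1 := (T.key_div_eq_iff (r := hi - 1) (h := h) (u := u) (by omega)).2 ⟨by omega, by omega⟩
    have h2 := mt (T.key_div_eq_iff (r := hi) (h := h) (u := u) h0.2).1 (by omega)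
    rw [h1]
    exact fun h => h2 h.symm
  · rw [T.sep_of_not h0]; omega

/-- A node is determined by the interval of ranks of its keys and its height. -/
theorem lo_eq_of_interval {l hi h u : ℕ} (hlt : l < hi) (hn : hi ≤ n)
    (hu : ∀ r, l ≤ r → r < hi → T.key r / 2 ^ h = u) (hl : h < T.sep l) (hhi : h < T.sep hi) :
    T.lo h u = l ∧ T.cnt h u = hi - l := by
  have h1 := (T.key_div_eq_iff (by omega)).1 (hu l le_rfl hlt)
  have h2 := (T.key_div_eq_iff (by omega)).1 (hu (hi - 1) (by omega) (by omega))
  have h3 : T.lo h u = l := by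
    by_contra hne
    have hlo : T.lo h u ≤ l - 1 := by omega
    have h4 := (T.key_div_eq_iff (r := l - 1) (h := h) (u := u) (by omega)).2 ⟨hlo, by omega⟩
    rw [← not_le, T.sep_le_iff (by omega) (by omega), h4] at hl
    exact hl (hu l le_rfl hlt).symm
  refine ⟨h3, ?_⟩
  by_contra hne
  have h6 := T.lo_add_cnt_le h u
  have h5 := (T.key_div_eq_iff (r := hi) (h := h) (u := u) (by omega)).2 ⟨by omega, by omega⟩
  rw [← not_le, T.sep_le_iff (by omega) (by omega), h5] at hhi
  exact hhi (hu (hi - 1) (by omega) (by omega))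

/-- The branching height of a node: the height of the compressed trie below it. -/
def bh : ℕ → ℕ → ℕ
  | 0, _ => 0
  | h + 1, u =>
    if T.cnt h (2 * u) = 0 then bh h (2 * u + 1)
    else if T.cnt h (2 * u + 1) = 0 then bh h (2 * u)
    else max (bh h (2 * u)) (bh h (2 * u + 1)) + 1

/-- The highest branching node below a node, named by the least rank in its second child. -/
def gap : ℕ → ℕ → ℕ
  | 0, _ => 0
  | h + 1, u =>
    if T.cnt h (2 * u) = 0 then gap h (2 * u + 1)
    else if T.cnt h (2 * u + 1) = 0 then gap h (2 * u)
    else T.lo h (2 * u + 1)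

theorem bh_le (h u : ℕ) : T.bh h u ≤ h := by
  induction h generalizing u with
  | zero => simp [bh]
  | succ h ih =>
    have h1 := ih (2 * u)
    have h2 := ih (2 * u + 1)
    rw [bh]
    split_ifs <;> omega

theorem bh_le_cnt (h u : ℕ) : T.bh h u ≤ T.cnt h u - 1 := by
  induction h generalizing u with
  | zero => simp [bh]
  | succ h ih =>
    have h1 := ih (2 * u)
    have h2 := ih (2 * u + 1)
    rw [bh, cnt_succ]
    split_ifs <;> omega

theorem bh_eq_zero {h u : ℕ} (hc : T.cnt h u ≤ 1) : T.bh h u = 0 := by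
  have := T.bh_le_cnt h u
  omega

theorem gap_eq_zero {h u : ℕ} (hc : T.cnt h u ≤ 1) : T.gap h u = 0 := by
  induction h generalizing u with
  | zero => rfl
  | succ h ih =>
    rw [cnt_succ] at hc
    rw [gap]
    split_ifs
    · exact ih (by omega)
    · exact ih (by omega)
    · omega

theorem bh_pos {h u : ℕ} (hc : 2 ≤ T.cnt h u) : 0 < T.bh h u := by
  induction h generalizing u with
  | zero => have := T.cnt_zero_le u; omega
  | succ h ih =>
    rw [cnt_succ] at hc
    rw [bh]
    split_ifs
    · exact ih (by omega)
    · exact ih (by omega)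
    · omega

theorem sep_lo_of_ne_zero {h u : ℕ} (h0 : T.cnt h (2 * u) ≠ 0) (h1 : T.cnt h (2 * u + 1) ≠ 0) :
    0 < T.lo h (2 * u + 1) ∧ T.lo h (2 * u + 1) < n ∧ T.sep (T.lo h (2 * u + 1)) = h + 1 ∧
      T.key (T.lo h (2 * u + 1)) / 2 ^ (h + 1) = u := by
  have hlo := T.lo_succ h (2 * u)
  have hle := T.lo_add_cnt_le h (2 * u + 1)
  set r := T.lo h (2 * u + 1) with hr
  have h2 := (T.key_div_eq_iff (r := r) (h := h) (u := 2 * u + 1) (by omega)).2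
    ⟨le_rfl, by omega⟩
  have h3 := (T.key_div_eq_iff (r := r - 1) (h := h) (u := 2 * u) (by omega)).2
    ⟨by omega, by omega⟩
  refine ⟨by omega, by omega, le_antisymm ?_ ?_, by rw [key_div_pow_succ]; omega⟩
  · rw [T.sep_le_iff (by omega) (by omega), key_div_pow_succ, key_div_pow_succ]
    omega
  · rw [Nat.succ_le_iff, ← not_le, T.sep_le_iff (by omega) (by omega)]
    omega

theorem exists_gap {h u : ℕ} (hc : 2 ≤ T.cnt h u) :
    ∃ r, 0 < r ∧ r < n ∧ T.sep r ≤ h ∧ T.key r / 2 ^ h = u ∧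
      T.cnt (T.sep r) (T.key r / 2 ^ T.sep r) = T.cnt h u := by
  induction h generalizing u with
  | zero => have := T.cnt_zero_le u; omega
  | succ h ih =>
    have hs := T.cnt_succ h u
    by_cases h1 : T.cnt h (2 * u) = 0
    · obtain ⟨r, h2, h3, h4, h5, h6⟩ := ih (u := 2 * u + 1) (by omega)
      exact ⟨r, h2, h3, by omega, by rw [key_div_pow_succ]; omega, by omega⟩
    by_cases h1' : T.cnt h (2 * u + 1) = 0
    · obtain ⟨r, h2, h3, h4, h5, h6⟩ := ih (u := 2 * u) (by omega)
      exact ⟨r, h2, h3, by omega, by rw [key_div_pow_succ]; omega, by omega⟩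
    obtain ⟨h2, h3, h4, h5⟩ := T.sep_lo_of_ne_zero h1 h1'
    exact ⟨_, h2, h3, h4.le, h5, by rw [h4, h5]⟩

/-- A node with the same keys as the branching node `r` has the same data. -/
theorem of_cnt_eq {r h : ℕ} (h0 : 0 < r) (hr : r < n) (hh : T.sep r ≤ h)
    (hc : T.cnt h (T.key r / 2 ^ h) = T.cnt (T.sep r) (T.key r / 2 ^ T.sep r)) :
    T.lo h (T.key r / 2 ^ h) = T.lo (T.sep r) (T.key r / 2 ^ T.sep r) ∧
    T.gap h (T.key r / 2 ^ h) = r ∧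
    T.bh h (T.key r / 2 ^ h) = T.bh (T.sep r) (T.key r / 2 ^ T.sep r) := by
  induction h, hh using Nat.le_induction with
  | base =>
    refine ⟨rfl, ?_, rfl⟩
    obtain ⟨h, hh, -⟩ := T.exists_sep_eq_succ h0 hr
    obtain ⟨h1, h2, h3⟩ := T.lo_sep h0 hr hh
    rw [hh, gap, if_neg (by omega), if_neg (by omega), h1]
  | succ h hh ih =>
    have h1 := T.cnt_le_of_le (r := r) hh
    have h2 := T.cnt_succ h (T.key r / 2 ^ (h + 1))
    have h3 := T.cnt_pos hr (T.sep r)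
    have hu := T.key_div_pow_succ r h
    have hl1 := T.lo_two_mul h (T.key r / 2 ^ (h + 1))
    have hl2 := T.lo_two_mul_add_one h (T.key r / 2 ^ (h + 1))
    rcases Nat.mod_two_eq_zero_or_one (T.key r / 2 ^ h) with hm | hm
    · have he : T.key r / 2 ^ h = 2 * (T.key r / 2 ^ (h + 1)) := by omega
      rw [← he] at h2 hl1
      obtain ⟨i1, i2, i3⟩ := ih (by omega)
      rw [gap, bh, ← he, if_neg (by omega), if_pos (by omega), if_neg (by omega), if_pos (by omega)]
      exact ⟨by omega, i2, i3⟩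
    · have he : T.key r / 2 ^ h = 2 * (T.key r / 2 ^ (h + 1)) + 1 := by omega
      rw [← he] at h2 hl2
      obtain ⟨i1, i2, i3⟩ := ih (by omega)
      rw [gap, bh, ← he, if_pos (by omega), if_pos (by omega)]
      exact ⟨by omega, i2, i3⟩

end Trie

/-! ### Branching nodes -/

namespace Trie

variable {n H : ℕ} (T : Trie n H)

/-- The first rank in the branching node `r`. -/
def left (r : ℕ) : ℕ := T.lo (T.sep r) (T.key r / 2 ^ T.sep r)

/-- The first rank after the branching node `r`. -/
def right (r : ℕ) : ℕ := T.left r + T.cnt (T.sep r) (T.key r / 2 ^ T.sep r)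

/-- The height of the highest node with the same keys as the branching node `r`. -/
def top (r : ℕ) : ℕ := min (T.sep (T.left r)) (T.sep (T.right r)) - 1

/-- The height of the children of the branching node `p`. -/
def childH (p : ℕ) : ℕ := T.sep p - 1

/-- The index, among the nodes of its height, of the child number `b` of the branching node `p`. -/
def childU (p b : ℕ) : ℕ := 2 * (T.key p / 2 ^ T.sep p) + b

variable {T}

theorem childH_add_one {p : ℕ} (h0 : 0 < p) (hp : p < n) : T.childH p + 1 = T.sep p := by
  obtain ⟨h, hh, -⟩ := T.exists_sep_eq_succ h0 hp
  rw [childH, hh]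
  rfl

theorem key_pred_div_childH {p : ℕ} (h0 : 0 < p) (hp : p < n) :
    T.key (p - 1) / 2 ^ T.childH p = T.childU p 0 := by
  obtain ⟨h, hh, h1, -⟩ := T.exists_sep_eq_succ h0 hp
  rw [childH, childU, hh]
  exact h1

theorem key_div_childH {p : ℕ} (h0 : 0 < p) (hp : p < n) :
    T.key p / 2 ^ T.childH p = T.childU p 1 := by
  obtain ⟨h, hh, -, h1⟩ := T.exists_sep_eq_succ h0 hp
  rw [childH, childU, hh]
  exact h1

theorem lo_childU_zero {p : ℕ} (h0 : 0 < p) (hp : p < n) :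
    T.lo (T.childH p) (T.childU p 0) = T.left p := by
  rw [childU, Nat.add_zero, lo_two_mul, childH_add_one h0 hp, left]

theorem lo_childU_one {p : ℕ} (h0 : 0 < p) (hp : p < n) :
    T.lo (T.childH p) (T.childU p 1) = p := by
  have := (T.lo_sep h0 hp (childH_add_one h0 hp).symm).1
  rwa [childH_add_one h0 hp] at this

theorem hi_childU_zero {p : ℕ} (h0 : 0 < p) (hp : p < n) :
    T.lo (T.childH p) (T.childU p 0) + T.cnt (T.childH p) (T.childU p 0) = p := by
  rw [← lo_succ]
  exact lo_childU_one h0 hp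

theorem hi_childU_one {p : ℕ} (h0 : 0 < p) (hp : p < n) :
    T.lo (T.childH p) (T.childU p 1) + T.cnt (T.childH p) (T.childU p 1) = T.right p := by
  have h1 := hi_childU_zero (T := T) h0 hp
  have h2 := T.cnt_succ (T.childH p) (T.key p / 2 ^ T.sep p)
  rw [childH_add_one h0 hp] at h2
  have h3 := lo_childU_zero (T := T) h0 hp
  have h4 := lo_childU_one (T := T) h0 hp
  rw [right]
  simp only [childU] at *
  rw [Nat.add_zero] at *
  omega

theorem cnt_childU_pos {p b : ℕ} (h0 : 0 < p) (hp : p < n) (hb : b < 2) :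
    0 < T.cnt (T.childH p) (T.childU p b) := by
  have h := (T.lo_sep h0 hp (childH_add_one h0 hp).symm).2
  rw [childH_add_one h0 hp] at h
  obtain rfl | rfl : b = 0 ∨ b = 1 := by omega
  · exact h.1
  · exact h.2

theorem left_lt {r : ℕ} (h0 : 0 < r) (hr : r < n) : T.left r < r := by
  have h1 := hi_childU_zero (T := T) h0 hr
  have h2 := lo_childU_zero (T := T) h0 hr
  have h3 := cnt_childU_pos (T := T) h0 hr (b := 0) (by omega)
  omega

theorem lt_right {r : ℕ} (h0 : 0 < r) (hr : r < n) : r < T.right r := by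
  have h1 := hi_childU_one (T := T) h0 hr
  have h2 := lo_childU_one (T := T) h0 hr
  have h3 := cnt_childU_pos (T := T) h0 hr (b := 1) (by omega)
  omega

theorem right_le (r : ℕ) : T.right r ≤ n := T.lo_add_cnt_le _ _

theorem key_div_sep {r r' : ℕ} (h1 : T.left r ≤ r') (h2 : r' < T.right r) :
    T.key r' / 2 ^ T.sep r = T.key r / 2 ^ T.sep r :=
  (T.key_div_eq_iff (h2.trans_le (right_le r))).2 ⟨h1, h2⟩

theorem sep_lt_sep_left {r : ℕ} (h0 : 0 < r) (hr : r < n) : T.sep r < T.sep (T.left r) :=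
  T.lt_sep_lo (T.sep_le h0 hr) (T.cnt_pos hr _)

theorem sep_lt_sep_right {r : ℕ} (h0 : 0 < r) (hr : r < n) : T.sep r < T.sep (T.right r) :=
  T.lt_sep_hi (T.sep_le h0 hr) (T.cnt_pos hr _)

theorem sep_le_top {r : ℕ} (h0 : 0 < r) (hr : r < n) : T.sep r ≤ T.top r := by
  have h1 := sep_lt_sep_left (T := T) h0 hr
  have h2 := sep_lt_sep_right (T := T) h0 hr
  rw [top]; omega

theorem lo_cnt_top {r : ℕ} (h0 : 0 < r) (hr : r < n) :
    T.lo (T.top r) (T.key r / 2 ^ T.top r) = T.left r ∧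
      T.cnt (T.top r) (T.key r / 2 ^ T.top r) = T.cnt (T.sep r) (T.key r / 2 ^ T.sep r) := by
  have h1 := sep_lt_sep_left (T := T) h0 hr
  have h2 := sep_lt_sep_right (T := T) h0 hr
  have h3 := left_lt (T := T) h0 hr
  have h4 := lt_right (T := T) h0 hr
  obtain ⟨h5, h6⟩ := T.lo_eq_of_interval (l := T.left r) (hi := T.right r) (h := T.top r)
    (u := T.key r / 2 ^ T.top r) (by omega) (right_le r)
    (fun r' h7 h8 => T.key_div_of_le (sep_le_top h0 hr) (key_div_sep h7 h8))
    (by rw [top]; omega) (by rw [top]; omega)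
  exact ⟨h5, by rw [h6, right]; omega⟩

theorem cnt_of_le_top {r h : ℕ} (h0 : 0 < r) (hr : r < n) (h1 : T.sep r ≤ h) (h2 : h ≤ T.top r) :
    T.cnt h (T.key r / 2 ^ h) = T.cnt (T.sep r) (T.key r / 2 ^ T.sep r) := by
  have h3 := T.cnt_le_of_le (r := r) h1
  have h4 := T.cnt_le_of_le (r := r) h2
  have h5 := (lo_cnt_top (T := T) h0 hr).2
  omega

theorem gap_bh_top {r : ℕ} (h0 : 0 < r) (hr : r < n) :
    T.gap (T.top r) (T.key r / 2 ^ T.top r) = r ∧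
      T.bh (T.top r) (T.key r / 2 ^ T.top r) = T.bh (T.sep r) (T.key r / 2 ^ T.sep r) :=
  (T.of_cnt_eq h0 hr (sep_le_top h0 hr) (lo_cnt_top h0 hr).2).2

theorem bh_sep {r : ℕ} (h0 : 0 < r) (hr : r < n) :
    T.bh (T.sep r) (T.key r / 2 ^ T.sep r) =
      max (T.bh (T.childH r) (T.childU r 0)) (T.bh (T.childH r) (T.childU r 1)) + 1 := by
  have h1 := cnt_childU_pos (T := T) h0 hr (b := 0) (by omega)
  have h2 := cnt_childU_pos (T := T) h0 hr (b := 1) (by omega)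
  conv_lhs => rw [← childH_add_one h0 hr]
  rw [bh, childH_add_one h0 hr]
  simp only [childU] at *
  rw [Nat.add_zero] at *
  rw [if_neg (by omega), if_neg (by omega)]
  rfl

/-- A child of a branching node `p`, if it contains at least two keys, is the highest node with the
same keys as the branching node `r` below it. The height of separation of its left and right ends
tells which end is `p`. -/
theorem of_gap_child {p b r : ℕ} (h0 : 0 < p) (hp : p < n) (hb : b < 2)
    (hc : 2 ≤ T.cnt (T.childH p) (T.childU p b)) (hr : T.gap (T.childH p) (T.childU p b) = r) :
    0 < r ∧ r < n ∧ T.top r = T.childH p ∧ T.key r / 2 ^ T.top r = T.childU p b ∧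
      (b = 0 → T.right r = p ∧ T.sep (T.right r) < T.sep (T.left r)) ∧
      (b = 1 → T.left r = p ∧ T.sep (T.left r) < T.sep (T.right r)) := by
  obtain ⟨r', h0', hr', h1, h2, h3⟩ := T.exists_gap hc
  rw [← h2] at h3
  obtain ⟨h4, h5, h6⟩ := T.of_cnt_eq h0' hr' h1 h3.symm
  rw [h2, hr] at h5
  subst h5
  rw [h2] at h3 h4
  have hl : T.left r = T.lo (T.childH p) (T.childU p b) := h4.symm
  have hrt : T.right r = T.lo (T.childH p) (T.childU p b) + T.cnt (T.childH p) (T.childU p b) := by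
    rw [right, hl, h3]
  have hs1 := sep_lt_sep_left (T := T) h0 hp
  have hs2 := sep_lt_sep_right (T := T) h0 hp
  have hs3 := childH_add_one (T := T) h0 hp
  obtain rfl | rfl : b = 0 ∨ b = 1 := by omega
  · rw [lo_childU_zero h0 hp] at hl
    rw [hi_childU_zero h0 hp] at hrt
    have ht : T.top r = T.childH p := by rw [top, hl, hrt, childH]; omega
    exact ⟨h0', hr', ht, ht ▸ h2, fun _ => ⟨hrt, by rw [hrt, hl]; exact hs1⟩, by simp⟩
  · rw [hi_childU_one h0 hp] at hrt
    rw [lo_childU_one h0 hp] at hl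
    have ht : T.top r = T.childH p := by rw [top, hl, hrt, childH]; omega
    exact ⟨h0', hr', ht, ht ▸ h2, by simp, fun _ => ⟨hl, by rw [hrt, hl]; exact hs2⟩⟩

theorem child_left {r : ℕ} (h0 : 0 < r) (hr : r < n) (h : T.sep (T.left r) < T.sep (T.right r)) :
    0 < T.left r ∧ T.left r < n ∧ T.childH (T.left r) = T.top r ∧
      T.childU (T.left r) 1 = T.key r / 2 ^ T.top r := by
  have h1 := T.sep_le_succ (T.right r)
  obtain ⟨h2, h3⟩ := T.pos_lt_of_sep_le (r := T.left r) (by omega)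
  have h4 : T.childH (T.left r) = T.top r := by rw [childH, top]; omega
  refine ⟨h2, h3, h4, ?_⟩
  rw [← key_div_childH h2 h3, h4]
  have := left_lt (T := T) h0 hr
  have := lt_right (T := T) h0 hr
  exact T.key_div_of_le (sep_le_top h0 hr) (key_div_sep le_rfl (by omega))

theorem child_right {r : ℕ} (h0 : 0 < r) (hr : r < n) (h : T.sep (T.right r) < T.sep (T.left r)) :
    0 < T.right r ∧ T.right r < n ∧ T.childH (T.right r) = T.top r ∧
      T.childU (T.right r) 0 = T.key r / 2 ^ T.top r := by
  have h1 := T.sep_le_succ (T.left r)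
  obtain ⟨h2, h3⟩ := T.pos_lt_of_sep_le (r := T.right r) (by omega)
  have h4 : T.childH (T.right r) = T.top r := by rw [childH, top]; omega
  refine ⟨h2, h3, h4, ?_⟩
  rw [← key_pred_div_childH h2 h3, h4]
  have := left_lt (T := T) h0 hr
  have := lt_right (T := T) h0 hr
  exact T.key_div_of_le (sep_le_top h0 hr) (key_div_sep (by omega) (by omega))

/-- The highest branching node. -/
theorem root_gap (hn : 2 ≤ n) : 0 < T.gap H 0 ∧ T.gap H 0 < n ∧ T.left (T.gap H 0) = 0 ∧
    T.right (T.gap H 0) = n ∧ T.top (T.gap H 0) = H := by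
  obtain ⟨r, h0, hr, h1, h2, h3⟩ := T.exists_gap (h := H) (u := 0) (by rw [T.cnt_root]; exact hn)
  rw [← h2] at h3
  obtain ⟨h4, h5, h6⟩ := T.of_cnt_eq h0 hr h1 h3.symm
  rw [h2] at h3 h4 h5
  rw [h5]
  have hl : T.left r = 0 := by rw [left, ← h4, T.lo_zero]
  have hrt : T.right r = n := by rw [right, hl, h3, T.cnt_root, Nat.zero_add]
  refine ⟨h0, hr, hl, hrt, ?_⟩
  rw [top, hl, hrt, T.sep_of_not (by omega), T.sep_of_not (by omega)]
  omega

theorem gap_root_eq {r : ℕ} (h0 : 0 < r) (hr : r < n) (hl : T.left r = 0) (hrt : T.right r = n) :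
    T.gap H 0 = r := by
  have ht : T.top r = H := by
    rw [top, hl, hrt, T.sep_of_not (by omega), T.sep_of_not (by omega)]
    omega
  have := (gap_bh_top (T := T) h0 hr).1
  rwa [ht, Nat.div_eq_of_lt (T.key_lt r hr)] at this

end Trie

/-! ### The dynamic program on a trie -/

theorem bestSplit_le {d : ℕ} (rnd : ℝ → ℝ) (t₁ t₂ : Table d) (k : ℕ) :
    bestSplit rnd t₁ t₂ k ≤ k := by
  rcases Set.eq_empty_or_nonempty {k₁ | k₁ ≤ k ∧
    ∀ j ≤ k, rnd (t₁.val k₁ + t₂.val (k - k₁)) ≤ rnd (t₁.val j + t₂.val (k - j))} with h | h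
  · rw [bestSplit, h, Nat.sInf_empty]; exact Nat.zero_le k
  · exact (Nat.sInf_mem h).1

theorem bestSplit_congr {d : ℕ} {rnd : ℝ → ℝ} {t₁ t₂ t₁' t₂' : Table d} {k : ℕ}
    (h₁ : ∀ j ≤ k, t₁.val j = t₁'.val j) (h₂ : ∀ j ≤ k, t₂.val j = t₂'.val j) :
    bestSplit rnd t₁ t₂ k = bestSplit rnd t₁' t₂' k := by
  unfold bestSplit
  congr 1
  ext k₁
  rw [Set.mem_ofPred_eq, Set.mem_ofPred_eq]
  refine and_congr_right fun hk => forall₂_congr fun j hj => ?_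
  rw [h₁ j hj, h₂ (k - j) (by omega), h₁ k₁ hk, h₂ (k - k₁) (by omega)]

/-- The data of a dynamic program on the nodes `(h, u)` of a binary trie: the weight of a node as a
function of the number of its keys, the diameters and the centers of the nodes, the threshold, and
the rounding map. -/
structure NodeData (d : ℕ) where
  weight : ℕ → ℕ → ℕ → ℝ
  diam : ℕ → ℕ → ℝ
  center : ℕ → ℕ → Fin d → ℝ
  thr : ℝ
  rnd : ℝ → ℝ

namespace NodeData

variable {d : ℕ} (N : NodeData d)

/-- The result at a node of weight `w` at which the recursion stops. -/
def leaf (h u : ℕ) (w : ℝ) : Table d where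
  val k' := if k' = 0 then N.rnd (w * N.diam h u) else N.rnd 0
  sol _ _ := fun j => N.rnd (N.center h u j)

/-- The result at a node of weight `w` whose children have the results `t₁` and `t₂`. -/
def node (h u : ℕ) (w : ℝ) (t₁ t₂ : Table d) : Table d where
  val k' := if k' = 0 then N.rnd (w * N.diam h u) else
    N.rnd (t₁.val (bestSplit N.rnd t₁ t₂ k') + t₂.val (k' - bestSplit N.rnd t₁ t₂ k'))
  sol k' a :=
    if a < bestSplit N.rnd t₁ t₂ k' then t₁.sol (bestSplit N.rnd t₁ t₂ k') a
    else t₂.sol (k' - bestSplit N.rnd t₁ t₂ k') (a - bestSplit N.rnd t₁ t₂ k')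

open Classical in
/-- The result of the dynamic program at a node, when `c` counts the keys in the nodes. The children
of a node whose weight is exactly the threshold have weight `0`. -/
def table (c : ℕ → ℕ → ℕ) : ℕ → ℕ → Table d
  | 0, u => N.leaf 0 u 0
  | h + 1, u =>
    if N.weight (h + 1) u (c (h + 1) u) < N.thr then
      N.leaf (h + 1) u (N.weight (h + 1) u (c (h + 1) u))
    else if N.thr < N.weight (h + 1) u (c (h + 1) u) then
      N.node (h + 1) u (N.weight (h + 1) u (c (h + 1) u))
        (table c h (2 * u)) (table c h (2 * u + 1))
    else
      N.node (h + 1) u (N.weight (h + 1) u (c (h + 1) u))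
        (N.leaf h (2 * u) 0) (N.leaf h (2 * u + 1) 0)

variable {N} {n H : ℕ} {T T' : Trie n H}

theorem table_eq_of_cnt_eq_zero {h u : ℕ} (h0 : T.cnt h u = 0) (h0' : T'.cnt h u = 0) :
    N.table T.cnt h u = N.table T'.cnt h u := by
  induction h generalizing u with
  | zero => rfl
  | succ h ih =>
    have h1 := T.cnt_succ h u
    have h1' := T'.cnt_succ h u
    rw [table, table, h0, h0', ih (u := 2 * u) (by omega) (by omega),
      ih (u := 2 * u + 1) (by omega) (by omega)]

theorem table_eq_of_cnt_eq_one {h r r' : ℕ} (hr : r < n) (hr' : r' < n)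
    (h1 : T.cnt h (T.key r / 2 ^ h) = 1) (h1' : T'.cnt h (T'.key r' / 2 ^ h) = 1)
    (hk : T.key r = T'.key r') :
    N.table T.cnt h (T.key r / 2 ^ h) = N.table T'.cnt h (T.key r / 2 ^ h) := by
  induction h with
  | zero => rfl
  | succ h ih =>
    have hp := T.cnt_pos hr h
    have hp' := T'.cnt_pos hr' h
    have hu := T.key_div_pow_succ r h
    rw [← hk] at h1' hp' ih
    have h2 := T.cnt_succ h (T.key r / 2 ^ (h + 1))
    have h2' := T'.cnt_succ h (T.key r / 2 ^ (h + 1))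
    rw [table, table, h1, h1']
    rcases Nat.mod_two_eq_zero_or_one (T.key r / 2 ^ h) with hm | hm
    · have he : T.key r / 2 ^ h = 2 * (T.key r / 2 ^ (h + 1)) := by omega
      rw [he] at ih hp hp'
      rw [ih (by omega) (by omega), table_eq_of_cnt_eq_zero (T := T) (T' := T')
        (u := 2 * (T.key r / 2 ^ (h + 1)) + 1) (by omega) (by omega)]
    · have he : T.key r / 2 ^ h = 2 * (T.key r / 2 ^ (h + 1)) + 1 := by omega
      rw [he] at ih hp hp'
      rw [ih (by omega) (by omega), table_eq_of_cnt_eq_zero (T := T) (T' := T')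
        (u := 2 * (T.key r / 2 ^ (h + 1))) (by omega) (by omega)]

theorem node_val_congr {h u k : ℕ} {w : ℝ} {t₁ t₂ t₁' t₂' : Table d}
    (h₁ : ∀ j ≤ k, t₁.val j = t₁'.val j) (h₂ : ∀ j ≤ k, t₂.val j = t₂'.val j) :
    ∀ j ≤ k, (N.node h u w t₁ t₂).val j = (N.node h u w t₁' t₂').val j := by
  intro j hj
  have hb := bestSplit_congr (rnd := N.rnd) (k := j) (fun i hi => h₁ i (hi.trans hj))
    (fun i hi => h₂ i (hi.trans hj))
  have hle := bestSplit_le N.rnd t₁' t₂' j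
  simp only [node]
  rw [hb, h₁ _ (hle.trans hj), h₂ _ ((Nat.sub_le _ _).trans hj)]

theorem table_val_congr {c c' : ℕ → ℕ → ℕ} {h u k : ℕ} (hc : c (h + 1) u = c' (h + 1) u)
    (h₁ : ∀ j ≤ k, (N.table c h (2 * u)).val j = (N.table c' h (2 * u)).val j)
    (h₂ : ∀ j ≤ k, (N.table c h (2 * u + 1)).val j = (N.table c' h (2 * u + 1)).val j) :
    ∀ j ≤ k, (N.table c (h + 1) u).val j = (N.table c' (h + 1) u).val j := by
  rw [table, table, hc]
  split_ifs
  · exact fun _ _ => rfl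
  · exact node_val_congr h₁ h₂
  · exact fun _ _ => rfl

theorem table_eq_of_not_lt {c c' : ℕ → ℕ → ℕ} {h u : ℕ} (hc : c (h + 1) u = c' (h + 1) u)
    (hw : ¬ N.thr < N.weight (h + 1) u (c (h + 1) u)) :
    N.table c (h + 1) u = N.table c' (h + 1) u := by
  rw [table, table, ← hc, if_neg hw, if_neg hw]

variable (N) in
/-- The step from a node to its children with the results `t₁` and `t₂`, for center number `a` of a
solution with `β` centers: the number of the child whose solution provides the center, the number of
centers of that solution, and the number of the center among them. -/
def split (t₁ t₂ : Table d) (β a : ℕ) : ℕ × ℕ × ℕ :=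
  if a < bestSplit N.rnd t₁ t₂ β then (0, bestSplit N.rnd t₁ t₂ β, a)
  else (1, β - bestSplit N.rnd t₁ t₂ β, a - bestSplit N.rnd t₁ t₂ β)

theorem split_fst_lt (t₁ t₂ : Table d) (β a : ℕ) : (N.split t₁ t₂ β a).1 < 2 := by
  unfold split; split_ifs <;> simp

theorem split_snd_le (t₁ t₂ : Table d) (β a : ℕ) : (N.split t₁ t₂ β a).2.1 ≤ β := by
  have := bestSplit_le N.rnd t₁ t₂ β
  unfold split; split_ifs <;> simp [this]

theorem split_snd_snd_le (t₁ t₂ : Table d) (β a : ℕ) : (N.split t₁ t₂ β a).2.2 ≤ a := by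
  unfold split; split_ifs <;> simp

theorem split_congr {t₁ t₂ t₁' t₂' : Table d} {β : ℕ} (a : ℕ)
    (h₁ : ∀ j ≤ β, t₁.val j = t₁'.val j) (h₂ : ∀ j ≤ β, t₂.val j = t₂'.val j) :
    N.split t₁ t₂ β a = N.split t₁' t₂' β a := by
  rw [split, split, bestSplit_congr h₁ h₂]

variable (N) (T)

open Classical in
/-- Follow the center number `a` of the solution with `β` centers from the node `(h, u)` down the
tree, until either its coordinates are found without using a node of another branching node, or it
enters a child with at least two keys of a branching node. In this case the result is the name of
the highest branching node of the child, the number of centers of the solution there, and the number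
of the center among them. -/
def walk : ℕ → ℕ → ℕ → ℕ → (ℕ × ℕ × ℕ) ⊕ (Fin d → ℝ)
  | 0, u, β, a => Sum.inr ((N.table T.cnt 0 u).sol β a)
  | h + 1, u, β, a =>
    if N.thr < N.weight (h + 1) u (T.cnt (h + 1) u) then
      let s := N.split (N.table T.cnt h (2 * u)) (N.table T.cnt h (2 * u + 1)) β a
      if T.cnt h (2 * u + s.1) ≤ 1 then Sum.inr ((N.table T.cnt h (2 * u + s.1)).sol s.2.1 s.2.2)
      else if T.cnt h (2 * u) = 0 ∨ T.cnt h (2 * u + 1) = 0 then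
        walk h (2 * u + s.1) s.2.1 s.2.2
      else Sum.inl (T.gap h (2 * u + s.1), s.2.1, s.2.2)
    else Sum.inr ((N.table T.cnt (h + 1) u).sol β a)

variable {N T}

theorem table_sol_eq {c : ℕ → ℕ → ℕ} {h u β a : ℕ} (hw : N.thr < N.weight (h + 1) u (c (h + 1) u))
    {s : ℕ × ℕ × ℕ} (hs : N.split (N.table c h (2 * u)) (N.table c h (2 * u + 1)) β a = s) :
    (N.table c (h + 1) u).sol β a = (N.table c h (2 * u + s.1)).sol s.2.1 s.2.2 := by
  subst hs
  rw [table, if_neg hw.le.not_gt, if_pos hw]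
  simp only [node]
  unfold split
  split_ifs <;> rfl

theorem sol_of_walk_eq_inr {h u β a : ℕ} {y : Fin d → ℝ} (hy : N.walk T h u β a = Sum.inr y) :
    (N.table T.cnt h u).sol β a = y := by
  induction h generalizing u β a with
  | zero => exact Sum.inr_injective hy
  | succ h ih =>
    rw [walk] at hy
    by_cases hw : N.thr < N.weight (h + 1) u (T.cnt (h + 1) u)
    · rw [if_pos hw] at hy
      generalize hs : N.split (N.table T.cnt h (2 * u)) (N.table T.cnt h (2 * u + 1)) β a = s at hy
      rw [table_sol_eq hw hs]
      simp only at hy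
      split_ifs at hy
      · exact Sum.inr_injective hy
      · exact ih hy
    · rw [if_neg hw] at hy
      exact Sum.inr_injective hy

theorem of_walk_eq_inl {h u β a r β' a' : ℕ} (hy : N.walk T h u β a = Sum.inl (r, β', a')) :
    ∃ p b, 0 < p ∧ p < n ∧ b < 2 ∧ 2 ≤ T.cnt (T.childH p) (T.childU p b) ∧
      T.gap (T.childH p) (T.childU p b) = r ∧
      (N.table T.cnt h u).sol β a =
        (N.table T.cnt (T.childH p) (T.childU p b)).sol β' a' ∧
      β' ≤ β ∧ a' ≤ a ∧ T.bh (T.childH p) (T.childU p b) < T.bh h u := by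
  induction h generalizing u β a with
  | zero => simp [walk] at hy
  | succ h ih =>
    rw [walk] at hy
    by_cases hw : N.thr < N.weight (h + 1) u (T.cnt (h + 1) u)
    swap
    · rw [if_neg hw] at hy
      exact absurd hy (by simp)
    rw [if_pos hw] at hy
    have hb := split_fst_lt (N := N) (N.table T.cnt h (2 * u)) (N.table T.cnt h (2 * u + 1)) β a
    have hβ := split_snd_le (N := N) (N.table T.cnt h (2 * u)) (N.table T.cnt h (2 * u + 1)) β a
    have ha := split_snd_snd_le (N := N)
      (N.table T.cnt h (2 * u)) (N.table T.cnt h (2 * u + 1)) β a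
    generalize hs : N.split (N.table T.cnt h (2 * u)) (N.table T.cnt h (2 * u + 1)) β a = s
      at hy hb hβ ha
    rw [table_sol_eq hw hs]
    obtain ⟨b, β₁, a₁⟩ := s
    simp only at hy hb hβ ha ⊢
    split_ifs at hy with h1 h2
    · obtain ⟨p, b', i0, i1, i2, i3, i4, i5, i6, i7, i8⟩ := ih hy
      refine ⟨p, b', i0, i1, i2, i3, i4, i5, i6.trans hβ, i7.trans ha, i8.trans_le ?_⟩
      rw [Trie.bh]
      obtain rfl | rfl : b = 0 ∨ b = 1 := by omega
      · rw [Nat.add_zero] at h1 ⊢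
        rw [if_neg (by omega), if_pos (by omega)]
      · rw [if_pos (by omega)]
    · push Not at h2
      obtain ⟨h3, h4⟩ := Prod.mk.inj (Sum.inl_injective hy)
      obtain ⟨h4, h5⟩ := Prod.mk.inj h4
      obtain ⟨j1, j2, j3, j4⟩ := T.sep_lo_of_ne_zero h2.1 h2.2
      have hH : T.childH (T.lo h (2 * u + 1)) = h := by rw [Trie.childH, j3]; rfl
      have hU : T.childU (T.lo h (2 * u + 1)) b = 2 * u + b := by rw [Trie.childU, j3, j4]
      refine ⟨T.lo h (2 * u + 1), b, j1, j2, hb, ?_⟩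
      rw [hH, hU, ← h4, ← h5]
      refine ⟨by omega, h3, rfl, hβ, ha, ?_⟩
      rw [Trie.bh, if_neg h2.1, if_neg h2.2]
      obtain rfl | rfl : b = 0 ∨ b = 1 := by omega
      · exact Nat.lt_succ_of_le (le_max_left _ _)
      · exact Nat.lt_succ_of_le (le_max_right _ _)

end NodeData

theorem Trie.sep_congr {n H : ℕ} {T T' : Trie n H} {r : ℕ}
    (h1 : 0 < r → r < n → T.key (r - 1) = T'.key (r - 1))
    (h2 : 0 < r → r < n → T.key r = T'.key r) : T.sep r = T'.sep r := by
  by_cases h : 0 < r ∧ r < n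
  · rw [sep, sep, h1 h.1 h.2, h2 h.1 h.2]
  · rw [sep_of_not _ h, sep_of_not _ h]

/-- The node `(h, u)` has the same data in two tries, where only the first `k + 1` values of the
dynamic program are compared. -/
structure NodeAgree {d n H : ℕ} (N : NodeData d) (T T' : Trie n H) (k h u : ℕ) : Prop where
  lo : T.lo h u = T'.lo h u
  cnt : T.cnt h u = T'.cnt h u
  sep_lo : T.sep (T.lo h u) = T'.sep (T'.lo h u)
  sep_hi : T.sep (T.lo h u + T.cnt h u) = T'.sep (T'.lo h u + T'.cnt h u)
  bh : T.bh h u = T'.bh h u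
  gap : T.gap h u = T'.gap h u
  val : ∀ j ≤ k, (N.table T.cnt h u).val j = (N.table T'.cnt h u).val j

/-- The branching node `r` has the same data in two tries, as far as these are given by its two
adjacent keys and by the data of its children. -/
structure GapAgree {d n H : ℕ} (N : NodeData d) (T T' : Trie n H) (k r : ℕ) : Prop where
  pos : 0 < r
  lt : r < n
  key_pred : T.key (r - 1) = T'.key (r - 1)
  key : T.key r = T'.key r
  node : ∀ b < 2, NodeAgree N T T' k (T.childH r) (T.childU r b)

namespace GapAgree

variable {d n H k r : ℕ} {N : NodeData d} {T T' : Trie n H}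

theorem sep (A : GapAgree N T T' k r) : T.sep r = T'.sep r :=
  Trie.sep_congr (fun _ _ => A.key_pred) (fun _ _ => A.key)

theorem childH (A : GapAgree N T T' k r) : T.childH r = T'.childH r := by
  rw [Trie.childH, Trie.childH, A.sep]

theorem childU (A : GapAgree N T T' k r) (b : ℕ) : T.childU r b = T'.childU r b := by
  rw [Trie.childU, Trie.childU, A.sep, A.key]

theorem cnt_sep (A : GapAgree N T T' k r) : T.cnt (T.sep r) (T.key r / 2 ^ T.sep r) =
    T'.cnt (T'.sep r) (T'.key r / 2 ^ T'.sep r) := by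
  have h0 := (A.node 0 (by omega)).cnt
  have h1 := (A.node 1 (by omega)).cnt
  have e := A.childH
  have h2 := T.cnt_succ (T.childH r) (T.key r / 2 ^ T.sep r)
  have h2' := T'.cnt_succ (T'.childH r) (T'.key r / 2 ^ T'.sep r)
  rw [Trie.childH_add_one A.pos A.lt] at h2 h2'
  rw [← e, ← A.key, ← A.sep] at h2'
  simp only [Trie.childU, Nat.add_zero] at h0 h1
  rw [← A.sep, ← A.key]
  omega

theorem table_childU_eq (A : GapAgree N T T' k r) {b : ℕ} (hb : b < 2)
    (hc : T.cnt (T.childH r) (T.childU r b) ≤ 1) :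
    N.table T.cnt (T.childH r) (T.childU r b) = N.table T'.cnt (T.childH r) (T.childU r b) := by
  have h0 := A.pos
  have hr := A.lt
  have h1 := Trie.cnt_childU_pos (T := T) h0 hr hb
  have hc' := (A.node b hb).cnt
  obtain rfl | rfl : b = 0 ∨ b = 1 := by omega
  · rw [← Trie.key_pred_div_childH h0 hr] at *
    refine NodeData.table_eq_of_cnt_eq_one (r := r - 1) (r' := r - 1) (by omega) (by omega)
      (by omega) ?_ A.key_pred
    rw [← A.key_pred]
    omega
  · rw [← Trie.key_div_childH h0 hr] at *
    refine NodeData.table_eq_of_cnt_eq_one (r := r) (r' := r) (by omega) (by omega)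
      (by omega) ?_ A.key
    rw [← A.key]
    omega

/-- The values and the walks at the nodes with the same keys as the branching node `r` are
determined by the data at `r`. -/
theorem table_val_walk (A : GapAgree N T T' k r) {h : ℕ} (h1 : T.sep r ≤ h) (h2 : h ≤ T.top r)
    (h2' : h ≤ T'.top r) :
    (∀ j ≤ k, (N.table T.cnt h (T.key r / 2 ^ h)).val j =
      (N.table T'.cnt h (T.key r / 2 ^ h)).val j) ∧
    ∀ β ≤ k, ∀ a, N.walk T h (T.key r / 2 ^ h) β a = N.walk T' h (T.key r / 2 ^ h) β a := by
  classical
  have h0 := A.pos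
  have hr := A.lt
  have hcs := A.cnt_sep
  have hp : 2 ≤ T.cnt (T.sep r) (T.key r / 2 ^ T.sep r) := by
    have hH := Trie.childH_add_one (T := T) h0 hr
    have hc0 := Trie.cnt_childU_pos (T := T) h0 hr (b := 0) (by omega)
    have hc1 := Trie.cnt_childU_pos (T := T) h0 hr (b := 1) (by omega)
    rw [← hH, T.cnt_succ, hH]
    simp only [Trie.childU, Nat.add_zero] at hc0 hc1
    omega
  induction h, h1 using Nat.le_induction with
  | base =>
    have hH := Trie.childH_add_one (T := T) h0 hr
    have hb0 := (A.node 0 (by omega)).val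
    have hb1 := (A.node 1 (by omega)).val
    have hc0 := Trie.cnt_childU_pos (T := T) h0 hr (b := 0) (by omega)
    have hc1 := Trie.cnt_childU_pos (T := T) h0 hr (b := 1) (by omega)
    have hcc0 := (A.node 0 (by omega)).cnt
    have hcc1 := (A.node 1 (by omega)).cnt
    have hg : ∀ b < 2, _ := fun b hb => (A.node b hb).gap
    have hcc : ∀ b < 2, _ := fun b hb => (A.node b hb).cnt
    have ht : ∀ b < 2, _ := fun b (hb : b < 2) => A.table_childU_eq hb
    rw [← A.sep, ← A.key] at hcs
    simp only [Trie.childU] at *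
    rw [Nat.add_zero] at *
    set u := T.key r / 2 ^ T.sep r with hu
    rw [← hH] at hcs ⊢
    set h := T.childH r
    refine ⟨NodeData.table_val_congr hcs hb0 hb1, fun β hβ a => ?_⟩
    rw [NodeData.walk, NodeData.walk, ← hcs]
    by_cases hw : N.thr < N.weight (h + 1) u (T.cnt (h + 1) u)
    · rw [if_pos hw, if_pos hw, ← NodeData.split_congr a (fun j hj => hb0 j (hj.trans hβ))
        (fun j hj => hb1 j (hj.trans hβ))]
      have hb := NodeData.split_fst_lt (N := N)
        (N.table T.cnt h (2 * u)) (N.table T.cnt h (2 * u + 1)) β a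
      generalize N.split (N.table T.cnt h (2 * u)) (N.table T.cnt h (2 * u + 1)) β a = s at hb ⊢
      obtain ⟨b, β₁, a₁⟩ := s
      simp only at hb ⊢
      rw [← hcc0, ← hcc1, ← hcc b hb, ← hg b hb]
      by_cases h3 : T.cnt h (2 * u + b) ≤ 1
      · rw [if_pos h3, if_pos h3, ht b hb h3]
      · rw [if_neg h3, if_neg h3, if_neg (by omega), if_neg (by omega)]
    · rw [if_neg hw, if_neg hw, NodeData.table_eq_of_not_lt hcs hw]
  | succ h h1 ih =>
    obtain ⟨ih1, ih2⟩ := ih (by omega) (by omega)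
    have e1 := Trie.cnt_of_le_top (T := T) h0 hr h1 (by omega)
    have e2 := Trie.cnt_of_le_top (T := T) h0 hr (h := h + 1) (Nat.le_succ_of_le h1) h2
    have e1' := Trie.cnt_of_le_top (T := T') h0 hr (A.sep ▸ h1) (by omega)
    have e2' := Trie.cnt_of_le_top (T := T') (h := h + 1) h0 hr (A.sep ▸ Nat.le_succ_of_le h1) h2'
    have hu := T.key_div_pow_succ r h
    rw [← A.key] at e1' e2'
    rw [← A.sep, ← A.key] at hcs
    rw [← A.sep] at e1' e2'
    set u := T.key r / 2 ^ (h + 1)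
    set v := T.key r / 2 ^ h
    have hs := T.cnt_succ h u
    have hs' := T'.cnt_succ h u
    have hc : T.cnt (h + 1) u = T'.cnt (h + 1) u := by omega
    -- The child that contains the key of `r` has all the keys, and the other one has none.
    obtain ⟨b, hb, hv⟩ : ∃ b < 2, v = 2 * u + b := ⟨v % 2, Nat.mod_lt _ (by omega), by omega⟩
    have hz : ∀ b' < 2, b' ≠ b → T.cnt h (2 * u + b') = 0 ∧ T'.cnt h (2 * u + b') = 0 := by
      intro b' hb' hne
      obtain rfl | rfl : b = 0 ∨ b = 1 := by omega
      · obtain rfl : b' = 1 := by omega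
        rw [hv] at e1 e1'
        simp only [Nat.add_zero] at e1 e1'
        omega
      · obtain rfl : b' = 0 := by omega
        rw [hv] at e1 e1'
        simp only [Nat.add_zero]
        omega
    have hval : ∀ b' < 2, ∀ j ≤ k, (N.table T.cnt h (2 * u + b')).val j =
        (N.table T'.cnt h (2 * u + b')).val j := by
      intro b' hb' j hj
      by_cases hne : b' = b
      · rw [hne, ← hv]; exact ih1 j hj
      · rw [NodeData.table_eq_of_cnt_eq_zero (hz b' hb' hne).1 (hz b' hb' hne).2]
    have hcnt : ∀ b' < 2, T.cnt h (2 * u + b') = T'.cnt h (2 * u + b') := by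
      intro b' hb'
      by_cases hne : b' = b
      · rw [hne, ← hv]; omega
      · rw [(hz b' hb' hne).1, (hz b' hb' hne).2]
    have hv0 := hval 0 (by omega)
    have hv1 := hval 1 (by omega)
    have hc0 := hcnt 0 (by omega)
    have hc1 := hcnt 1 (by omega)
    rw [Nat.add_zero] at hv0 hc0
    refine ⟨NodeData.table_val_congr hc hv0 hv1, fun β hβ a => ?_⟩
    rw [NodeData.walk, NodeData.walk, ← hc]
    by_cases hw : N.thr < N.weight (h + 1) u (T.cnt (h + 1) u)
    · rw [if_pos hw, if_pos hw, ← NodeData.split_congr a (fun j hj => hv0 j (hj.trans hβ))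
        (fun j hj => hv1 j (hj.trans hβ))]
      have hb' := NodeData.split_fst_lt (N := N)
        (N.table T.cnt h (2 * u)) (N.table T.cnt h (2 * u + 1)) β a
      have hβ' := NodeData.split_snd_le (N := N)
        (N.table T.cnt h (2 * u)) (N.table T.cnt h (2 * u + 1)) β a
      generalize N.split (N.table T.cnt h (2 * u)) (N.table T.cnt h (2 * u + 1)) β a = s at hb' hβ' ⊢
      obtain ⟨b', β₁, a₁⟩ := s
      simp only at hb' hβ' ⊢
      rw [← hc0, ← hc1, ← hcnt b' hb']
      have hor : T.cnt h (2 * u) = 0 ∨ T.cnt h (2 * u + 1) = 0 := by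
        obtain rfl | rfl : b = 0 ∨ b = 1 := by omega
        · exact Or.inr (hz 1 (by omega) (by omega)).1
        · exact Or.inl (hz 0 (by omega) (by omega)).1
      rw [if_pos hor, if_pos hor]
      by_cases hne : b' = b
      · subst hne
        have h2v : ¬ T.cnt h v ≤ 1 := by omega
        rw [← hv, if_neg h2v, if_neg h2v]
        exact ih2 β₁ (hβ'.trans hβ) a₁
      · rw [(hz b' hb' hne).1, if_pos (Nat.zero_le 1), if_pos (Nat.zero_le 1),
          NodeData.table_eq_of_cnt_eq_zero (hz b' hb' hne).1 (hz b' hb' hne).2]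
    · rw [if_neg hw, if_neg hw, NodeData.table_eq_of_not_lt hc hw]

theorem left (A : GapAgree N T T' k r) : T.left r = T'.left r := by
  have := (A.node 0 (by omega)).lo
  rw [Trie.lo_childU_zero A.pos A.lt] at this
  rw [this, A.childH, A.childU, Trie.lo_childU_zero A.pos A.lt]

theorem right (A : GapAgree N T T' k r) : T.right r = T'.right r := by
  rw [Trie.right, Trie.right, A.cnt_sep, ← A.left]

theorem sep_left (A : GapAgree N T T' k r) : T.sep (T.left r) = T'.sep (T'.left r) := by
  have := (A.node 0 (by omega)).sep_lo
  rw [Trie.lo_childU_zero A.pos A.lt] at this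
  rw [this, A.childH, A.childU, Trie.lo_childU_zero A.pos A.lt]

theorem sep_right (A : GapAgree N T T' k r) : T.sep (T.right r) = T'.sep (T'.right r) := by
  have := (A.node 1 (by omega)).sep_hi
  rw [Trie.hi_childU_one A.pos A.lt] at this
  rw [this, A.childH, A.childU, Trie.hi_childU_one A.pos A.lt]

theorem top (A : GapAgree N T T' k r) : T.top r = T'.top r := by
  rw [Trie.top, Trie.top, A.sep_left, A.sep_right]

/-- The highest node with the same keys as a branching node has data that are determined by those of
the branching node. -/
theorem node_top (A : GapAgree N T T' k r) :
    NodeAgree N T T' k (T.top r) (T.key r / 2 ^ T.top r) := by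
  have h1 := Trie.lo_cnt_top (T := T) A.pos A.lt
  have h2 := Trie.lo_cnt_top (T := T') A.pos A.lt
  have h3 := Trie.gap_bh_top (T := T) A.pos A.lt
  have h4 := Trie.gap_bh_top (T := T') A.pos A.lt
  have h5 := Trie.bh_sep (T := T) A.pos A.lt
  have h6 := Trie.bh_sep (T := T') A.pos A.lt
  have hl := A.left
  have hc := A.cnt_sep
  have h7 : ∀ (T : Trie n H), T.left r + T.cnt (T.sep r) (T.key r / 2 ^ T.sep r) = T.right r :=
    fun T => rfl
  have h8 := A.sep_left
  have h9 := A.sep_right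
  rw [← A.top, ← A.key] at h2 h4
  rw [← A.childH, ← A.childU, ← A.childU, ← (A.node 0 (by omega)).bh,
    ← (A.node 1 (by omega)).bh] at h6
  rw [← A.sep] at h2 h4 h6 hc
  rw [← A.key] at h6 hc
  refine ⟨by omega, by omega, ?_, ?_, by omega, by omega, ?_⟩
  · rw [h1.1, h2.1, h8]
  · rw [h1.1, h2.1, h1.2, h2.2, ← hc, ← hl, h7, h9, A.right]
  · exact (A.table_val_walk (Trie.sep_le_top A.pos A.lt) le_rfl A.top.le).1

theorem walk_top (A : GapAgree N T T' k r) {β : ℕ} (hβ : β ≤ k) (a : ℕ) :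
    N.walk T (T.top r) (T.key r / 2 ^ T.top r) β a =
      N.walk T' (T'.top r) (T'.key r / 2 ^ T'.top r) β a := by
  rw [← A.top, ← A.key]
  exact (A.table_val_walk (Trie.sep_le_top A.pos A.lt) le_rfl A.top.le).2 β hβ a

/-- If a child of a branching node `p` has `r` as its highest branching node, then the data at `r`
determine `p` and the data of the child. -/
theorem child {p b : ℕ} (h0 : 0 < p) (hp : p < n) (hb : b < 2)
    (hc : 2 ≤ T.cnt (T.childH p) (T.childU p b))
    (A : GapAgree N T T' k (T.gap (T.childH p) (T.childU p b))) :
    T.childH p = T'.childH p ∧ T.childU p b = T'.childU p b ∧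
      NodeAgree N T T' k (T.childH p) (T.childU p b) := by
  obtain ⟨r0, hr, ht, hk, hl, hrt⟩ := Trie.of_gap_child h0 hp hb hc rfl
  have hN := A.node_top
  rw [hk, ht] at hN
  have e1 := A.left
  have e2 := A.right
  have e3 := A.sep_left
  have e4 := A.sep_right
  have e5 := A.top
  have e6 := A.key
  obtain rfl | rfl : b = 0 ∨ b = 1 := by omega
  · obtain ⟨i1, i2⟩ := hl rfl
    obtain ⟨-, -, j3, j4⟩ := Trie.child_right (T := T') r0 hr (by omega)
    rw [← e2, i1] at j3 j4
    refine ⟨by omega, ?_, hN⟩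
    rw [j4, ← e5, ← e6, hk]
  · obtain ⟨i1, i2⟩ := hrt rfl
    obtain ⟨-, -, j3, j4⟩ := Trie.child_left (T := T') r0 hr (by omega)
    rw [← e1, i1] at j3 j4
    refine ⟨by omega, ?_, hN⟩
    rw [j4, ← e5, ← e6, hk]

theorem gap_root (A : GapAgree N T T' k (T.gap H 0)) (hn : 2 ≤ n) : T'.gap H 0 = T.gap H 0 := by
  obtain ⟨h0, hr, hl, hrt, -⟩ := Trie.root_gap (T := T) hn
  exact Trie.gap_root_eq h0 hr (A.left ▸ hl) (A.right ▸ hrt)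

end GapAgree

/-! ### Tracing the centers back -/

namespace NodeData

variable {d n H : ℕ} (N : NodeData d) (T : Trie n H)

/-- The center that a token `(r, β, a)` stands for: center number `a` of the solution with `β`
centers of the highest node with the keys of the branching node `r`. -/
def solAt (s : ℕ × ℕ × ℕ) : Fin d → ℝ :=
  (N.table T.cnt (T.top s.1) (T.key s.1 / 2 ^ T.top s.1)).sol s.2.1 s.2.2

/-- The walk of a token to the next branching node. -/
def tokenWalk (s : ℕ × ℕ × ℕ) : (ℕ × ℕ × ℕ) ⊕ (Fin d → ℝ) :=
  N.walk T (T.top s.1) (T.key s.1 / 2 ^ T.top s.1) s.2.1 s.2.2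

/-- The next state of a token. It stays where it is when the center has been found. -/
def next (s : ℕ × ℕ × ℕ) : ℕ × ℕ × ℕ := (N.tokenWalk T s).elim id fun _ => s

/-- The token of center number `a` of the solution with `k` centers after `t` steps. -/
def token (k t a : ℕ) : ℕ × ℕ × ℕ := (N.next T)^[t] (T.gap H 0, k, a)

variable {N T}

theorem token_zero (k a : ℕ) : N.token T k 0 a = (T.gap H 0, k, a) := rfl

theorem token_succ (k t a : ℕ) : N.token T k (t + 1) a = N.next T (N.token T k t a) := by
  rw [token, Function.iterate_succ_apply']
  rfl

theorem next_spec {s : ℕ × ℕ × ℕ} (h0 : 0 < s.1) (hn : s.1 < n) :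
    0 < (N.next T s).1 ∧ (N.next T s).1 < n ∧ (N.next T s).2.1 ≤ s.2.1 ∧
      (N.next T s).2.2 ≤ s.2.2 ∧ N.solAt T (N.next T s) = N.solAt T s ∧
      ((∃ y, N.tokenWalk T (N.next T s) = Sum.inr y) ∨
        T.bh (T.top (N.next T s).1) (T.key (N.next T s).1 / 2 ^ T.top (N.next T s).1) <
          T.bh (T.top s.1) (T.key s.1 / 2 ^ T.top s.1)) := by
  rcases h : N.tokenWalk T s with ⟨r, β, a⟩ | y
  · have hs : N.next T s = (r, β, a) := by rw [next, h]; rfl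
    obtain ⟨p, b, h1, h2, h3, h4, h5, h6, h7, h8, h9⟩ := of_walk_eq_inl h
    obtain ⟨i1, i2, i3, i4, -⟩ := Trie.of_gap_child h1 h2 h3 h4 h5
    rw [← i4, ← i3] at h6 h9
    rw [hs]
    exact ⟨i1, i2, h7, h8, h6.symm, Or.inr h9⟩
  · have hs : N.next T s = s := by rw [next, h]; rfl
    rw [hs]
    exact ⟨h0, hn, le_rfl, le_rfl, rfl, Or.inl ⟨y, h⟩⟩

/-- The center that a token stands for never changes, and after as many steps as the compressed trie
is high the token knows it. -/
theorem token_spec (hn : 2 ≤ n) (k t a : ℕ) :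
    0 < (N.token T k t a).1 ∧ (N.token T k t a).1 < n ∧ (N.token T k t a).2.1 ≤ k ∧
      (N.token T k t a).2.2 ≤ a ∧ N.solAt T (N.token T k t a) = (N.table T.cnt H 0).sol k a ∧
      ((∃ y, N.tokenWalk T (N.token T k t a) = Sum.inr y) ∨
        T.bh (T.top (N.token T k t a).1)
          (T.key (N.token T k t a).1 / 2 ^ T.top (N.token T k t a).1) + t ≤ T.bh H 0) := by
  induction t with
  | zero =>
    obtain ⟨h1, h2, -, -, h5⟩ := Trie.root_gap (T := T) hn
    have h6 : T.key (T.gap H 0) / 2 ^ T.top (T.gap H 0) = 0 := by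
      rw [h5, Nat.div_eq_of_lt (T.key_lt _ h2)]
    rw [token_zero]
    refine ⟨h1, h2, le_rfl, le_rfl, ?_, Or.inr ?_⟩
    · rw [solAt, h6, h5]
    · rw [h6, h5, Nat.add_zero]
  | succ t ih =>
    obtain ⟨h1, h2, h3, h4, h5, h6⟩ := ih
    obtain ⟨i1, i2, i3, i4, i5, i6⟩ := next_spec (N := N) h1 h2
    rw [token_succ]
    refine ⟨i1, i2, i3.trans h3, i4.trans h4, i5.trans h5, ?_⟩
    rcases i6 with i6 | i6
    · exact Or.inl i6
    rcases h6 with ⟨y, hy⟩ | h6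
    · refine Or.inl ⟨y, ?_⟩
      have : N.next T (N.token T k t a) = N.token T k t a := by rw [next, hy]; rfl
      rw [this, hy]
    · exact Or.inr (by omega)

/-- After as many steps as the branching height of the root, all centers have been found. -/
theorem tokenWalk_token (hn : 2 ≤ n) {k t : ℕ} (ht : T.bh H 0 ≤ t) (a : ℕ) :
    N.tokenWalk T (N.token T k t a) = Sum.inr ((N.table T.cnt H 0).sol k a) := by
  obtain ⟨h1, h2, -, -, h5, h6⟩ := token_spec (N := N) (T := T) hn k t a
  have h7 : ∃ y, N.tokenWalk T (N.token T k t a) = Sum.inr y := by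
    refine h6.resolve_right fun h => ?_
    have h8 := Trie.gap_bh_top (T := T) h1 h2
    have h9 := Trie.bh_sep (T := T) h1 h2
    omega
  obtain ⟨y, hy⟩ := h7
  rw [hy, ← h5]
  exact congrArg _ (sol_of_walk_eq_inr hy).symm

theorem rnd_table_val (hr : ∀ x, N.rnd (N.rnd x) = N.rnd x) (c : ℕ → ℕ → ℕ) (h u j : ℕ) :
    N.rnd ((N.table c h u).val j) = (N.table c h u).val j := by
  have h1 : ∀ h u w, N.rnd ((N.leaf h u w).val j) = (N.leaf h u w).val j := fun h u w => by
    simp only [leaf]; split_ifs <;> exact hr _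
  have h2 : ∀ h u w t t', N.rnd ((N.node h u w t t').val j) = (N.node h u w t t').val j :=
    fun h u w t t' => by simp only [node]; split_ifs <;> exact hr _
  cases h with
  | zero => exact h1 ..
  | succ h =>
    rw [table]
    split_ifs
    exacts [h1 .., h2 .., h2 ..]

end NodeData

theorem GapAgree.tokenWalk {d n H k : ℕ} {N : NodeData d} {T T' : Trie n H} {s : ℕ × ℕ × ℕ}
    (A : GapAgree N T T' k s.1) (hs : s.2.1 ≤ k) : N.tokenWalk T s = N.tokenWalk T' s :=
  A.walk_top hs _

/-! ### The records kept for the branching nodes -/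

/-- Points in the order of their keys in a trie, where the key of a point is computed from its rank
and its coordinates. -/
structure KeyedPoints (n d H : ℕ) (F : Set ℝ) (kf : ℕ → (Fin d → F) → ℕ) where
  trie : Trie n H
  pts : ℕ → Fin d → F
  key_eq : ∀ r < n, trie.key r = kf r (pts r)

section Records

variable {n d H B : ℕ} [NeZero B] {F : Set ℝ} {kf : ℕ → (Fin d → F) → ℕ}

/-- The points `r - 2, …, r + 1`, as far as they exist, numbered from `0`. -/
def near (x : KeyedPoints n d H F kf) (r e : ℕ) : Option (Fin d → F) :=
  if r < n ∧ 2 ≤ r + e ∧ r + e < n + 2 then some (x.pts (r + e - 2)) else none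

theorem key_eq_of_near_eq {x x' : KeyedPoints n d H F kf} {r r' : ℕ}
    (h : ∀ e < 4, near x r e = near x' r e) (hr : r < n) (h1 : r ≤ r' + 2) (h2 : r' ≤ r + 1)
    (hr' : r' < n) : x.trie.key r' = x'.trie.key r' := by
  have h3 := h (r' + 2 - r) (by omega)
  have h4 : r < n ∧ 2 ≤ r + (r' + 2 - r) ∧ r + (r' + 2 - r) < n + 2 := by omega
  rw [near, near, if_pos h4, if_pos h4] at h3
  have h5 := Option.some.inj h3
  rw [show r + (r' + 2 - r) - 2 = r' by omega] at h5
  rw [x.key_eq r' hr', x'.key_eq r' hr', h5]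

theorem sep_eq_of_near_eq {x x' : KeyedPoints n d H F kf} {r r' : ℕ}
    (h : ∀ e < 4, near x r e = near x' r e) (hr : r < n) (h1 : r ≤ r' + 1) (h2 : r' ≤ r + 1) :
    x.trie.sep r' = x'.trie.sep r' :=
  Trie.sep_congr (fun _ _ => key_eq_of_near_eq h hr (by omega) (by omega) (by omega))
    fun _ h' => key_eq_of_near_eq h hr (by omega) (by omega) h'

/-- Whether a child of a branching node has only one key is seen from the neighbors. -/
theorem cnt_childU_eq_one_iff {T : Trie n H} {r b : ℕ} (h0 : 0 < r) (hr : r < n) (hb : b < 2) :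
    T.cnt (T.childH r) (T.childU r b) = 1 ↔
      (b = 0 → T.childH r < T.sep (r - 1)) ∧ (b = 1 → T.childH r < T.sep (r + 1)) := by
  have hH : T.childH r ≤ H := by rw [Trie.childH]; have := T.sep_le h0 hr; omega
  have hp := Trie.cnt_childU_pos (T := T) h0 hr hb
  have h1 := T.lt_sep_lo hH hp
  have h2 := T.lt_sep_hi hH hp
  obtain rfl | rfl : b = 0 ∨ b = 1 := by omega
  · have h3 := Trie.hi_childU_zero (T := T) h0 hr
    have h4 := Trie.key_pred_div_childH (T := T) h0 hr
    constructor
    · intro h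
      rw [show T.lo (T.childH r) (T.childU r 0) = r - 1 by omega] at h1
      exact ⟨fun _ => h1, by omega⟩
    · intro h
      have h5 := h.1 rfl
      by_contra hne
      have h6 : T.key (r - 1 - 1) / 2 ^ T.childH r = T.childU r 0 :=
        (T.key_div_eq_iff (by omega)).2 ⟨by omega, by omega⟩
      exact absurd ((T.sep_le_iff (by omega) (by omega) _).2 (h6.trans h4.symm)) (not_le.2 h5)
  · have h3 := Trie.lo_childU_one (T := T) h0 hr
    have h4 := Trie.key_div_childH (T := T) h0 hr
    have hle := T.lo_add_cnt_le (T.childH r) (T.childU r 1)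
    constructor
    · intro h
      rw [h3, h] at h2
      exact ⟨by omega, fun _ => h2⟩
    · intro h
      have h5 := h.2 rfl
      by_contra hne
      have h6 : T.key (r + 1) / 2 ^ T.childH r = T.childU r 1 :=
        (T.key_div_eq_iff (by omega)).2 ⟨by omega, by omega⟩
      refine absurd ((T.sep_le_iff (by omega) (by omega) _).2 ?_) (not_le.2 h5)
      rw [Nat.add_sub_cancel, h4, h6]

variable (N : NodeData d) (k : ℕ)

theorem nodeAgree_of_near_eq {x x' : KeyedPoints n d H F kf} {r b : ℕ}
    (h : ∀ e < 4, near x r e = near x' r e) (h0 : 0 < r) (hr : r < n) (hb : b < 2)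
    (hc : x.trie.cnt (x.trie.childH r) (x.trie.childU r b) = 1) :
    x'.trie.cnt (x'.trie.childH r) (x'.trie.childU r b) = 1 ∧
      NodeAgree N x.trie x'.trie k (x.trie.childH r) (x.trie.childU r b) := by
  have hs : ∀ r', r ≤ r' + 1 → r' ≤ r + 1 → x.trie.sep r' = x'.trie.sep r' :=
    fun r' h1 h2 => sep_eq_of_near_eq h hr h1 h2
  have hk : ∀ r', r ≤ r' + 2 → r' ≤ r + 1 → r' < n → x.trie.key r' = x'.trie.key r' :=
    fun r' h1 h2 => key_eq_of_near_eq h hr h1 h2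
  have hH : x.trie.childH r = x'.trie.childH r := by
    rw [Trie.childH, Trie.childH, hs r (by omega) (by omega)]
  have hU : x.trie.childU r b = x'.trie.childU r b := by
    rw [Trie.childU, Trie.childU, hs r (by omega) (by omega), hk r (by omega) (by omega) hr]
  have hc' : x'.trie.cnt (x'.trie.childH r) (x'.trie.childU r b) = 1 := by
    rw [cnt_childU_eq_one_iff h0 hr hb] at hc ⊢
    rwa [← hs (r - 1) (by omega) (by omega), ← hs (r + 1) (by omega) (by omega), ← hH]
  refine ⟨hc', ?_⟩
  have hc2 := hc'
  rw [← hH, ← hU] at hc2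
  have hlo : x.trie.lo (x.trie.childH r) (x.trie.childU r b) =
      x'.trie.lo (x.trie.childH r) (x.trie.childU r b) ∧
      r ≤ x.trie.lo (x.trie.childH r) (x.trie.childU r b) + 1 ∧
      x.trie.lo (x.trie.childH r) (x.trie.childU r b) ≤ r := by
    obtain rfl | rfl : b = 0 ∨ b = 1 := by omega
    · have h1 := Trie.hi_childU_zero (T := x.trie) h0 hr
      have h2 := Trie.hi_childU_zero (T := x'.trie) h0 hr
      rw [← hH, ← hU] at h2
      omega
    · have h1 := Trie.lo_childU_one (T := x.trie) h0 hr
      have h2 := Trie.lo_childU_one (T := x'.trie) h0 hr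
      rw [← hH, ← hU] at h2
      omega
  obtain ⟨hlo, hl1, hl2⟩ := hlo
  refine ⟨hlo, by omega, ?_, ?_, ?_, ?_, ?_⟩
  · rw [← hlo, hs _ hl1 (by omega)]
  · rw [← hlo, hc, hc2, hs _ (by omega) (by omega)]
  · rw [Trie.bh_eq_zero _ hc.le, Trie.bh_eq_zero _ hc2.le]
  · rw [Trie.gap_eq_zero _ hc.le, Trie.gap_eq_zero _ hc2.le]
  · intro j _
    congr 1
    obtain rfl | rfl : b = 0 ∨ b = 1 := by omega
    · rw [← Trie.key_pred_div_childH h0 hr] at *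
      refine NodeData.table_eq_of_cnt_eq_one (r := r - 1) (r' := r - 1) (by omega) (by omega)
        hc ?_ (hk _ (by omega) (by omega) (by omega))
      rwa [← hk _ (by omega) (by omega) (by omega)]
    · rw [← Trie.key_div_childH h0 hr] at *
      refine NodeData.table_eq_of_cnt_eq_one (r := r) (r' := r) hr hr
        hc ?_ (hk _ (by omega) (by omega) (by omega))
      rwa [← hk _ (by omega) (by omega) (by omega)]

/-- The numbers by which a node is described to others. -/
def nodeNumbers (T : Trie n H) (h u : ℕ) : List ℕ :=
  [T.lo h u, T.lo h u + T.cnt h u, T.sep (T.lo h u), T.sep (T.lo h u + T.cnt h u), T.bh h u,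
    T.gap h u]

variable (ρ : ℝ → F)

/-- The description of a node in words. -/
def nodeWords (T : Trie n H) (h u : ℕ) : List (Word B F) :=
  (nodeNumbers T h u).map natWord ++
    (List.range (k + 1)).map fun j => Sum.inr (ρ ((N.table T.cnt h u).val j))

theorem length_nodeWords (T : Trie n H) (h u : ℕ) :
    (nodeWords N k ρ T h u : List (Word B F)).length = k + 7 := by
  simp [nodeWords, nodeNumbers]

/-- The part of the record of the branching node `r` on its child number `b`, which is known when the
branching height of the child is at most `t`. -/
def childWords (T : Trie n H) (t r b : ℕ) : List (Word B F) :=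
  if 0 < r ∧ r < n ∧ T.bh (T.childH r) (T.childU r b) ≤ t then
    natWord 1 :: nodeWords N k ρ T (T.childH r) (T.childU r b)
  else List.replicate (k + 8) (natWord 0)

theorem length_childWords (T : Trie n H) (t r b : ℕ) :
    (childWords N k ρ T t r b : List (Word B F)).length = k + 8 := by
  rw [childWords]
  split_ifs
  · rw [List.length_cons, length_nodeWords]
  · rw [List.length_replicate]

/-- The record of the branching node `r`. -/
def gapWords (x : KeyedPoints n d H F kf) (t r : ℕ) : List (Word B F) :=
  ((List.range 4).flatMap fun e => pointWords (near x r e)) ++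
    (List.range 2).flatMap (childWords N k ρ x.trie t r)

theorem length_gapWords (x : KeyedPoints n d H F kf) (t r : ℕ) :
    (gapWords N k ρ x t r : List (Word B F)).length = d * 4 + (k + 8) * 2 := by
  rw [gapWords, List.length_append, length_flatMap_of_length_eq fun e _ => length_pointWords _,
    length_flatMap_of_length_eq fun b _ => length_childWords N k ρ x.trie t r b]
  simp

variable {N k ρ}

theorem nodeWords_eq {T T' : Trie n H} {h u : ℕ} (A : NodeAgree N T T' k h u) :
    (nodeWords N k ρ T h u : List (Word B F)) = nodeWords N k ρ T' h u := by
  have h1 : nodeNumbers T h u = nodeNumbers T' h u := by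
    rw [nodeNumbers, nodeNumbers, A.sep_lo, A.sep_hi, A.lo, A.cnt, A.bh, A.gap]
  rw [nodeWords, nodeWords, h1]
  congr 1
  refine List.map_congr_left fun j hj => ?_
  rw [A.val j (by have := List.mem_range.1 hj; omega)]

theorem gap_le (T : Trie n H) (h u : ℕ) : T.gap h u ≤ n := by
  rcases Nat.lt_or_ge (T.cnt h u) 2 with hc | hc
  · rw [T.gap_eq_zero (by omega)]; omega
  · obtain ⟨r, h0, hr, h1, rfl, h2⟩ := T.exists_gap hc
    rw [(T.of_cnt_eq h0 hr h1 h2.symm).2.1]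
    exact hr.le

theorem bh_le_left (T : Trie n H) (h u : ℕ) : T.bh h u ≤ n := by
  have := T.bh_le_cnt h u
  have := T.lo_add_cnt_le h u
  omega

theorem nodeAgree_of_nodeWords_eq {T T' : Trie n H} {h u : ℕ} (hn : n < B) (hH : H + 1 < B)
    (hρ : ∀ x : F, ρ x = x) (hN : ∀ y, N.rnd y = ρ y)
    (e : (nodeWords N k ρ T h u : List (Word B F)) = nodeWords N k ρ T' h u) :
    NodeAgree N T T' k h u := by
  have h1 := List.append_inj e (by simp [nodeNumbers])
  have hlt : ∀ T : Trie n H, ∀ v ∈ nodeNumbers T h u, v < B := by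
    intro T v hv
    have i1 := T.lo_add_cnt_le h u
    have i2 := T.sep_le_succ (T.lo h u)
    have i3 := T.sep_le_succ (T.lo h u + T.cnt h u)
    have i4 := gap_le T h u
    have i5 := bh_le_left T h u
    simp only [nodeNumbers, List.mem_cons, List.not_mem_nil, or_false] at hv
    omega
  have h2 : nodeNumbers T h u = nodeNumbers T' h u := by
    have h3 := h1.1
    refine List.ext_getElem (by simp [nodeNumbers]) fun i hi hi' => ?_
    have h4 : ((nodeNumbers T h u).map (natWord : ℕ → Word B F))[i]'(by simpa using hi) =
        ((nodeNumbers T' h u).map natWord)[i]'(by simpa using hi') := by simp only [h3]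
    rw [List.getElem_map, List.getElem_map] at h4
    exact natWord_inj (hlt T _ (List.getElem_mem _)) (hlt T' _ (List.getElem_mem _)) h4
  simp only [nodeNumbers, List.cons.injEq, and_true] at h2
  obtain ⟨g1, g2, g3, g4, g5, g6⟩ := h2
  refine ⟨g1, by omega, g3, g4, g5, g6, fun j hj => ?_⟩
  have h5 := (List.map_inj_left.1 h1.2) j (List.mem_range.2 (by omega))
  have h6 := congrArg (Subtype.val) (Sum.inr_injective h5)
  have hr : ∀ x, N.rnd (N.rnd x) = N.rnd x := fun x => by rw [hN x, hN, hρ]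
  rw [← hN, ← hN, NodeData.rnd_table_val hr, NodeData.rnd_table_val hr] at h6
  exact h6

theorem near_eq_of_gapWords_eq (hd : 0 < d) {x x' : KeyedPoints n d H F kf} {t r : ℕ}
    (e : (gapWords N k ρ x t r : List (Word B F)) = gapWords N k ρ x' t r) :
    ∀ i < 4, near x r i = near x' r i := by
  have h1 := List.append_inj e (by
    rw [length_flatMap_of_length_eq fun e _ => length_pointWords _,
      length_flatMap_of_length_eq fun e _ => length_pointWords _])
  intro i hi
  refine pointWords_injective (B := B) hd (flatMap_eq_flatMap ?_ h1.1 i (List.mem_range.2 hi))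
  intro i _
  rw [length_pointWords, length_pointWords]

theorem childWords_eq_of_gapWords_eq {x x' : KeyedPoints n d H F kf} {t r : ℕ}
    (e : (gapWords N k ρ x t r : List (Word B F)) = gapWords N k ρ x' t r) :
    ∀ b < 2, (childWords N k ρ x.trie t r b : List (Word B F)) = childWords N k ρ x'.trie t r b := by
  have h1 := List.append_inj e (by
    rw [length_flatMap_of_length_eq fun e _ => length_pointWords _,
      length_flatMap_of_length_eq fun e _ => length_pointWords _])
  intro b hb
  refine flatMap_eq_flatMap ?_ h1.2 b (List.mem_range.2 hb)
  intro i _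
  rw [length_childWords, length_childWords]

theorem childH_childU_eq_of_gapWords_eq (hd : 0 < d) {x x' : KeyedPoints n d H F kf} {t r : ℕ}
    (hr : r < n) (e : (gapWords N k ρ x t r : List (Word B F)) = gapWords N k ρ x' t r) :
    x.trie.childH r = x'.trie.childH r ∧ ∀ b, x.trie.childU r b = x'.trie.childU r b := by
  have h := near_eq_of_gapWords_eq hd e
  have h1 : x.trie.sep r = x'.trie.sep r := sep_eq_of_near_eq h hr (by omega) (by omega)
  refine ⟨by rw [Trie.childH, Trie.childH, h1], fun b => ?_⟩
  rw [Trie.childU, Trie.childU, h1, key_eq_of_near_eq h hr (by omega) (by omega) hr]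

/-- A record with both children determines the data at a branching node. -/
theorem gapAgree_of_gapWords_eq (hd : 0 < d) (hn : n < B) (hH : H + 1 < B)
    (hρ : ∀ x : F, ρ x = x) (hN : ∀ y, N.rnd y = ρ y)
    {x x' : KeyedPoints n d H F kf} {t r : ℕ} (h0 : 0 < r) (hr : r < n)
    (hbh : ∀ b < 2, x.trie.bh (x.trie.childH r) (x.trie.childU r b) ≤ t)
    (e : (gapWords N k ρ x t r : List (Word B F)) = gapWords N k ρ x' t r) :
    GapAgree N x.trie x'.trie k r := by
  have h := near_eq_of_gapWords_eq hd e
  refine ⟨h0, hr, key_eq_of_near_eq h hr (by omega) (by omega) (by omega),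
    key_eq_of_near_eq h hr (by omega) (by omega) hr, fun b hb => ?_⟩
  obtain ⟨eH, eU⟩ := childH_childU_eq_of_gapWords_eq hd hr e
  have h1 := childWords_eq_of_gapWords_eq e b hb
  rw [childWords, if_pos ⟨h0, hr, hbh b hb⟩, childWords] at h1
  split_ifs at h1
  · rw [← eH, ← eU] at h1
    exact nodeAgree_of_nodeWords_eq hn hH hρ hN (List.cons.inj h1).2
  · rw [List.replicate_succ] at h1
    exact absurd (natWord_inj (by omega) (by omega) (List.cons.inj h1).1) one_ne_zero

theorem bh_le_iff_of_childWords_eq {x x' : KeyedPoints n d H F kf} {t r b : ℕ} (hB : 1 < B)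
    (h0 : 0 < r) (hr : r < n)
    (e : (childWords N k ρ x.trie t r b : List (Word B F)) = childWords N k ρ x'.trie t r b) :
    x.trie.bh (x.trie.childH r) (x.trie.childU r b) ≤ t ↔
      x'.trie.bh (x'.trie.childH r) (x'.trie.childU r b) ≤ t := by
  rw [childWords, childWords] at e
  simp only [h0, hr, true_and] at e
  split_ifs at e with h1 h2 h2
  · exact iff_of_true h1 h2
  · rw [List.replicate_succ] at e
    exact absurd (natWord_inj (by omega) (by omega) (List.cons.inj e).1) one_ne_zero
  · rw [List.replicate_succ] at e
    exact absurd (natWord_inj (by omega) (by omega) (List.cons.inj e).1) zero_ne_one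
  · exact iff_of_false h1 h2

/-- The initial records are determined by the neighbors. -/
theorem gapWords_zero_eq {x x' : KeyedPoints n d H F kf} {r : ℕ}
    (h : ∀ e < 4, near x r e = near x' r e) :
    (gapWords N k ρ x 0 r : List (Word B F)) = gapWords N k ρ x' 0 r := by
  have key : ∀ {x x' : KeyedPoints n d H F kf}, (∀ e < 4, near x r e = near x' r e) →
      ∀ b < 2, (0 < r ∧ r < n ∧ x.trie.bh (x.trie.childH r) (x.trie.childU r b) ≤ 0) →
      (childWords N k ρ x.trie 0 r b : List (Word B F)) = childWords N k ρ x'.trie 0 r b := by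
    intro x x' h b hb h1
    obtain ⟨h0, hr, hbh⟩ := h1
    have hp := Trie.cnt_childU_pos (T := x.trie) h0 hr hb
    have hc : x.trie.cnt (x.trie.childH r) (x.trie.childU r b) = 1 := by
      by_contra hne
      have := x.trie.bh_pos (h := x.trie.childH r) (u := x.trie.childU r b) (by omega)
      omega
    obtain ⟨hc', hA⟩ := nodeAgree_of_near_eq N k h h0 hr hb hc
    rw [childWords, childWords, if_pos ⟨h0, hr, hbh⟩,
      if_pos ⟨h0, hr, (x'.trie.bh_eq_zero hc'.le).le⟩, nodeWords_eq hA]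
    have h1 : x.trie.sep r = x'.trie.sep r := sep_eq_of_near_eq h hr (by omega) (by omega)
    rw [Trie.childH, Trie.childH, Trie.childU, Trie.childU, h1,
      key_eq_of_near_eq h hr (by omega) (by omega) hr]
  rw [gapWords, gapWords, List.flatMap_def, List.flatMap_def, List.flatMap_def, List.flatMap_def]
  congr 2
  · exact List.map_congr_left fun e he => by rw [h e (List.mem_range.1 he)]
  · refine List.map_congr_left fun b hb => ?_
    rw [List.mem_range] at hb
    by_cases h1 : 0 < r ∧ r < n ∧ x.trie.bh (x.trie.childH r) (x.trie.childU r b) ≤ 0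
    · exact key h b hb h1
    by_cases h2 : 0 < r ∧ r < n ∧ x'.trie.bh (x'.trie.childH r) (x'.trie.childU r b) ≤ 0
    · exact (key (fun e he => (h e he).symm) b hb h2).symm
    · rw [childWords, childWords, if_neg h1, if_neg h2]

end Records

/-! ### The rounds of the dynamic program -/

section Rounds

variable {X : Type*} {n d H B m s : ℕ} [NeZero B] [NeZero m] {F : Set ℝ}
  {kf : ℕ → (Fin d → F) → ℕ} {N : NodeData d} {k : ℕ} {ρ : ℝ → F} {g : ℕ}

theorem val_ofNat_div (hg : 0 < g) (hm : n ≤ m * g) {r : ℕ} (hr : r < n) :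
    ((Fin.ofNat m (r / g) : Fin m) : ℕ) = r / g := by
  rw [Fin.val_ofNat, Nat.mod_eq_of_lt ((Nat.div_lt_iff_lt_mul hg).2 (by omega))]

theorem card_filter_div_le (hg : 0 < g) (A : Finset ℕ) (v : ℕ) :
    (A.filter fun r => r / g = v).card ≤ g := by
  have h2 : (A.filter fun r => r / g = v) ⊆ Finset.Ico (v * g) (v * g + g) := by
    intro r hr
    have := (Finset.mem_filter.1 hr).2
    rw [Nat.div_eq_iff hg] at this
    rw [Finset.mem_Ico]
    omega
  refine (Finset.card_le_card h2).trans ?_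
  simp

variable (N k ρ g)

/-- The records of the branching nodes at machine `i`. -/
def treeMemory (x : KeyedPoints n d H F kf) (t i : ℕ) : List (Word B F) :=
  (List.range g).flatMap fun j => gapWords N k ρ x t (i * g + j)

theorem length_treeMemory (x : KeyedPoints n d H F kf) (t i : ℕ) :
    (treeMemory N k ρ g x t i : List (Word B F)).length = (d * 4 + (k + 8) * 2) * g := by
  rw [treeMemory, length_flatMap_of_length_eq fun j _ => length_gapWords N k ρ x t _,
    List.length_range]

variable {N k ρ g}

theorem treeMemory_congr {x x' : KeyedPoints n d H F kf} {t i : ℕ}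
    (h : ∀ j < g, (gapWords N k ρ x t (i * g + j) : List (Word B F)) =
      gapWords N k ρ x' t (i * g + j)) :
    (treeMemory N k ρ g x t i : List (Word B F)) = treeMemory N k ρ g x' t i := by
  rw [treeMemory, treeMemory, List.flatMap_def, List.flatMap_def]
  congr 1
  exact List.map_congr_left fun j hj => h j (List.mem_range.1 hj)

theorem gapWords_eq_of_treeMemory_eq (hg : 0 < g) {x x' : KeyedPoints n d H F kf} {t i r : ℕ}
    (h : (treeMemory N k ρ g x t i : List (Word B F)) = treeMemory N k ρ g x' t i)
    (hr : r / g = i) :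
    (gapWords N k ρ x t r : List (Word B F)) = gapWords N k ρ x' t r := by
  have h1 := flatMap_eq_flatMap (fun j _ => by rw [length_gapWords, length_gapWords]) h (r % g)
    (List.mem_range.2 (Nat.mod_lt _ hg))
  subst hr
  rwa [show r / g * g + r % g = r by rw [Nat.mul_comm]; exact Nat.div_add_mod r g] at h1

/-- Each branching node obtains its neighbors. -/
theorem step_scatter {b : ℕ} (hd : 0 < d) (hg : 0 < g) (hm : n ≤ m * g) (hB : 4 * n + 4 ≤ B)
    (K : X → KeyedPoints n d H F kf) (M : X → Fin m → List (Word B F)) (mach : ℕ → ℕ)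
    (hM : ∀ x x' i, M x i = M x' i → ∀ p < n, mach p = i → (K x).pts p = (K x').pts p)
    (hmach : ∀ p < n, mach p < m)
    (hload : ∀ v, ((Finset.range n).filter fun p => mach p = v).card ≤ b)
    (hs1 : (d + 1) * (b * 4) ≤ s) (hs2 : (d + 1) * (g * 4) ≤ s)
    (hs3 : (d * 4 + (k + 8) * 2) * g ≤ s) :
    Step s M (fun x (i : Fin m) => treeMemory N k ρ g (K x) 0 i) := by
  have hval : ∀ v < m, ((Fin.ofNat m v : Fin m) : ℕ) = v := fun v hv => by
    rw [Fin.val_ofNat, Nat.mod_eq_of_lt hv]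
  let A : Finset (ℕ × ℕ) :=
    (Finset.range n ×ˢ Finset.range 4).filter fun q => 2 ≤ q.1 + q.2 ∧ q.1 + q.2 < n + 2
  have hA : ∀ {q}, q ∈ A ↔ (q.1 < n ∧ q.2 < 4) ∧ 2 ≤ q.1 + q.2 ∧ q.1 + q.2 < n + 2 := by
    intro q; simp [A]
  refine Step.of_packets (d + 1) (by omega) (fun _ => A)
    (fun _ q => Fin.ofNat m (mach (q.1 + q.2 - 2))) (fun _ q => Fin.ofNat m (q.1 / g))
    (fun x q => natWord (4 * q.1 + q.2) :: pointWords (some ((K x).pts (q.1 + q.2 - 2))))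
    ?_ ?_ ?_ ?_ ?_ ?_
  · intro x q _
    rw [List.length_cons, length_pointWords]
  · intro x x' i h q hq hi
    obtain ⟨⟨h1, h2⟩, h3, h4⟩ := hA.1 hq
    refine ⟨q, hq, hi, rfl, ?_⟩
    rw [hM x x' i h (q.1 + q.2 - 2) (by omega) (by rw [← hi, hval _ (hmach _ (by omega))])]
  · intro x x' i _ h1 _
    refine treeMemory_congr fun j hj => gapWords_zero_eq fun e he => ?_
    rw [near, near]
    by_cases hv : i * g + j < n ∧ 2 ≤ i * g + j + e ∧ i * g + j + e < n + 2
    · rw [if_pos hv, if_pos hv]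
      have hdst : (i * g + j) / g = i := by
        rw [Nat.mul_comm, Nat.mul_add_div hg, Nat.div_eq_of_lt hj, Nat.add_zero]
      obtain ⟨q, hq, -, hpay⟩ := h1 (i * g + j, e) (hA.2 ⟨⟨hv.1, he⟩, hv.2⟩)
        (Fin.ext (by rw [val_ofNat_div hg hm hv.1, hdst]))
      obtain ⟨⟨g1, g2⟩, -⟩ := hA.1 hq
      obtain ⟨e1, e2⟩ := List.cons.inj hpay
      have e3 := natWord_inj (by omega) (by simp only; omega) e1
      simp only at e3
      have e4 : q = (i * g + j, e) := Prod.ext (by simp only; omega) (by simp only; omega)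
      rw [e4] at e2
      exact (pointWords_injective hd e2).symm
    · rw [if_neg hv, if_neg hv]
  · intro x i
    refine (Nat.mul_le_mul_left _ ?_).trans hs1
    have h1 : ((A.filter fun q => Fin.ofNat m (mach (q.1 + q.2 - 2)) = i).image
        fun q => (q.1 + q.2 - 2, q.2)) ⊆
        ((Finset.range n).filter fun p => mach p = i) ×ˢ Finset.range 4 := by
      intro q hq
      obtain ⟨p, hp, rfl⟩ := Finset.mem_image.1 hq
      obtain ⟨hp, hi⟩ := Finset.mem_filter.1 hp
      obtain ⟨⟨g1, g2⟩, g3, g4⟩ := hA.1 hp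
      simp only [Finset.mem_product, Finset.mem_filter, Finset.mem_range]
      exact ⟨⟨by omega, by rw [← hi, hval _ (hmach _ (by omega))]⟩, g2⟩
    have h2 := Finset.card_le_card h1
    rw [Finset.card_image_of_injOn, Finset.card_product, Finset.card_range] at h2
    · exact h2.trans (Nat.mul_le_mul_right _ (hload i))
    · intro p hp p' hp' he
      obtain ⟨⟨g1, g2⟩, g3, g4⟩ := hA.1 (Finset.mem_filter.1 hp).1
      obtain ⟨⟨g1', g2'⟩, g3', g4'⟩ := hA.1 (Finset.mem_filter.1 hp').1
      simp only [Prod.mk.injEq] at he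
      exact Prod.ext (by omega) (by omega)
  · intro x i
    refine (Nat.mul_le_mul_left _ ?_).trans hs2
    have h1 : (A.filter fun q => Fin.ofNat m (q.1 / g) = i) ⊆
        ((Finset.range n).filter fun r => r / g = i) ×ˢ Finset.range 4 := by
      intro q hq
      obtain ⟨hp, hi⟩ := Finset.mem_filter.1 hq
      obtain ⟨⟨g1, g2⟩, g3, g4⟩ := hA.1 hp
      simp only [Finset.mem_product, Finset.mem_filter, Finset.mem_range]
      exact ⟨⟨g1, by rw [← hi, val_ofNat_div hg hm g1]⟩, g2⟩
    have h2 := Finset.card_le_card h1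
    rw [Finset.card_product, Finset.card_range] at h2
    exact h2.trans (Nat.mul_le_mul_right _ (card_filter_div_le hg _ _))
  · intro x i
    rw [length_treeMemory]
    exact hs3

/-- The children of branching height `t + 1` are reported to their branching nodes. -/
theorem step_tree (hd : 0 < d) (hg : 0 < g) (hm : n ≤ m * g) (hn : n < B) (hH : H + 1 < B)
    (hρ : ∀ x : F, ρ x = x) (hN : ∀ y, N.rnd y = ρ y) (K : X → KeyedPoints n d H F kf) (t : ℕ)
    (hs1 : (k + 9) * (g * 2) ≤ s) (hs2 : (d * 4 + (k + 8) * 2) * g ≤ s) :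
    Step s (fun x (i : Fin m) => (treeMemory N k ρ g (K x) t i : List (Word B F)))
      (fun x (i : Fin m) => treeMemory N k ρ g (K x) (t + 1) i) := by
  classical
  let A : X → Finset (ℕ × ℕ) := fun x => (Finset.range n ×ˢ Finset.range 2).filter fun q =>
    0 < q.1 ∧ 2 ≤ (K x).trie.cnt ((K x).trie.childH q.1) ((K x).trie.childU q.1 q.2) ∧
      (K x).trie.bh ((K x).trie.childH q.1) ((K x).trie.childU q.1 q.2) = t + 1
  have hA : ∀ {x q}, q ∈ A x ↔ (q.1 < n ∧ q.2 < 2) ∧ 0 < q.1 ∧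
      2 ≤ (K x).trie.cnt ((K x).trie.childH q.1) ((K x).trie.childU q.1 q.2) ∧
      (K x).trie.bh ((K x).trie.childH q.1) ((K x).trie.childU q.1 q.2) = t + 1 := by
    intro x q; simp [A]
  let src : X → ℕ × ℕ → ℕ := fun x q =>
    (K x).trie.gap ((K x).trie.childH q.1) ((K x).trie.childU q.1 q.2)
  have hsrc : ∀ {x q}, q ∈ A x → 0 < src x q ∧ src x q < n := by
    intro x q hq
    obtain ⟨⟨h1, h2⟩, h3, h4, h5⟩ := hA.1 hq
    obtain ⟨i1, i2, -⟩ := Trie.of_gap_child h3 h1 h2 h4 rfl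
    exact ⟨i1, i2⟩
  refine Step.of_packets (k + 9) (by omega) A (fun x q => Fin.ofNat m (src x q / g))
    (fun _ q => Fin.ofNat m (q.1 / g))
    (fun x q => natWord q.1 :: natWord q.2 ::
      nodeWords N k ρ (K x).trie ((K x).trie.childH q.1) ((K x).trie.childU q.1 q.2))
    ?_ ?_ ?_ ?_ ?_ ?_
  · intro x q _
    rw [List.length_cons, List.length_cons, length_nodeWords]
  · intro x x' i h q hq hi
    have hr := hsrc hq
    obtain ⟨⟨h1, h2⟩, h3, h4, h5⟩ := hA.1 hq
    have hri : src x q / g = i := by rw [← hi, val_ofNat_div hg hm hr.2]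
    have hw := gapWords_eq_of_treeMemory_eq hg h hri
    have hG : GapAgree N (K x).trie (K x').trie k (src x q) := by
      refine gapAgree_of_gapWords_eq hd hn hH hρ hN hr.1 hr.2 (fun b hb => ?_) hw
      obtain ⟨-, -, i3, i4, -⟩ := Trie.of_gap_child h3 h1 h2 h4 (r := src x q) rfl
      have i5 := (Trie.gap_bh_top (T := (K x).trie) hr.1 hr.2).2
      have i6 := Trie.bh_sep (T := (K x).trie) hr.1 hr.2
      rw [i3] at i4
      rw [i3, i4, h5] at i5
      obtain rfl | rfl : b = 0 ∨ b = 1 := by omega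
      all_goals omega
    obtain ⟨e1, e2, hA'⟩ := GapAgree.child h3 h1 h2 h4 hG
    refine ⟨q, hA.2 ⟨⟨h1, h2⟩, h3, ?_, ?_⟩, ?_, rfl, ?_⟩
    · rw [← e1, ← e2, ← hA'.cnt]; exact h4
    · rw [← e1, ← e2, ← hA'.bh]; exact h5
    · have : src x' q = src x q := by
        simp only [src]
        rw [← e1, ← e2, ← hA'.gap]
      rw [this, hi]
    · rw [← e1, ← e2, nodeWords_eq hA']
  · intro x x' i h hxx' hx'x
    have key : ∀ x x' : X, (treeMemory N k ρ g (K x) t i : List (Word B F)) =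
        treeMemory N k ρ g (K x') t i →
        (∀ q ∈ A x, Fin.ofNat m (q.1 / g) = i → ∃ q' ∈ A x', Fin.ofNat m (q'.1 / g) = i ∧
          (natWord q'.1 :: natWord q'.2 :: nodeWords N k ρ (K x').trie ((K x').trie.childH q'.1)
            ((K x').trie.childU q'.1 q'.2) : List (Word B F)) =
          natWord q.1 :: natWord q.2 :: nodeWords N k ρ (K x).trie ((K x).trie.childH q.1)
            ((K x).trie.childU q.1 q.2)) →
        ∀ r, r / g = i → ∀ b < 2, (0 < r ∧ r < n ∧
          (K x).trie.bh ((K x).trie.childH r) ((K x).trie.childU r b) ≤ t + 1) →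
        (childWords N k ρ (K x).trie (t + 1) r b : List (Word B F)) =
          childWords N k ρ (K x').trie (t + 1) r b := by
      intro x x' h hx r hri b hb ⟨h0, hr, hbh⟩
      have hw := gapWords_eq_of_treeMemory_eq hg h hri
      have hc := childWords_eq_of_gapWords_eq hw b hb
      rw [childWords, if_pos ⟨h0, hr, hbh⟩]
      rcases Nat.lt_or_ge t ((K x).trie.bh ((K x).trie.childH r) ((K x).trie.childU r b))
        with hlt | hle
      · have hcnt : 2 ≤ (K x).trie.cnt ((K x).trie.childH r) ((K x).trie.childU r b) := by
          by_contra hne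
          have := (K x).trie.bh_eq_zero (h := (K x).trie.childH r) (u := (K x).trie.childU r b)
            (by omega)
          omega
        obtain ⟨q, hq, -, hpay⟩ := hx (r, b) (hA.2 ⟨⟨hr, hb⟩, h0, hcnt, by simp only; omega⟩)
          (Fin.ext (by rw [val_ofNat_div hg hm hr, hri]))
        obtain ⟨⟨j1, j2⟩, j3, j4, j5⟩ := hA.1 hq
        obtain ⟨e1, e2⟩ := List.cons.inj hpay
        obtain ⟨e2, e3⟩ := List.cons.inj e2
        have e1 := natWord_inj (by omega) (by simp only; omega) e1
        have e2 := natWord_inj (by omega) (by simp only; omega) e2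
        have e4 : q = (r, b) := Prod.ext e1 e2
        subst e4
        rw [childWords, if_pos ⟨h0, hr, j5.le⟩]
        exact congrArg _ e3.symm
      · have hle' := (bh_le_iff_of_childWords_eq (by omega) h0 hr hc).1 hle
        rw [childWords, childWords, if_pos ⟨h0, hr, hle⟩, if_pos ⟨h0, hr, hle'⟩] at hc
        rw [childWords, if_pos ⟨h0, hr, hle'.trans (Nat.le_succ t)⟩]
        exact hc
    refine treeMemory_congr fun j hj => ?_
    have hri : (i * g + j) / g = i := by
      rw [Nat.mul_comm, Nat.mul_add_div hg, Nat.div_eq_of_lt hj, Nat.add_zero]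
    generalize (i * g + j : ℕ) = r at hri
    have hw := gapWords_eq_of_treeMemory_eq hg h hri
    have hnear := near_eq_of_gapWords_eq hd hw
    rw [gapWords, gapWords, List.flatMap_def, List.flatMap_def, List.flatMap_def,
      List.flatMap_def]
    congr 2
    · exact List.map_congr_left fun e he => by rw [hnear e (List.mem_range.1 he)]
    · refine List.map_congr_left fun b hb => ?_
      rw [List.mem_range] at hb
      by_cases h1 : 0 < r ∧ r < n ∧
          (K x).trie.bh ((K x).trie.childH r) ((K x).trie.childU r b) ≤ t + 1
      · exact key x x' h hxx' r hri b hb h1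
      by_cases h2 : 0 < r ∧ r < n ∧
          (K x').trie.bh ((K x').trie.childH r) ((K x').trie.childU r b) ≤ t + 1
      · exact (key x' x h.symm hx'x r hri b hb h2).symm
      · rw [childWords, childWords, if_neg h1, if_neg h2]
  · intro x i
    refine (Nat.mul_le_mul_left _ ?_).trans hs1
    -- The highest branching node of a child, with the side of the child, determines its parent.
    have h1 : ((A x).filter fun q => Fin.ofNat m (src x q / g) = i).image
        (fun q => (src x q, q.2)) ⊆
        ((Finset.range n).filter fun r => r / g = i) ×ˢ Finset.range 2 := by
      intro q hq
      obtain ⟨p, hp, rfl⟩ := Finset.mem_image.1 hq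
      obtain ⟨hp, hi⟩ := Finset.mem_filter.1 hp
      simp only [Finset.mem_product, Finset.mem_filter, Finset.mem_range]
      exact ⟨⟨(hsrc hp).2, by rw [← hi, val_ofNat_div hg hm (hsrc hp).2]⟩, (hA.1 hp).1.2⟩
    have h2 := Finset.card_le_card h1
    rw [Finset.card_image_of_injOn, Finset.card_product, Finset.card_range] at h2
    · exact h2.trans (Nat.mul_le_mul_right _ (card_filter_div_le hg _ _))
    · intro p hp p' hp' he
      obtain ⟨⟨g1, g2⟩, g3, g4, -⟩ := hA.1 (Finset.mem_filter.1 hp).1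
      obtain ⟨⟨g1', g2'⟩, g3', g4', -⟩ := hA.1 (Finset.mem_filter.1 hp').1
      simp only [Prod.mk.injEq] at he
      obtain ⟨-, -, -, -, i5, i6⟩ := Trie.of_gap_child g3 g1 g2 g4 (r := src x p) rfl
      obtain ⟨-, -, -, -, i5', i6'⟩ := Trie.of_gap_child g3' g1' g2' g4' (r := src x p') rfl
      rw [← he.1] at i5' i6'
      refine Prod.ext ?_ he.2
      obtain hb | hb : p.2 = 0 ∨ p.2 = 1 := by omega
      · exact (i5 hb).1.symm.trans (i5' (he.2 ▸ hb)).1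
      · exact (i6 hb).1.symm.trans (i6' (he.2 ▸ hb)).1
  · intro x i
    refine (Nat.mul_le_mul_left _ ?_).trans hs1
    have h1 : ((A x).filter fun q => Fin.ofNat m (q.1 / g) = i) ⊆
        ((Finset.range n).filter fun r => r / g = i) ×ˢ Finset.range 2 := by
      intro q hq
      obtain ⟨hp, hi⟩ := Finset.mem_filter.1 hq
      obtain ⟨⟨g1, g2⟩, -⟩ := hA.1 hp
      simp only [Finset.mem_product, Finset.mem_filter, Finset.mem_range]
      exact ⟨⟨g1, by rw [← hi, val_ofNat_div hg hm g1]⟩, g2⟩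
    have h2 := Finset.card_le_card h1
    rw [Finset.card_product, Finset.card_range] at h2
    exact h2.trans (Nat.mul_le_mul_right _ (card_filter_div_le hg _ _))
  · intro x i
    rw [length_treeMemory]
    exact hs2

variable (N k g) in
/-- The words for token `a` at machine `i`. -/
def tokenWords (B : ℕ) [NeZero B] (F : Set ℝ) (T : Trie n H) (t i a : ℕ) : List (Word B F) :=
  if (N.token T k t a).1 / g = i then
    [natWord 1, natWord (N.token T k t a).1, natWord (N.token T k t a).2.1,
      natWord (N.token T k t a).2.2]
  else List.replicate 4 (natWord 0)

theorem length_tokenWords (T : Trie n H) (t i a : ℕ) :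
    (tokenWords N k g B F T t i a).length = 4 := by
  rw [tokenWords]; split_ifs <;> simp

variable (N k ρ g) in
/-- The records and the tokens at machine `i`. -/
def tokenMemory (b : ℕ) (x : KeyedPoints n d H F kf) (t i : ℕ) : List (Word B F) :=
  treeMemory N k ρ g x b i ++ (List.range k).flatMap (tokenWords N k g B F x.trie t i)

theorem length_tokenMemory (b : ℕ) (x : KeyedPoints n d H F kf) (t i : ℕ) :
    (tokenMemory N k ρ g b x t i : List (Word B F)).length =
      (d * 4 + (k + 8) * 2) * g + 4 * k := by
  rw [tokenMemory, List.length_append, length_treeMemory,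
    length_flatMap_of_length_eq fun a _ => length_tokenWords x.trie t i a, List.length_range]

theorem tokenMemory_congr {b : ℕ} {x x' : KeyedPoints n d H F kf} {t i : ℕ}
    (h : (treeMemory N k ρ g x b i : List (Word B F)) = treeMemory N k ρ g x' b i)
    (h1 : ∀ a < k, (N.token x.trie k t a).1 / g = i → N.token x'.trie k t a = N.token x.trie k t a)
    (h2 : ∀ a < k, (N.token x'.trie k t a).1 / g = i →
      N.token x'.trie k t a = N.token x.trie k t a) :
    (tokenMemory N k ρ g b x t i : List (Word B F)) = tokenMemory N k ρ g b x' t i := by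
  rw [tokenMemory, tokenMemory, h, List.flatMap_def, List.flatMap_def]
  congr 2
  refine List.map_congr_left fun a ha => ?_
  rw [List.mem_range] at ha
  rw [tokenWords, tokenWords]
  by_cases h3 : (N.token x.trie k t a).1 / g = i
  · rw [h1 a ha h3]
  by_cases h4 : (N.token x'.trie k t a).1 / g = i
  · rw [h2 a ha h4]
  · rw [if_neg h3, if_neg h4]

theorem treeMemory_eq_of_tokenMemory_eq {b : ℕ} {x x' : KeyedPoints n d H F kf} {t i : ℕ}
    (h : (tokenMemory N k ρ g b x t i : List (Word B F)) = tokenMemory N k ρ g b x' t i) :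
    (treeMemory N k ρ g x b i : List (Word B F)) = treeMemory N k ρ g x' b i :=
  (List.append_inj h (by rw [length_treeMemory, length_treeMemory])).1

theorem bh_childH_le {T : Trie n H} {b : ℕ} (hb : ∀ h u, h ≤ H → T.bh h u ≤ b) {r : ℕ} (u : ℕ) :
    T.bh (T.childH r) u ≤ b :=
  hb _ _ (by have := T.sep_le_succ r; rw [Trie.childH]; omega)

/-- A machine that holds a token knows it and its walk to the next branching node. -/
theorem token_eq_of_tokenMemory_eq {b : ℕ} (hd : 0 < d) (hg : 0 < g) (hn2 : 2 ≤ n) (hn : n < B)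
    (hH : H + 1 < B) (hk : k < B) (hρ : ∀ x : F, ρ x = x) (hN : ∀ y, N.rnd y = ρ y)
    {x x' : KeyedPoints n d H F kf} {t i a : ℕ} (hb : ∀ h u, h ≤ H → x.trie.bh h u ≤ b)
    (h : (tokenMemory N k ρ g b x t i : List (Word B F)) = tokenMemory N k ρ g b x' t i)
    (ha : a < k) (hi : (N.token x.trie k t a).1 / g = i) :
    N.token x'.trie k t a = N.token x.trie k t a ∧
      N.tokenWalk x'.trie (N.token x'.trie k t a) = N.tokenWalk x.trie (N.token x.trie k t a) := by
  obtain ⟨h1, h2⟩ := List.append_inj h (by rw [length_treeMemory, length_treeMemory])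
  have h3 := flatMap_eq_flatMap (fun j _ => by rw [length_tokenWords, length_tokenWords]) h2 a
    (List.mem_range.2 ha)
  obtain ⟨i1, i2, i3, i4, -⟩ := NodeData.token_spec (N := N) (T := x.trie) hn2 k t a
  obtain ⟨j1, j2, j3, j4, -⟩ := NodeData.token_spec (N := N) (T := x'.trie) hn2 k t a
  have h4 : N.token x'.trie k t a = N.token x.trie k t a := by
    rw [tokenWords, if_pos hi, tokenWords] at h3
    split_ifs at h3
    · simp only [List.cons.injEq, and_true, true_and] at h3
      obtain ⟨e1, e2, e3⟩ := h3
      have e1 := natWord_inj (by omega) (by omega) e1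
      have e2 := natWord_inj (by omega) (by omega) e2
      have e3 := natWord_inj (by omega) (by omega) e3
      exact Prod.ext e1.symm (Prod.ext e2.symm e3.symm)
    · rw [List.replicate_succ] at h3
      exact absurd (natWord_inj (by omega) (by omega) (List.cons.inj h3).1) one_ne_zero
  have hw := gapWords_eq_of_treeMemory_eq hg h1 hi
  have hG := gapAgree_of_gapWords_eq hd hn hH hρ hN i1 i2 (fun b' _ => bh_childH_le hb _) hw
  refine ⟨h4, ?_⟩
  rw [h4]
  exact (hG.tokenWalk i3).symm

/-- The machine that holds the highest branching node recognizes it, and creates the tokens. -/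
theorem step_start {b : ℕ} (hd : 0 < d) (hg : 0 < g) (hn2 : 2 ≤ n) (hn : n < B)
    (hH : H + 1 < B) (hρ : ∀ x : F, ρ x = x) (hN : ∀ y, N.rnd y = ρ y)
    (K : X → KeyedPoints n d H F kf) (hb : ∀ x h u, h ≤ H → (K x).trie.bh h u ≤ b)
    (hs : (d * 4 + (k + 8) * 2) * g + 4 * k ≤ s) :
    Step s (fun x (i : Fin m) => (treeMemory N k ρ g (K x) b i : List (Word B F)))
      (fun x (i : Fin m) => tokenMemory N k ρ g b (K x) 0 i) := by
  refine Step.of_packets (ι := ℕ) 1 one_pos (fun _ => ∅) (fun _ _ => Fin.ofNat m 0)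
    (fun _ _ => Fin.ofNat m 0) (fun _ _ => []) (by simp) (by simp) ?_ (by simp) (by simp) ?_
  · intro x x' i h _ _
    have key : ∀ x x' : X, (treeMemory N k ρ g (K x) b i : List (Word B F)) =
        treeMemory N k ρ g (K x') b i → ((K x).trie.gap H 0) / g = i →
        (K x').trie.gap H 0 = (K x).trie.gap H 0 := by
      intro x x' h hi
      obtain ⟨i1, i2, -⟩ := Trie.root_gap (T := (K x).trie) hn2
      have hw := gapWords_eq_of_treeMemory_eq hg h hi
      exact (gapAgree_of_gapWords_eq hd hn hH hρ hN i1 i2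
        (fun b' _ => bh_childH_le (hb x) _) hw).gap_root hn2
    refine tokenMemory_congr h (fun a _ hi => ?_) fun a _ hi => ?_
    · rw [NodeData.token_zero, NodeData.token_zero, key x x' h hi]
    · rw [NodeData.token_zero, NodeData.token_zero, key x' x h.symm hi]
  · intro x i
    rw [length_tokenMemory]
    exact hs

/-- Each token moves to the next branching node on its way, or stays where it is. -/
theorem step_token {b : ℕ} (hd : 0 < d) (hg : 0 < g) (hm : n ≤ m * g) (hn2 : 2 ≤ n) (hn : n < B)
    (hH : H + 1 < B) (hk : k < B) (hρ : ∀ x : F, ρ x = x) (hN : ∀ y, N.rnd y = ρ y)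
    (K : X → KeyedPoints n d H F kf) (hb : ∀ x h u, h ≤ H → (K x).trie.bh h u ≤ b) (t : ℕ)
    (hs : (d * 4 + (k + 8) * 2) * g + 4 * k ≤ s) :
    Step s (fun x (i : Fin m) => (tokenMemory N k ρ g b (K x) t i : List (Word B F)))
      (fun x (i : Fin m) => tokenMemory N k ρ g b (K x) (t + 1) i) := by
  have hlt : ∀ x t a, (N.token (K x).trie k t a).1 < n := fun x t a =>
    (NodeData.token_spec (N := N) (T := (K x).trie) hn2 k t a).2.1
  have hload : ∀ p : ℕ → Prop, ∀ [DecidablePred p], 4 * ((Finset.range k).filter p).card ≤ s :=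
    fun p _ => by
      have := Finset.card_filter_le (Finset.range k) p
      rw [Finset.card_range] at this
      omega
  refine Step.of_packets 4 (by omega) (fun _ => Finset.range k)
    (fun x a => Fin.ofNat m ((N.token (K x).trie k t a).1 / g))
    (fun x a => Fin.ofNat m ((N.token (K x).trie k (t + 1) a).1 / g))
    (fun x a => [natWord a, natWord (N.token (K x).trie k (t + 1) a).1,
      natWord (N.token (K x).trie k (t + 1) a).2.1, natWord (N.token (K x).trie k (t + 1) a).2.2])
    (fun _ _ _ => rfl) ?_ ?_ (fun x i => hload _) (fun x i => hload _) ?_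
  · intro x x' i h a ha hi
    have hi' : (N.token (K x).trie k t a).1 / g = i := by
      rw [← hi, val_ofNat_div hg hm (hlt x t a)]
    obtain ⟨e1, e2⟩ := token_eq_of_tokenMemory_eq hd hg hn2 hn hH hk hρ hN (hb x) h
      (Finset.mem_range.1 ha) hi'
    have e3 : N.token (K x').trie k (t + 1) a = N.token (K x).trie k (t + 1) a := by
      rw [NodeData.token_succ, NodeData.token_succ, NodeData.next, NodeData.next, e2, e1]
    refine ⟨a, ha, ?_, ?_, ?_⟩
    · rw [e1, hi]
    · rw [e3]
    · rw [e3]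
  · intro x x' i h h1 h2
    have key : ∀ x x' : X, (∀ a ∈ Finset.range k,
        Fin.ofNat m ((N.token (K x).trie k (t + 1) a).1 / g) = i → ∃ a' ∈ Finset.range k,
          Fin.ofNat m ((N.token (K x').trie k (t + 1) a').1 / g) = i ∧
          ([natWord a', natWord (N.token (K x').trie k (t + 1) a').1,
            natWord (N.token (K x').trie k (t + 1) a').2.1,
            natWord (N.token (K x').trie k (t + 1) a').2.2] : List (Word B F)) =
          [natWord a, natWord (N.token (K x).trie k (t + 1) a).1,
            natWord (N.token (K x).trie k (t + 1) a).2.1,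
            natWord (N.token (K x).trie k (t + 1) a).2.2]) →
        ∀ a < k, (N.token (K x).trie k (t + 1) a).1 / g = i →
          N.token (K x').trie k (t + 1) a = N.token (K x).trie k (t + 1) a := by
      intro x x' hx a ha hi
      obtain ⟨a', ha', -, hpay⟩ := hx a (Finset.mem_range.2 ha)
        (Fin.ext (by rw [val_ofNat_div hg hm (hlt x _ a), hi]))
      rw [Finset.mem_range] at ha'
      obtain ⟨i1, i2, i3, i4, -⟩ := NodeData.token_spec (N := N) (T := (K x).trie) hn2 k (t + 1) a
      obtain ⟨j1, j2, j3, j4, -⟩ :=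
        NodeData.token_spec (N := N) (T := (K x').trie) hn2 k (t + 1) a'
      simp only [List.cons.injEq, and_true] at hpay
      obtain ⟨e0, e1, e2, e3⟩ := hpay
      have e0 := natWord_inj (by omega) (by omega) e0
      have e1 := natWord_inj (by omega) (by omega) e1
      have e2 := natWord_inj (by omega) (by omega) e2
      have e3 := natWord_inj (by omega) (by omega) e3
      subst e0
      exact Prod.ext e1 (Prod.ext e2 e3)
    exact tokenMemory_congr (treeMemory_eq_of_tokenMemory_eq h) (key x x' h1)
      fun a ha hi => (key x' x h2 a ha hi).symm
  · intro x i
    rw [length_tokenMemory]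
    exact hs

variable (k ρ) in
/-- The centers `y 0, …, y (k - 1)`, coordinate after coordinate, at machine `0`. -/
def outputMemory (B : ℕ) (y : ℕ → Fin d → ℝ) (i : ℕ) : List (Word B F) :=
  if i = 0 then (List.range k).flatMap fun a => List.ofFn fun j => Sum.inr (ρ (y a j)) else []

theorem step_output {b : ℕ} (hd : 0 < d) (hg : 0 < g) (hm : n ≤ m * g) (hn2 : 2 ≤ n) (hn : n < B)
    (hH : H + 1 < B) (hk : k < B) (hρ : ∀ x : F, ρ x = x) (hN : ∀ y, N.rnd y = ρ y)
    (K : X → KeyedPoints n d H F kf) (hb : ∀ x h u, h ≤ H → (K x).trie.bh h u ≤ b)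
    (hs : (d + 1) * k ≤ s) :
    Step s (fun x (i : Fin m) => (tokenMemory N k ρ g b (K x) b i : List (Word B F)))
      (fun x (i : Fin m) => outputMemory k ρ B ((N.table (K x).trie.cnt H 0).sol k) i) := by
  have hload : ∀ p : ℕ → Prop, ∀ [DecidablePred p],
      (d + 1) * ((Finset.range k).filter p).card ≤ s := fun p _ => by
    have := Finset.card_filter_le (Finset.range k) p
    rw [Finset.card_range] at this
    exact (Nat.mul_le_mul_left _ this).trans hs
  refine Step.of_packets (d + 1) (by omega) (fun _ => Finset.range k)
    (fun x a => Fin.ofNat m ((N.token (K x).trie k b a).1 / g)) (fun _ _ => Fin.ofNat m 0)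
    (fun x a => natWord a ::
      List.ofFn fun j => Sum.inr (ρ ((N.table (K x).trie.cnt H 0).sol k a j)))
    ?_ ?_ ?_ (fun x i => hload _) (fun x i => hload _) ?_
  · intro x a _
    rw [List.length_cons, List.length_ofFn]
  · intro x x' i h a ha hi
    have hi' : (N.token (K x).trie k b a).1 / g = i := by
      rw [← hi, val_ofNat_div hg hm
        (NodeData.token_spec (N := N) (T := (K x).trie) hn2 k b a).2.1]
    obtain ⟨e1, e2⟩ := token_eq_of_tokenMemory_eq hd hg hn2 hn hH hk hρ hN (hb x) h
      (Finset.mem_range.1 ha) hi'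
    rw [NodeData.tokenWalk_token hn2 (hb x _ _ le_rfl),
      NodeData.tokenWalk_token hn2 (hb x' _ _ le_rfl)] at e2
    refine ⟨a, ha, ?_, rfl, ?_⟩
    · rw [e1, hi]
    · rw [Sum.inr_injective e2]
  · intro x x' i h h1 _
    rw [outputMemory, outputMemory]
    split_ifs with hi
    · rw [List.flatMap_def, List.flatMap_def]
      congr 1
      refine List.map_congr_left fun a ha => ?_
      rw [List.mem_range] at ha
      obtain ⟨a', ha', -, hpay⟩ := h1 a (Finset.mem_range.2 ha) (Fin.ext (by simp [hi]))
      rw [Finset.mem_range] at ha'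
      obtain ⟨e0, e1⟩ := List.cons.inj hpay
      have e0 := natWord_inj (by omega) (by omega) e0
      subst e0
      exact e1.symm
    · rfl
  · intro x i
    rw [outputMemory]
    split_ifs
    · rw [length_flatMap_of_length_eq fun a _ => List.length_ofFn, List.length_range]
      exact (Nat.mul_le_mul_right _ (Nat.le_succ d)).trans hs
    · simp

/-- All rounds of the dynamic program, from points that are distributed in their order. -/
theorem reach_output {b c : ℕ} (hd : 0 < d) (hg : 0 < g) (hm : n ≤ m * g) (hn2 : 2 ≤ n)
    (hn : 4 * n + 4 ≤ B) (hH : H + 1 < B) (hk : k < B) (hρ : ∀ x : F, ρ x = x)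
    (hN : ∀ y, N.rnd y = ρ y) (K : X → KeyedPoints n d H F kf)
    (hb : ∀ x h u, h ≤ H → (K x).trie.bh h u ≤ b)
    (M : X → Fin m → List (Word B F)) (mach : ℕ → ℕ)
    (hM : ∀ x x' i, M x i = M x' i → ∀ p < n, mach p = i → (K x).pts p = (K x').pts p)
    (hmach : ∀ p < n, mach p < m)
    (hload : ∀ v, ((Finset.range n).filter fun p => mach p = v).card ≤ c)
    (hs1 : (d + 1) * (c * 4) ≤ s) (hs2 : (d + 1) * (g * 4) ≤ s) (hs3 : (k + 9) * (g * 2) ≤ s)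
    (hs4 : (d * 4 + (k + 8) * 2) * g + 4 * k ≤ s) (hs5 : (d + 1) * k ≤ s) :
    Reach s (1 + (b + (1 + (b + 1)))) M
      (fun x (i : Fin m) => outputMemory k ρ B ((N.table (K x).trie.cnt H 0).sol k) i) := by
  have hs4' : (d * 4 + (k + 8) * 2) * g ≤ s := by omega
  refine (step_scatter (N := N) (ρ := ρ) hd hg hm hn K M mach hM hmach hload hs1 hs2
    hs4').reach.trans ?_
  refine (Reach.of_steps (fun t x (i : Fin m) => treeMemory N k ρ g (K x) t i) b fun t _ =>
    step_tree hd hg hm (by omega) hH hρ hN K t hs3 hs4').trans ?_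
  refine (step_start hd hg hn2 (by omega) hH hρ hN K hb hs4).reach.trans ?_
  refine (Reach.of_steps (fun t x (i : Fin m) => tokenMemory N k ρ g b (K x) t i) b fun t _ =>
    step_token hd hg hm hn2 (by omega) hH hk hρ hN K hb t hs4).trans ?_
  exact (step_output hd hg hm hn2 (by omega) hH hk hρ hN K hb hs5).reach

end Rounds

/-! ### The quadtree as a trie -/

section Paths

/-- The number with the binary digits of a cell name, the least significant digit being the head. -/
def cellNumber : Cell → ℕ
  | [] => 0
  | b :: c => 2 * cellNumber c + b.toNat

/-- The cell at a given depth with a given number. -/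
def cellOf : ℕ → ℕ → Cell
  | 0, _ => []
  | l + 1, u => decide (u % 2 = 1) :: cellOf l (u / 2)

theorem length_cellOf (l u : ℕ) : (cellOf l u).length = l := by
  induction l generalizing u with
  | zero => rfl
  | succ l ih => rw [cellOf, List.length_cons, ih]

theorem cellOf_two_mul (l u : ℕ) : cellOf (l + 1) (2 * u) = false :: cellOf l u := by
  rw [cellOf, Nat.mul_mod_right, Nat.mul_div_cancel_left _ two_pos]
  rfl

theorem cellOf_two_mul_add_one (l u : ℕ) : cellOf (l + 1) (2 * u + 1) = true :: cellOf l u := by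
  rw [cellOf, show (2 * u + 1) % 2 = 1 by omega, show (2 * u + 1) / 2 = u by omega]
  rfl

theorem cellNumber_lt (c : Cell) : cellNumber c < 2 ^ c.length := by
  induction c with
  | nil => simp [cellNumber]
  | cons b c ih =>
    rw [cellNumber, List.length_cons, pow_succ]
    have := Bool.toNat_lt b
    omega

theorem cellNumber_cellOf {l u : ℕ} (hu : u < 2 ^ l) : cellNumber (cellOf l u) = u := by
  induction l generalizing u with
  | zero => rw [pow_zero] at hu; rw [cellOf, cellNumber]; omega
  | succ l ih =>
    rw [cellOf, cellNumber, ih (by rw [pow_succ] at hu; omega)]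
    rcases Nat.mod_two_eq_zero_or_one u with h | h <;> simp [h] <;> omega

theorem cellOf_cellNumber (c : Cell) : cellOf c.length (cellNumber c) = c := by
  induction c with
  | nil => rfl
  | cons b c ih =>
    rw [List.length_cons, cellNumber]
    cases b
    · exact (cellOf_two_mul _ _).trans (by rw [ih])
    · exact (cellOf_two_mul_add_one _ _).trans (by rw [ih])

variable (d : ℕ) (Λ : ℝ) (ω : Coins) (p : Fin d → ℝ)

open Classical in
/-- The cell at depth `l` whose region contains the point `p` of the root cube. -/
def path : ℕ → Cell
  | 0 => []
  | l + 1 => decide (∃ j : Fin d, (j : ℕ) = (path l).length % d ∧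
      cutPos ω (path l) ((box d Λ ω (path l)).1 j) ((box d Λ ω (path l)).2 j) < p j) :: path l

variable {d Λ ω p}

theorem length_path (l : ℕ) : (path d Λ ω p l).length = l := by
  induction l with
  | zero => rfl
  | succ l ih => rw [path, List.length_cons, ih]

theorem mem_region_iff (hd : 0 < d) (hp : ∀ j, -Λ ≤ p j ∧ p j ≤ Λ) (c : Cell) :
    p ∈ region d Λ ω c ↔ path d Λ ω p c.length = c := by
  induction c with
  | nil => exact iff_of_true hp rfl
  | cons b c ih =>
    rw [List.length_cons, path]
    have hj : ∃ j : Fin d, (j : ℕ) = c.length % d := ⟨⟨c.length % d, Nat.mod_lt _ hd⟩, rfl⟩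
    obtain ⟨j, hj⟩ := hj
    have hu : ∀ j' : Fin d, (j' : ℕ) = c.length % d → j' = j := fun j' h =>
      Fin.ext (h.trans hj.symm)
    cases b
    · rw [region, Set.mem_ofPred_eq, ih]
      constructor
      · rintro ⟨h1, h2⟩
        rw [h1]
        congr 1
        refine decide_eq_false ?_
        rintro ⟨j', h3, h4⟩
        exact absurd (h2 j' h3) (not_le.2 h4)
      · intro h
        obtain ⟨h1, h2⟩ := List.cons.inj h
        rw [h2] at h1
        refine ⟨h2, fun j' h3 => ?_⟩
        by_contra h4
        exact absurd ⟨j', h3, not_le.1 h4⟩ (of_decide_eq_false h1)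
    · rw [region, Set.mem_ofPred_eq, ih]
      constructor
      · rintro ⟨h1, h2⟩
        rw [h1]
        congr 1
        exact decide_eq_true ⟨j, hj, h2 j hj⟩
      · intro h
        obtain ⟨h1, h2⟩ := List.cons.inj h
        rw [h2] at h1
        obtain ⟨j', h3, h4⟩ := of_decide_eq_true h1
        refine ⟨h2, fun j'' h5 => ?_⟩
        rwa [hu j'' h5, ← hu j' h3]

theorem cellNumber_path_add (l e : ℕ) :
    cellNumber (path d Λ ω p (l + e)) / 2 ^ e = cellNumber (path d Λ ω p l) := by
  induction e with
  | zero => simp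
  | succ e ih =>
    rw [← Nat.add_assoc, path, cellNumber, pow_succ', ← Nat.div_div_eq_div_mul, ← ih]
    congr 1
    have := Bool.toNat_lt (decide (∃ j : Fin d, (j : ℕ) = (path d Λ ω p (l + e)).length % d ∧
      cutPos ω (path d Λ ω p (l + e)) ((box d Λ ω (path d Λ ω p (l + e))).1 j)
        ((box d Λ ω (path d Λ ω p (l + e))).2 j) < p j))
    omega

end Paths

section QuadtreeTrie

variable {n d : ℕ} (ε Λ : ℝ) (ω : Coins) (rnd : ℝ → ℝ) (g : ℕ)

open Classical in
/-- The dynamic program on the quadtree as a dynamic program on a trie of height `D + g`, where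
`D = maxDepth n d`. The nodes of height at least `g` are the cells of depth at most `D`; the
nodes below are added to separate points that are in the same cell at depth `D`. -/
def quadtreeData (n d : ℕ) : NodeData d where
  weight h u c :=
    if g < h ∧ Λ / n < diam d Λ ω (cellOf (maxDepth n d + g - h) u) then
      c + (ω (cellOf (maxDepth n d + g - h) u)).2
    else 0
  diam h u := diam d Λ ω (cellOf (maxDepth n d + g - h) u)
  center h u := center d Λ ω (cellOf (maxDepth n d + g - h) u)
  thr := threshold n d ε
  rnd := rnd

variable {ε Λ ω rnd g}

theorem threshold_pos (hn : 2 ≤ n) (hd : 1 ≤ d) (hε : 0 < ε) : 0 < threshold n d ε := by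
  have hlog : 0 < Real.log n := Real.log_pos (by exact_mod_cast hn)
  have hd' : (0 : ℝ) < d := by exact_mod_cast hd
  unfold threshold
  positivity

variable {P : Fin n → Fin d → ℝ}

theorem leafTable_eq (h u : ℕ) {c : Cell} (hc : cellOf (maxDepth n d + g - h) u = c) :
    leafTable ε Λ ω P rnd c = (quadtreeData ε Λ ω rnd g n d).leaf h u (weight ε Λ ω P c) := by
  subst hc
  rfl

theorem nodeTable_eq (h u : ℕ) (t₁ t₂ : Table d) {c : Cell}
    (hc : cellOf (maxDepth n d + g - h) u = c) :
    nodeTable ε Λ ω P rnd c t₁ t₂ =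
      (quadtreeData ε Λ ω rnd g n d).node h u (weight ε Λ ω P c) t₁ t₂ := by
  subst hc
  rfl

theorem weight_eq_zero_of_not_queued {c : Cell} (h : ¬ Queued ε Λ ω P c) :
    weight ε Λ ω P c = 0 := if_neg fun h' => h h'.1

theorem dynamicProgramAux_of_not_queued (hthr : 0 < threshold n d ε) {c : Cell}
    (h : ¬ Queued ε Λ ω P c) (f : ℕ) :
    dynamicProgramAux ε Λ ω P rnd f c = leafTable ε Λ ω P rnd c := by
  cases f with
  | zero => rfl
  | succ f => rw [dynamicProgramAux, if_pos (by rwa [weight_eq_zero_of_not_queued h])]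

theorem table_eq_dynamicProgramAux (hn : 2 ≤ n) (hd : 1 ≤ d) (hε : 0 < ε) (hΛ : 0 < Λ)
    {c : ℕ → ℕ → ℕ} (hc : ∀ f ≤ maxDepth n d, ∀ u < 2 ^ (maxDepth n d - f),
      c (g + f) u = count Λ ω P (cellOf (maxDepth n d - f) u)) {f : ℕ} (hf : f ≤ maxDepth n d)
    {u : ℕ} (hu : u < 2 ^ (maxDepth n d - f)) (hq : Queued ε Λ ω P (cellOf (maxDepth n d - f) u)) :
    (quadtreeData ε Λ ω rnd g n d).table c (g + f) u =
      dynamicProgramAux ε Λ ω P rnd f (cellOf (maxDepth n d - f) u) := by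
  have hthr := threshold_pos hn hd hε
  induction f generalizing u with
  | zero =>
    have hw : weight ε Λ ω P (cellOf (maxDepth n d) u) = 0 := by
      refine if_neg fun h => absurd h.2 (not_lt.2 ?_)
      exact diam_le_of_maxDepth_le hn hd hΛ ω (length_cellOf _ _).ge
    rw [dynamicProgramAux, Nat.sub_zero, Nat.add_zero,
      leafTable_eq (rnd := rnd) g u (by rw [Nat.add_sub_cancel]), hw]
    cases g with
    | zero => rfl
    | succ g =>
      have h0 : (quadtreeData ε Λ ω rnd (g + 1) n d).weight (g + 1) u (c (g + 1) u) = 0 :=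
        if_neg fun h => absurd h.1 (lt_irrefl _)
      rw [NodeData.table, h0]
      exact if_pos hthr
  | succ f ih =>
    set l := maxDepth n d - (f + 1) with hl
    have hl' : maxDepth n d - f = l + 1 := by omega
    have hcell : maxDepth n d + g - (g + f + 1) = l := by omega
    have hcell' : maxDepth n d + g - (g + f) = l + 1 := by omega
    rw [hl'] at ih
    have hw : (quadtreeData ε Λ ω rnd g n d).weight (g + f + 1) u (c (g + f + 1) u) =
        weight ε Λ ω P (cellOf l u) := by
      rw [Nat.add_assoc, hc (f + 1) hf u hu, ← hl]
      simp only [quadtreeData, weight, noisyCount]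
      rw [← Nat.add_assoc, hcell]
      by_cases hdm : Λ / n < diam d Λ ω (cellOf l u)
      · rw [if_pos ⟨by omega, hdm⟩, if_pos ⟨hq, hdm⟩]
      · rw [if_neg fun h => hdm h.2, if_neg fun h => hdm h.2]
    rw [← Nat.add_assoc, NodeData.table, hw, dynamicProgramAux]
    change (if _ < threshold n d ε then _ else if threshold n d ε < _ then _ else _) = _
    by_cases h1 : weight ε Λ ω P (cellOf l u) < threshold n d ε
    · rw [if_pos h1, if_pos h1, leafTable_eq (g + f + 1) u (by rw [hcell])]
    rw [if_neg h1, if_neg h1, nodeTable_eq (g := g) (g + f + 1) u _ _ (by rw [hcell])]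
    have hne : weight ε Λ ω P (cellOf l u) ≠ 0 := fun h => h1 (by rw [h]; exact hthr)
    have hnoisy : weight ε Λ ω P (cellOf l u) = noisyCount Λ ω P (cellOf l u) ∧
        Λ / n < diam d Λ ω (cellOf l u) := by
      by_cases hdm : Λ / n < diam d Λ ω (cellOf l u)
      · exact ⟨if_pos ⟨hq, hdm⟩, hdm⟩
      · exact absurd (if_neg fun h => hdm h.2) hne
    have hpow : 2 ^ (l + 1) = 2 * 2 ^ l := pow_succ' 2 l
    by_cases h2 : threshold n d ε < weight ε Λ ω P (cellOf l u)
    · have hq' : ∀ b, Queued ε Λ ω P (b :: cellOf l u) := fun b =>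
        ⟨hq, hnoisy.2, hnoisy.1 ▸ h2⟩
      have i1 := ih (u := 2 * u) (by omega) (by omega) (by rw [cellOf_two_mul]; exact hq' _)
      have i2 := ih (u := 2 * u + 1) (by omega) (by omega)
        (by rw [cellOf_two_mul_add_one]; exact hq' _)
      rw [if_pos h2, i1, i2, cellOf_two_mul, cellOf_two_mul_add_one]
    · have hq' : ∀ b, ¬ Queued ε Λ ω P (b :: cellOf l u) := fun b h =>
        h2 (hnoisy.1 ▸ h.2.2)
      rw [if_neg h2, dynamicProgramAux_of_not_queued hthr (hq' _),
        dynamicProgramAux_of_not_queued hthr (hq' _),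
        leafTable_eq (g := g) (g + f) (2 * u) (by rw [hcell', cellOf_two_mul]),
        leafTable_eq (g := g) (g + f) (2 * u + 1) (by rw [hcell', cellOf_two_mul_add_one]),
        weight_eq_zero_of_not_queued (hq' _), weight_eq_zero_of_not_queued (hq' _)]

variable {F : Set ℝ}

/-- The number of the deepest cell that contains a point. -/
def quadtreeKey (n : ℕ) (Λ : ℝ) (ω : Coins) (p : Fin d → F) : ℕ :=
  cellNumber (path d Λ ω (fun j => (p j : ℝ)) (maxDepth n d))

theorem quadtreeKey_lt (p : Fin d → F) : quadtreeKey n Λ ω p < 2 ^ maxDepth n d := by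
  have := cellNumber_lt (path d Λ ω (fun j => (p j : ℝ)) (maxDepth n d))
  rwa [length_path] at this

/-- Points sorted by their deepest cells, as the leaves of a trie. Points in the same cell are
distinguished by their ranks. -/
def keyedPoints (hg : n ≤ 2 ^ g) (q : ℕ → Fin d → F)
    (hq : ∀ r r', r < r' → r' < n → quadtreeKey n Λ ω (q r) ≤ quadtreeKey n Λ ω (q r')) :
    KeyedPoints n d (maxDepth n d + g) F (fun r p => quadtreeKey n Λ ω p * 2 ^ g + r) where
  trie :=
    { key := fun r => quadtreeKey n Λ ω (q r) * 2 ^ g + r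
      key_lt_key := fun r r' h h' =>
        Nat.add_lt_add_of_le_of_lt (Nat.mul_le_mul_right _ (hq r r' h h')) h
      key_lt := fun r hr => by
        have := quadtreeKey_lt (n := n) (Λ := Λ) (ω := ω) (q r)
        rw [pow_add]
        nlinarith }
  pts := q
  key_eq _ _ := rfl

theorem cnt_keyedPoints (hd : 0 < d) (hg : n ≤ 2 ^ g) (q : ℕ → Fin d → F)
    (hq : ∀ r r', r < r' → r' < n → quadtreeKey n Λ ω (q r) ≤ quadtreeKey n Λ ω (q r'))
    {P : Fin n → Fin d → F} (hP : ∀ i j, -Λ ≤ (P i j : ℝ) ∧ (P i j : ℝ) ≤ Λ)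
    (hcard : ∀ Q : (Fin d → F) → Prop,
      Nat.card {r // r < n ∧ Q (q r)} = Nat.card {i // Q (P i)}) {f u : ℕ}
    (hf : f ≤ maxDepth n d) (hu : u < 2 ^ (maxDepth n d - f)) :
    (keyedPoints hg q hq).trie.cnt (g + f) u =
      count Λ ω (fun i j => (P i j : ℝ)) (cellOf (maxDepth n d - f) u) := by
  classical
  have h1 := hcard fun p => path d Λ ω (fun j => (p j : ℝ)) (maxDepth n d - f) =
    cellOf (maxDepth n d - f) u
  rw [Nat.card_eq_fintype_card (α := {i : Fin n // _}), Fintype.card_subtype] at h1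
  rw [count]
  have h2 : (Finset.univ.filter fun i => (fun j => (P i j : ℝ)) ∈
      region d Λ ω (cellOf (maxDepth n d - f) u)) = Finset.univ.filter fun i =>
      path d Λ ω (fun j => (P i j : ℝ)) (maxDepth n d - f) = cellOf (maxDepth n d - f) u :=
    Finset.filter_congr fun i _ => by rw [mem_region_iff hd (hP i), length_cellOf]
  rw [h2, ← h1]
  symm
  refine Nat.subtype_card _ fun r => ?_
  rw [Finset.mem_filter, Finset.mem_range]
  refine and_congr_right fun hr => ?_
  have h3 : (keyedPoints hg q hq).trie.key r / 2 ^ (g + f) =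
      cellNumber (path d Λ ω (fun j => (q r j : ℝ)) (maxDepth n d - f)) := by
    change (quadtreeKey n Λ ω (q r) * 2 ^ g + r) / 2 ^ (g + f) = _
    rw [pow_add, ← Nat.div_div_eq_div_mul, Nat.mul_comm, Nat.mul_add_div (by positivity),
      Nat.div_eq_of_lt (hr.trans_le hg), Nat.add_zero, ← cellNumber_path_add _ f,
      Nat.sub_add_cancel hf]
    rfl
  rw [h3]
  constructor
  · intro h
    rw [← h]
    conv_lhs => rw [← cellOf_cellNumber (path d Λ ω (fun j => (q r j : ℝ)) (maxDepth n d - f))]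
    rw [length_path]
  · intro h
    rw [h, cellNumber_cellOf hu]

theorem table_keyedPoints (hn : 2 ≤ n) (hd : 1 ≤ d) (hε : 0 < ε) (hΛ : 0 < Λ) (hg : n ≤ 2 ^ g)
    (q : ℕ → Fin d → F)
    (hq : ∀ r r', r < r' → r' < n → quadtreeKey n Λ ω (q r) ≤ quadtreeKey n Λ ω (q r'))
    {P : Fin n → Fin d → F} (hP : ∀ i j, -Λ ≤ (P i j : ℝ) ∧ (P i j : ℝ) ≤ Λ)
    (hcard : ∀ Q : (Fin d → F) → Prop,
      Nat.card {r // r < n ∧ Q (q r)} = Nat.card {i // Q (P i)}) :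
    (quadtreeData ε Λ ω rnd g n d).table (keyedPoints hg q hq).trie.cnt (maxDepth n d + g) 0 =
      dynamicProgram ε Λ ω (fun i j => (P i j : ℝ)) rnd [] := by
  have h := table_eq_dynamicProgramAux (rnd := rnd) (P := fun i j => (P i j : ℝ)) hn hd hε hΛ
    (c := (keyedPoints hg q hq).trie.cnt)
    (fun f hf u hu => cnt_keyedPoints hd hg q hq hP hcard hf hu) le_rfl
    (u := 0) (by simp) (by rw [Nat.sub_self]; trivial)
  rw [Nat.sub_self] at h
  rw [Nat.add_comm g] at h
  exact h

end QuadtreeTrie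

/-! ### Measurability of the output -/

section Measurability

variable {n d : ℕ} {ε Λ : ℝ} {P : Fin n → Fin d → ℝ} {rnd : ℝ → ℝ}

theorem measurable_eval_nat {α β : Type*} [MeasurableSpace α] [MeasurableSpace β] {f : ℕ → α → β}
    {g : α → ℕ} (hf : ∀ i, Measurable (f i)) (hg : Measurable g) :
    Measurable fun x => f (g x) x :=
  (measurable_from_prod_countable_right (f := fun p : ℕ × α => f p.1 p.2) hf).comp
    (hg.prodMk measurable_id)

theorem measurable_cut (c : Cell) : Measurable fun ω : Coins => ((ω c).1 : ℝ) :=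
  measurable_subtype_coe.comp (measurable_fst.comp (measurable_pi_apply c))

theorem measurable_noise (c : Cell) : Measurable fun ω : Coins => (ω c).2 :=
  measurable_snd.comp (measurable_pi_apply c)

theorem measurable_cutPos {f g : Coins → ℝ} (hf : Measurable f) (hg : Measurable g) (c : Cell) :
    Measurable fun ω => cutPos ω c (f ω) (g ω) := by
  have := measurable_cut c
  unfold cutPos
  fun_prop

theorem measurable_box (c : Cell) (j : Fin d) :
    Measurable (fun ω => (box d Λ ω c).1 j) ∧ Measurable (fun ω => (box d Λ ω c).2 j) := by
  induction c with
  | nil => exact ⟨measurable_const, measurable_const⟩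
  | cons b c ih =>
    have h := measurable_cutPos ih.1 ih.2 c
    simp only [box]
    constructor
    · split_ifs
      exacts [h, ih.1]
    · split_ifs
      exacts [h, ih.2]

theorem measurable_cutPos_box (c : Cell) (j : Fin d) :
    Measurable fun ω => cutPos ω c ((box d Λ ω c).1 j) ((box d Λ ω c).2 j) :=
  measurable_cutPos (measurable_box c j).1 (measurable_box c j).2 c

theorem measurable_diam (c : Cell) : Measurable fun ω => diam d Λ ω c := by
  have h1 := fun j : Fin d => (measurable_box (Λ := Λ) c j).1
  have h2 := fun j : Fin d => (measurable_box (Λ := Λ) c j).2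
  exact (Finset.measurable_sum _ fun j _ => ((h2 j).sub (h1 j)).pow_const 2).sqrt

theorem measurable_center (c : Cell) (j : Fin d) : Measurable fun ω => center d Λ ω c j :=
  ((measurable_box c j).1.add (measurable_box c j).2).div_const 2

theorem measurableSet_mem_region (p : Fin d → ℝ) (c : Cell) :
    MeasurableSet {ω | p ∈ region d Λ ω c} := by
  induction c with
  | nil => exact MeasurableSet.const _
  | cons b c ih =>
    have h := fun j : Fin d => measurable_cutPos_box (Λ := Λ) c j
    cases b
    · have e : {ω | p ∈ region d Λ ω (false :: c)} = {ω | p ∈ region d Λ ω c} ∩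
          ⋂ (j : Fin d), ⋂ (_ : (j : ℕ) = c.length % d),
            {ω | p j ≤ cutPos ω c ((box d Λ ω c).1 j) ((box d Λ ω c).2 j)} := by
        ext ω
        simp [region]
      rw [e]
      exact ih.inter (MeasurableSet.iInter fun j => MeasurableSet.iInter fun _ =>
        measurableSet_le measurable_const (h j))
    · have e : {ω | p ∈ region d Λ ω (true :: c)} = {ω | p ∈ region d Λ ω c} ∩
          ⋂ (j : Fin d), ⋂ (_ : (j : ℕ) = c.length % d),
            {ω | cutPos ω c ((box d Λ ω c).1 j) ((box d Λ ω c).2 j) < p j} := by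
        ext ω
        simp [region]
      rw [e]
      exact ih.inter (MeasurableSet.iInter fun j => MeasurableSet.iInter fun _ =>
        measurableSet_lt (h j) measurable_const)

theorem measurable_noisyCount (c : Cell) : Measurable fun ω => noisyCount Λ ω P c := by
  classical
  have h : (fun ω => noisyCount Λ ω P c) = fun ω =>
      (∑ i, if P i ∈ region d Λ ω c then (1 : ℝ) else 0) + (ω c).2 := by
    funext ω
    rw [noisyCount, count, Finset.sum_boole]
  rw [h]
  exact (Finset.measurable_sum _ fun i _ => Measurable.ite (measurableSet_mem_region (P i) c)
    measurable_const measurable_const).add (measurable_noise c)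

theorem measurableSet_queued (c : Cell) : MeasurableSet {ω | Queued ε Λ ω P c} := by
  induction c with
  | nil => exact MeasurableSet.const _
  | cons b c ih =>
    exact ih.inter ((measurableSet_lt measurable_const (measurable_diam c)).inter
      (measurableSet_lt measurable_const (measurable_noisyCount c)))

theorem measurable_weight (c : Cell) : Measurable fun ω => weight ε Λ ω P c := by
  classical
  unfold weight
  refine Measurable.ite ?_ (measurable_noisyCount c) measurable_const
  exact (measurableSet_queued c).inter (measurableSet_lt measurable_const (measurable_diam c))

/-- All entries of a random table are measurable. -/
structure MeasurableTable (t : Coins → Table d) : Prop where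
  val : ∀ k, Measurable fun ω => (t ω).val k
  sol : ∀ k a j, Measurable fun ω => (t ω).sol k a j

theorem measurable_zeroVal (hr : Measurable rnd) (c : Cell) :
    Measurable fun ω => zeroVal ε Λ ω P rnd c :=
  hr.comp ((measurable_weight c).mul (measurable_diam c))

theorem measurableTable_leafTable (hr : Measurable rnd) (c : Cell) :
    MeasurableTable fun ω => leafTable ε Λ ω P rnd c where
  val k := by
    simp only [leafTable]
    split_ifs
    exacts [measurable_zeroVal hr c, measurable_const]
  sol k a j := hr.comp (measurable_center c j)

theorem measurable_bestSplit (hr : Measurable rnd) {t₁ t₂ : Coins → Table d}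
    (h₁ : MeasurableTable t₁) (h₂ : MeasurableTable t₂) (k : ℕ) :
    Measurable fun ω => bestSplit rnd (t₁ ω) (t₂ ω) k := by
  classical
  have hval : ∀ j, Measurable fun ω => rnd ((t₁ ω).val j + (t₂ ω).val (k - j)) := fun j =>
    hr.comp ((h₁.val j).add (h₂.val (k - j)))
  have hex : ∀ ω, ∃ k₁, k₁ ≤ k ∧ ∀ j ≤ k, rnd ((t₁ ω).val k₁ + (t₂ ω).val (k - k₁)) ≤
      rnd ((t₁ ω).val j + (t₂ ω).val (k - j)) := fun ω => by
    obtain ⟨k₁, hk, hmin⟩ := Finset.exists_min_image (Finset.range (k + 1))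
      (fun j => rnd ((t₁ ω).val j + (t₂ ω).val (k - j))) ⟨0, by simp⟩
    exact ⟨k₁, by simpa using Finset.mem_range_succ_iff.1 hk,
      fun j hj => hmin j (Finset.mem_range_succ_iff.2 hj)⟩
  have h : (fun ω => bestSplit rnd (t₁ ω) (t₂ ω) k) = fun ω => Nat.find (hex ω) := by
    funext ω
    exact ((Nat.find_eq_iff (hex ω)).2
      ⟨Nat.sInf_mem (hex ω), fun _ hm => Nat.notMem_of_lt_sInf hm⟩).symm
  rw [h]
  refine measurable_find hex fun k₁ => ?_
  have e : {ω | k₁ ≤ k ∧ ∀ j ≤ k, rnd ((t₁ ω).val k₁ + (t₂ ω).val (k - k₁)) ≤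
      rnd ((t₁ ω).val j + (t₂ ω).val (k - j))} = {_ω | k₁ ≤ k} ∩ ⋂ (j : ℕ), ⋂ (_ : j ≤ k),
        {ω | rnd ((t₁ ω).val k₁ + (t₂ ω).val (k - k₁)) ≤
          rnd ((t₁ ω).val j + (t₂ ω).val (k - j))} := by
    ext ω
    simp
  rw [e]
  exact (MeasurableSet.const _).inter (MeasurableSet.iInter fun j => MeasurableSet.iInter fun _ =>
    measurableSet_le (hval k₁) (hval j))

theorem measurableTable_nodeTable (hr : Measurable rnd) {t₁ t₂ : Coins → Table d}
    (h₁ : MeasurableTable t₁) (h₂ : MeasurableTable t₂) (c : Cell) :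
    MeasurableTable fun ω => nodeTable ε Λ ω P rnd c (t₁ ω) (t₂ ω) where
  val k := by
    simp only [nodeTable]
    split_ifs
    · exact measurable_zeroVal hr c
    · exact hr.comp ((measurable_eval_nat h₁.val (measurable_bestSplit hr h₁ h₂ k)).add
        (measurable_eval_nat (fun i => h₂.val (k - i)) (measurable_bestSplit hr h₁ h₂ k)))
  sol k a j := by
    have hb := measurable_bestSplit hr h₁ h₂ k
    have h : (fun ω => (nodeTable ε Λ ω P rnd c (t₁ ω) (t₂ ω)).sol k a j) = fun ω =>
        if a < bestSplit rnd (t₁ ω) (t₂ ω) k then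
          (t₁ ω).sol (bestSplit rnd (t₁ ω) (t₂ ω) k) a j
        else (t₂ ω).sol (k - bestSplit rnd (t₁ ω) (t₂ ω) k)
          (a - bestSplit rnd (t₁ ω) (t₂ ω) k) j := by
      funext ω
      simp only [nodeTable]
      split_ifs <;> rfl
    rw [h]
    refine Measurable.ite (measurableSet_lt measurable_const hb)
      (measurable_eval_nat (fun i => h₁.sol i a j) hb)
      (measurable_eval_nat (fun i => h₂.sol (k - i) (a - i) j) hb)

theorem measurableTable_dynamicProgramAux (hr : Measurable rnd) (h : ℕ) (c : Cell) :
    MeasurableTable fun ω => dynamicProgramAux ε Λ ω P rnd h c := by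
  classical
  induction h generalizing c with
  | zero => exact measurableTable_leafTable hr c
  | succ h ih =>
    have h1 : MeasurableSet {ω | weight ε Λ ω P c < threshold n d ε} :=
      measurableSet_lt (measurable_weight c) measurable_const
    have h2 := measurableTable_leafTable (ε := ε) (Λ := Λ) (P := P) hr c
    have h3 := measurableTable_nodeTable (ε := ε) (Λ := Λ) (P := P) hr (ih (false :: c))
      (ih (true :: c)) c
    have h4 : (fun ω => dynamicProgramAux ε Λ ω P rnd (h + 1) c) = fun ω =>
        if weight ε Λ ω P c < threshold n d ε then leafTable ε Λ ω P rnd c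
        else nodeTable ε Λ ω P rnd c (dynamicProgramAux ε Λ ω P rnd h (false :: c))
          (dynamicProgramAux ε Λ ω P rnd h (true :: c)) := by
      funext ω
      rw [dynamicProgramAux]
    rw [h4]
    constructor
    · intro k
      simp only [apply_ite Table.val, ite_apply]
      exact Measurable.ite h1 (h2.val k) (h3.val k)
    · intro k a j
      simp only [apply_ite Table.sol, ite_apply]
      exact Measurable.ite h1 (h2.sol k a j) (h3.sol k a j)

theorem measurable_privateKMedian (hr : Measurable rnd) (k : ℕ) :
    Measurable fun ω => privateKMedian ε Λ ω P rnd k :=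
  measurable_pi_lambda _ fun a => measurable_pi_lambda _ fun j =>
    (measurableTable_dynamicProgramAux hr _ _).sol k a j

end Measurability

/-! ### The simulation, for given parameters -/

section Simulation

theorem getElem?_flatMap_range {W : Type*} {f : ℕ → List W} {L : ℕ} (hlen : ∀ a, (f a).length = L)
    {k a j : ℕ} (ha : a < k) (hj : j < L) :
    ((List.range k).flatMap f)[a * L + j]? = (f a)[j]? := by
  induction k with
  | zero => omega
  | succ k ih =>
    have hl : ((List.range k).flatMap f).length = L * k := by
      rw [length_flatMap_of_length_eq fun a _ => hlen a, List.length_range]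
    rw [List.range_succ, List.flatMap_append, List.flatMap_singleton]
    rcases Nat.lt_succ_iff_lt_or_eq.1 ha with h | rfl
    · rw [List.getElem?_append_left, ih h]
      rw [hl]
      nlinarith
    · rw [List.getElem?_append_right (by rw [hl, Nat.mul_comm]; omega), hl, Nat.mul_comm L,
        Nat.add_sub_cancel_left]

/-- The coordinates of the centers are words: rounding them again changes nothing. -/
theorem rnd_dynamicProgramAux_sol {n d : ℕ} {ε Λ : ℝ} {ω : Coins} {P : Fin n → Fin d → ℝ}
    {rnd : ℝ → ℝ} (hr : ∀ x, rnd (rnd x) = rnd x) (h : ℕ) (c : Cell) (k a : ℕ) (j : Fin d) :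
    rnd ((dynamicProgramAux ε Λ ω P rnd h c).sol k a j) =
      (dynamicProgramAux ε Λ ω P rnd h c).sol k a j := by
  induction h generalizing c k a with
  | zero => exact hr _
  | succ h ih =>
    rw [dynamicProgramAux]
    split_ifs
    · exact hr _
    · simp only [nodeTable]
      split_ifs
      exacts [ih .., ih ..]

theorem length_initialMemory_le {n d m S B : ℕ} {Λ : ℝ} {F : Set ℝ} (x : Input n d m S Λ F)
    (i : Fin m) : (initialMemory x.pts x.loc i : List (Word B F)).length ≤ d * S := by
  rw [initialMemory, length_flatMap_of_length_eq fun p _ => List.length_ofFn]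
  exact Nat.mul_le_mul_left d (x.length_names_le i)

variable {n d k m s S B b c J g w : ℕ} {ε Λ : ℝ} {F : Set ℝ} {ρ : ℝ → F}

/-- For each outcome `ω` the first machine obtains the output of the sequential algorithm for the same
`ω`. Here `b` is the number of items that a machine sorts, `g` the number of branching nodes that it
keeps, `c` the ratio and `J` the depth of the sorting network, and `w` the number of binary digits
of a rank. -/
theorem reach_privateKMedian [NeZero m] [NeZero B] (hn : 2 ≤ n) (hd : 1 ≤ d) (hε : 0 < ε)
    (hΛ : 0 < Λ) (hρ : ∀ x : F, ρ x = x) (hS : 0 < S) (hSb : S ≤ b) (hc : 1 ≤ c)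
    (hb : 2 * (c * c) ≤ b) (hcm : c ^ J ≤ m) (hnS : n ≤ m * S) (hmS : m * S ≤ b * c ^ J)
    (hNB : b * c ^ J ≤ B)
    (hg : 0 < g) (hmg : n ≤ m * g) (hnB : 4 * n + 4 ≤ B) (hw : n ≤ 2 ^ w)
    (hHB : maxDepth n d + w + 1 < B) (hk : k < B)
    (hs1 : (d + 1) * (b * 4) ≤ s) (hs2 : (d + 1) * (g * 4) ≤ s) (hs3 : (k + 9) * (g * 2) ≤ s)
    (hs4 : (d * 4 + (k + 8) * 2) * g + 4 * k ≤ s) (hs5 : (d + 1) * k ≤ s) (ω : Coins) :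
    Reach s (4 ^ J + (1 + (min n (maxDepth n d + w) + (1 + (min n (maxDepth n d + w) + 1)))))
      (fun x : Input n d m S Λ F => (initialMemory x.pts x.loc : Fin m → List (Word B F)))
      (fun x (i : Fin m) => outputMemory k ρ B ((dynamicProgram ε Λ ω (fun i j => (x.pts i j : ℝ))
        (fun y => (ρ y : ℝ)) []).sol k) i) := by
  obtain ⟨ls, hlen, hls, hsort⟩ := sorter_pow hc hb J
  have hne : ls ≠ [] := by
    rintro rfl
    exact (pow_pos (by norm_num : 0 < 4) J).ne hlen
  have hls' : ∀ l ∈ ls, (∀ p < b * c ^ J, l.mach p < m) ∧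
      ∀ v, (l.fiber (b * c ^ J) v).card ≤ b :=
    fun l hl => ⟨fun p hp => ((hls l hl).1 p hp).trans_le hcm, (hls l hl).2⟩
  choose q hnN hq1 hq2 hq3 using fun x : Input n d m S Λ F =>
    exists_sorted_points (fun _ => ρ 0) x hS hmS (quadtreeKey n Λ ω) (2 ^ maxDepth n d)
      quadtreeKey_lt ls hsort
  have hP : ∀ (x : Input n d m S Λ F) i j, -Λ ≤ (x.pts i j : ℝ) ∧ (x.pts i j : ℝ) ≤ Λ :=
    fun x i j => abs_le.1 ((PiLp.norm_apply_le (p := 2)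
      (WithLp.toLp 2 fun j => (x.pts i j : ℝ) : EuclideanSpace ℝ (Fin d)) j).trans
        (x.norm_lt i).le)
  have h1 := reach_sorted (s := s) (B := B) (Λ := Λ) (F := F) (n := n) hd hS hSb hNB
    (slotKey (quadtreeKey n Λ ω) (2 ^ maxDepth n d)) ls hne hls' (by nlinarith)
  have h2 := reach_output (B := B) (ρ := ρ) (k := k) (s := s)
    (N := quadtreeData ε Λ ω (fun y => (ρ y : ℝ)) w n d)
    (b := min n (maxDepth n d + w)) hd hg hmg hn hnB hHB hk hρ (fun _ => rfl)
    (fun x : Input n d m S Λ F => keyedPoints hw (q x) (hq2 x))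
    (fun x h u hh => le_min (bh_le_left _ h u) ((Trie.bh_le _ h u).trans hh))
    (fun x (i : Fin m) => slotMemory B (ls.getLast hne) (b * c ^ J)
      (sorted (b * c ^ J) (slotKey (quadtreeKey n Λ ω) (2 ^ maxDepth n d)) ls x) i)
    (ls.getLast hne).mach ?_ ?_ ?_ hs1 hs2 hs3 hs4 hs5
  · rw [hlen] at h1
    have h3 : (fun (x : Input n d m S Λ F) (i : Fin m) => outputMemory k ρ B
        ((dynamicProgram ε Λ ω (fun i j => (x.pts i j : ℝ)) (fun y => (ρ y : ℝ)) []).sol k) i) =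
        fun x (i : Fin m) => outputMemory k ρ B (((quadtreeData ε Λ ω (fun y => (ρ y : ℝ)) w n d).table
          (keyedPoints hw (q x) (hq2 x)).trie.cnt (maxDepth n d + w) 0).sol k) i := by
      funext x i
      rw [table_keyedPoints hn hd hε hΛ hw (q x) (hq2 x) (hP x) (hq3 x)]
    rw [h3]
    exact h1.trans h2
  · intro x x' i h p hp hi
    have h3 := eq_of_slotMemory_eq hd h p (Layer.mem_fiber.2 ⟨hp.trans_le (hnN x), hi⟩)
    rw [hq1 x p hp, hq1 x' p hp] at h3
    exact Option.some.inj h3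
  · intro p hp
    exact (hls' _ (List.getLast_mem hne)).1 p (hp.trans_le (hnS.trans hmS))
  · intro v
    refine (Finset.card_le_card fun p hp => ?_).trans ((hls' _ (List.getLast_mem hne)).2 v)
    obtain ⟨hp, hv⟩ := Finset.mem_filter.1 hp
    exact Layer.mem_fiber.2 ⟨(Finset.mem_range.1 hp).trans_le (hnS.trans hmS), hv⟩

/-- The two outputs are equal for every outcome, so that measurability gives equality in
distribution. -/
theorem exists_simulation [NeZero m] [NeZero B] (hn : 2 ≤ n) (hd : 1 ≤ d) (hε : 0 < ε)
    (hΛ : 0 < Λ) (hρm : Measurable ρ) (hρ : ∀ x : F, ρ x = x) (hS : 0 < S) (hSb : S ≤ b)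
    (hc : 1 ≤ c) (hb : 2 * (c * c) ≤ b) (hcm : c ^ J ≤ m) (hnS : n ≤ m * S)
    (hmS : m * S ≤ b * c ^ J) (hNB : b * c ^ J ≤ B)
    (hg : 0 < g) (hmg : n ≤ m * g) (hnB : 4 * n + 4 ≤ B) (hw : n ≤ 2 ^ w)
    (hHB : maxDepth n d + w + 1 < B) (hk : k < B)
    (hs1 : (d + 1) * (b * 4) ≤ s) (hs2 : (d + 1) * (g * 4) ≤ s) (hs3 : (k + 9) * (g * 2) ≤ s)
    (hs4 : (d * 4 + (k + 8) * 2) * g + 4 * k ≤ s) (hs5 : (d + 1) * k ≤ s) :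
    ∃ A : MPCAlgorithm m (Word B F), A.rounds =
        4 ^ J + (1 + (min n (maxDepth n d + w) + (1 + (min n (maxDepth n d + w) + 1)))) ∧
      ∀ x : Input n d m S Λ F, Simulates A s k ε Λ ρ x.pts x.loc := by
  have hreach := reach_privateKMedian (ε := ε) (Λ := Λ) (ρ := ρ) (s := s) (k := k) hn hd hε hΛ hρ
    hS hSb hc hb hcm hnS hmS hNB hg hmg hnB hw hHB hk hs1 hs2 hs3 hs4 hs5
  generalize 4 ^ J + (1 + (min n (maxDepth n d + w) + (1 + (min n (maxDepth n d + w) + 1)))) = R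
    at hreach ⊢
  obtain ⟨send, update, h⟩ := exists_algorithm_of_reach (s := s) Coins inferInstance
    (coinLaw n d ε) (isProbabilityMeasure_coinLaw hn hd hε) _ _
    (fun x i => (length_initialMemory_le x i).trans (by nlinarith)) hreach
  let A : MPCAlgorithm m (Word B F) := ⟨Coins, inferInstance, coinLaw n d ε,
    isProbabilityMeasure_coinLaw hn hd hε, R, send, update⟩
  refine ⟨A, rfl, fun x => ⟨fun ω => (h ω x).1, ?_⟩⟩
  have hm : 0 < m := NeZero.pos m
  have hout : (fun ω : Coins => outputPoints k d A ω
        (initialMemory x.pts x.loc : Fin m → List (Word B F))) =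
      fun ω => privateKMedian ε Λ ω (fun i j => (x.pts i j : ℝ)) (fun y => (ρ y : ℝ)) k := by
    funext ω a j
    have hmem : A.memory ω (initialMemory x.pts x.loc) A.rounds ⟨0, hm⟩ = outputMemory k ρ B
        ((dynamicProgram ε Λ ω (fun i j => (x.pts i j : ℝ)) (fun y => (ρ y : ℝ)) []).sol k) 0 :=
      congrFun (h ω x).2 ⟨0, hm⟩
    rw [outputPoints, dif_pos hm, hmem, outputMemory, if_pos rfl,
      getElem?_flatMap_range (fun _ => List.length_ofFn) a.2 j.2, List.getElem?_ofFn,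
      dif_pos j.2]
    exact rnd_dynamicProgramAux_sol (rnd := fun y => (ρ y : ℝ))
      (fun y => congrArg Subtype.val (hρ (ρ y))) _ _ _ _ _
  change IdentDistrib (fun ω : Coins => outputPoints k d A ω _) _ (coinLaw n d ε) (coinLaw n d ε)
  rw [hout]
  exact IdentDistrib.refl (measurable_privateKMedian (measurable_subtype_coe.comp hρm) k).aemeasurable

end Simulation

/-! ### The choice of the parameters -/

section Parameters

theorem half_le_log {n : ℕ} (hn : 2 ≤ n) : 1 / 2 ≤ Real.log n := by
  have h1 := Real.log_two_gt_d9
  have h2 : Real.log 2 ≤ Real.log n := Real.log_le_log two_pos (by exact_mod_cast hn)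
  linarith

theorem clog_le {n : ℕ} (hn : 2 ≤ n) : (Nat.clog 2 n : ℝ) ≤ 2 * Real.log n + 1 := by
  have h1 := Nat.pow_pred_clog_lt_self (b := 2) (by norm_num) (show 1 < n by omega)
  have h2 : ((2 : ℝ) ^ (Nat.clog 2 n - 1)) ≤ n := by exact_mod_cast h1.le
  have h3 := Real.log_le_log (by positivity) h2
  rw [Real.log_pow] at h3
  have h4 := Real.log_two_gt_d9
  have h5 : (Nat.clog 2 n : ℝ) ≤ (Nat.clog 2 n - 1 : ℕ) + 1 := by
    exact_mod_cast (by omega : Nat.clog 2 n ≤ Nat.clog 2 n - 1 + 1)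
  have h6 : (0 : ℝ) ≤ (Nat.clog 2 n - 1 : ℕ) := Nat.cast_nonneg _
  nlinarith

theorem maxDepth_le {n d : ℕ} (hn : 2 ≤ n) (hd : 1 ≤ d) :
    (maxDepth n d : ℝ) ≤ d * (3 * (Real.log 2 + Real.log d / 2 + Real.log n) + 1) := by
  have hn' : (2 : ℝ) ≤ n := by exact_mod_cast hn
  have hd' : (1 : ℝ) ≤ d := by exact_mod_cast hd
  have hs : 1 ≤ √(d : ℝ) := Real.one_le_sqrt.2 hd'
  have h1 : Real.log (2 * √d * n) = Real.log 2 + Real.log d / 2 + Real.log n := by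
    rw [Real.log_mul (by positivity) (by positivity), Real.log_mul (by norm_num) (by positivity),
      Real.log_sqrt (by positivity)]
  have h2 : 0 ≤ Real.log (2 * √d * n) := Real.log_nonneg (by nlinarith)
  have h3 : 1 / 3 ≤ Real.log (3 / 2 : ℝ) := by
    have := Real.one_sub_inv_le_log_of_pos (show (0 : ℝ) < 3 / 2 by norm_num)
    norm_num at this ⊢
    linarith
  have h4 : Real.logb (3 / 2) (2 * √d * n) ≤ 3 * Real.log (2 * √d * n) := by
    rw [Real.logb, div_le_iff₀ (by linarith)]
    nlinarith
  have h5 : 0 ≤ Real.logb (3 / 2) (2 * √d * n) := div_nonneg h2 (by linarith)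
  have h6 := (Nat.ceil_lt_add_one h5).le
  rw [maxDepth, Nat.cast_mul, ← h1]
  exact mul_le_mul_of_nonneg_left (by linarith) (by positivity)

/-- The number of rounds of the dynamic program is small, even when the tree is deep because of a
dimension larger than the number of points. -/
theorem min_maxDepth_le {n d : ℕ} (hn : 2 ≤ n) (hd : 1 ≤ d) :
    (min n (maxDepth n d + Nat.clog 2 n) : ℕ) ≤ 14 * (d * Real.log n) := by
  have hl := half_le_log hn
  have hd' : (1 : ℝ) ≤ d := by exact_mod_cast hd
  have hdl : Real.log n ≤ d * Real.log n := le_mul_of_one_le_left (by linarith) hd'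
  rcases Nat.le_total n d with h | h
  · have h1 : ((min n (maxDepth n d + Nat.clog 2 n) : ℕ) : ℝ) ≤ d := by
      exact_mod_cast (min_le_left _ _).trans h
    nlinarith
  · have h1 : ((min n (maxDepth n d + Nat.clog 2 n) : ℕ) : ℝ) ≤
        maxDepth n d + Nat.clog 2 n := by exact_mod_cast min_le_right _ _
    have h2 := maxDepth_le hn hd
    have h3 := clog_le hn
    have h4 : Real.log d ≤ Real.log n :=
      Real.log_le_log (by linarith) (by exact_mod_cast h)
    have h5 : Real.log 2 ≤ Real.log n := Real.log_le_log two_pos (by exact_mod_cast hn)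
    have h6 : (d : ℝ) * (3 * (Real.log 2 + Real.log d / 2 + Real.log n) + 1) ≤
        d * (19 / 2 * Real.log n) := mul_le_mul_of_nonneg_left (by linarith) (by linarith)
    nlinarith

theorem maxDepth_add_lt {n d : ℕ} (hn : 2 ≤ n) (hd : 1 ≤ d) :
    (maxDepth n d + Nat.clog 2 n + 2 : ℝ) ≤ 50 * (d * Real.log n) ^ 2 := by
  have hl := half_le_log hn
  have hd' : (1 : ℝ) ≤ d := by exact_mod_cast hd
  have h1 := maxDepth_le hn hd
  have h2 := clog_le hn
  have h3 : Real.log d ≤ d := Real.log_le_self (by linarith)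
  have h4 : Real.log 2 ≤ 1 := by have := Real.log_two_lt_d9; linarith
  set L := (d : ℝ) * Real.log n with hL
  have h5 : (d : ℝ) ≤ 2 * L := by nlinarith
  have h6 : Real.log n ≤ L := le_mul_of_one_le_left (by linarith) hd'
  have h7 : (d : ℝ) * (3 * (Real.log 2 + Real.log d / 2 + Real.log n) + 1) ≤
      d * (4 + 3 / 2 * d) + 3 * L := by nlinarith
  have h8 : (d : ℝ) * (4 + 3 / 2 * d) ≤ 2 * L * (4 + 3 / 2 * (2 * L)) := by gcongr
  have h9 : 1 ≤ 2 * L := by linarith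
  nlinarith

/-- Here `c` is the largest integer whose `J`-th power is at most `m`. -/
theorem exists_root {m : ℕ} (hm : 1 ≤ m) {J : ℕ} (hJ : J ≠ 0) :
    ∃ c, 1 ≤ c ∧ c ^ J ≤ m ∧ m ≤ 2 ^ J * c ^ J := by
  classical
  have h1 : (Nat.findGreatest (fun c => c ^ J ≤ m) m) ^ J ≤ m :=
    Nat.findGreatest_spec (P := fun c => c ^ J ≤ m) (m := 1) hm (by simpa using hm)
  have h2 : 1 ≤ Nat.findGreatest (fun c => c ^ J ≤ m) m :=
    Nat.le_findGreatest hm (by simpa using hm)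
  refine ⟨_, h2, h1, ?_⟩
  set c := Nat.findGreatest (fun c => c ^ J ≤ m) m with hc
  have h3 : m ≤ (c + 1) ^ J := by
    by_contra hlt
    have h4 : c + 1 ≤ m := (Nat.le_self_pow hJ (c + 1)).trans (not_le.1 hlt).le
    have := Nat.le_findGreatest (P := fun c => c ^ J ≤ m) h4 (not_le.1 hlt).le
    omega
  rw [← mul_pow]
  exact h3.trans (Nat.pow_le_pow_left (by omega) J)

theorem exists_exponent {δ : ℝ} (hδ : 0 < δ) : ∃ J : ℕ, 11 ≤ J ∧ 2 ≤ J * δ := by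
  refine ⟨max 11 ⌈2 / δ⌉₊, le_max_left _ _, ?_⟩
  have h1 : 2 / δ ≤ (max 11 ⌈2 / δ⌉₊ : ℕ) :=
    (Nat.le_ceil _).trans (by exact_mod_cast le_max_right _ _)
  rwa [div_le_iff₀ hδ] at h1

/-- With memory `2 ^ J * n ^ δ`, machines can be arranged in a cube of dimension `J` with a side
that is small compared to the memory. -/
theorem two_mul_sq_le {n J c S : ℕ} {δ a : ℝ} (hn : 2 ≤ n) (ha : a ≤ 1) (hJ : 11 ≤ J)
    (hJδ : 2 ≤ J * δ) (hS : (n : ℝ) ^ δ ≤ S)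
    (hc : c ^ J ≤ ⌈(2 ^ (2 * J + 12) : ℕ) * (n : ℝ) ^ a⌉₊) : 2 * (c * c) ≤ 2 ^ J * S := by
  have hn' : (2 : ℝ) ≤ n := by exact_mod_cast hn
  have hna : (n : ℝ) ^ a ≤ n := by
    conv_rhs => rw [← Real.rpow_one (n : ℝ)]
    exact Real.rpow_le_rpow_of_exponent_le (by linarith) ha
  have h1 : ((c ^ J : ℕ) : ℝ) ≤ 2 ^ (2 * J + 13) * n := by
    have h2 : ((c ^ J : ℕ) : ℝ) ≤ ⌈(2 ^ (2 * J + 12) : ℕ) * (n : ℝ) ^ a⌉₊ := by exact_mod_cast hc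
    have h3 := (Nat.ceil_lt_add_one (show 0 ≤ (2 ^ (2 * J + 12) : ℕ) * (n : ℝ) ^ a by
      positivity)).le
    push_cast at h2 h3 ⊢
    have h4 : (1 : ℝ) ≤ 2 ^ (2 * J + 12) := one_le_pow₀ (by norm_num)
    have h5 : (2 : ℝ) ^ (2 * J + 13) = 2 ^ (2 * J + 12) * 2 := pow_succ _ _
    nlinarith
  by_contra hlt
  rw [not_le] at hlt
  have h2 : (2 : ℝ) ^ (J - 1) * (n : ℝ) ^ δ < (c : ℝ) ^ 2 := by
    have h3 : ((2 ^ J * S : ℕ) : ℝ) < ((2 * (c * c) : ℕ) : ℝ) := by exact_mod_cast hlt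
    push_cast at h3
    have h4 : (2 : ℝ) ^ J = 2 ^ (J - 1) * 2 := by rw [← pow_succ, Nat.sub_add_cancel (by omega)]
    have h5 : (0 : ℝ) < 2 ^ (J - 1) := by positivity
    nlinarith
  have h3 := pow_lt_pow_left₀ h2 (by positivity) (show J ≠ 0 by omega)
  have h4 : ((c : ℝ) ^ 2) ^ J = ((c ^ J : ℕ) : ℝ) ^ 2 := by
    push_cast
    rw [← pow_mul, ← pow_mul, Nat.mul_comm]
  have h5 : ((c ^ J : ℕ) : ℝ) ^ 2 ≤ (2 ^ (2 * J + 13) * n) ^ 2 :=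
    pow_le_pow_left₀ (by positivity) h1 2
  have h6 : (n : ℝ) ^ 2 ≤ ((n : ℝ) ^ δ) ^ J := by
    rw [← Real.rpow_natCast, ← Real.rpow_natCast, ← Real.rpow_mul (by linarith)]
    refine Real.rpow_le_rpow_of_exponent_le (by linarith) ?_
    push_cast
    linarith
  have h7 : ((2 : ℝ) ^ (2 * J + 13)) ^ 2 ≤ (2 ^ (J - 1)) ^ J := by
    rw [← pow_mul, ← pow_mul]
    refine pow_le_pow_right₀ (by norm_num) ?_
    obtain ⟨i, rfl⟩ : ∃ i, J = i + 11 := ⟨J - 11, by omega⟩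
    rw [show i + 11 - 1 = i + 10 by omega]
    nlinarith
  have h8 : ((2 : ℝ) ^ (2 * J + 13) * n) ^ 2 ≤ (2 ^ (J - 1) * (n : ℝ) ^ δ) ^ J := by
    rw [mul_pow, mul_pow]
    exact mul_le_mul h7 h6 (by positivity) (by positivity)
  linarith

/-- The quantities that have to fit in a memory of `s` words, where `x`, `y`, `z`, `u` stand for the
powers of `n` with the exponents `δ`, `γ`, `δ - γ`, `1 - δ + γ`, and `L` for `log n`. -/
theorem parameter_bounds {n d k m s S g C J : ℕ} {x y z u L T : ℝ} (hd : (1 : ℝ) ≤ d)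
    (hl : 1 / 2 ≤ L) (hT : T = 2 ^ J) (hC : (C : ℝ) = 4096 * T ^ 2) (hy1 : 1 ≤ y) (hz1 : 1 ≤ z)
    (hu1 : 1 ≤ u) (hyz : y * z = x) (huz : u * z = n) (hk : k ≤ y) (hSx : x ≤ S)
    (hSx' : S ≤ x + 1) (hgz : z ≤ g) (hgz' : g ≤ z + 1) (hm : C * u ≤ m)
    (hs : C * (x * d * L) ≤ s) :
    n ≤ m * S ∧ n ≤ m * g ∧ 8 * S ≤ s ∧ (d + 1) * (2 ^ J * S * 4) ≤ s ∧ (d + 1) * (g * 4) ≤ s ∧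
      (k + 9) * (g * 2) ≤ s ∧ (d * 4 + (k + 8) * 2) * g + 4 * k ≤ s ∧ (d + 1) * k ≤ s ∧
      50 * (d * L) ^ 2 ≤ (s : ℝ) * s := by
  have hT1 : 1 ≤ T := hT ▸ one_le_pow₀ (by norm_num)
  have hTT : T ≤ T ^ 2 := by nlinarith
  have hC1 : (4096 : ℝ) ≤ C := by rw [hC]; linarith
  have hyx : y ≤ x := hyz ▸ le_mul_of_one_le_right (by linarith) hz1
  have hzx : z ≤ x := hyz ▸ le_mul_of_one_le_left (by linarith) hy1
  have hx1 : 1 ≤ x := hy1.trans hyx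
  have hum : u ≤ m := le_trans (le_mul_of_one_le_left (by linarith) (by linarith)) hm
  have hxd : x ≤ x * d := le_mul_of_one_le_right (by linarith) hd
  have hdx : (d : ℝ) ≤ x * d := le_mul_of_one_le_left (by linarith) hx1
  have hL : x * d ≤ 2 * (x * d * L) := by
    have : x * d * (1 / 2) ≤ x * d * L := mul_le_mul_of_nonneg_left hl (by linarith)
    linarith
  have h0 : 0 ≤ x * d * L := by linarith
  -- The factor `L` is only needed for the square root of the depth of the tree.
  have hsT : 2048 * T * (x * d) ≤ s := by
    refine le_trans ?_ hs
    calc 2048 * T * (x * d) ≤ 2048 * T * (2 * (x * d * L)) := by gcongr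
      _ = 4096 * T * (x * d * L) := by ring
      _ ≤ C * (x * d * L) := by rw [hC]; gcongr
  have hsx : 2048 * (x * d) ≤ s := by
    refine le_trans ?_ hsT
    gcongr
    linarith
  have hsmall : ∀ a : ℕ, (a : ℝ) ≤ 2048 * (x * d) → a ≤ s := fun a ha => by
    exact_mod_cast ha.trans hsx
  have hgx : (g : ℝ) ≤ 2 * x := by linarith
  have hkx : (k : ℝ) ≤ x := hk.trans hyx
  have hkg : (k : ℝ) * g ≤ 2 * x := by
    calc (k : ℝ) * g ≤ y * (2 * z) := by gcongr; linarith
      _ = 2 * x := by rw [← hyz]; ring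
  have hdg : (d : ℝ) * g ≤ 2 * (x * d) := by
    calc (d : ℝ) * g ≤ d * (2 * x) := by gcongr
      _ = 2 * (x * d) := by ring
  have hdk : (d : ℝ) * k ≤ x * d := by rw [mul_comm]; gcongr
  refine ⟨?_, ?_, hsmall _ ?_, ?_, hsmall _ ?_, hsmall _ ?_, hsmall _ ?_, hsmall _ ?_, ?_⟩
  · have h1 : ((n : ℕ) : ℝ) ≤ ((m * S : ℕ) : ℝ) := by
      push_cast
      calc (n : ℝ) = u * z := huz.symm
        _ ≤ m * S := by gcongr; linarith
    exact_mod_cast h1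
  · have h1 : ((n : ℕ) : ℝ) ≤ ((m * g : ℕ) : ℝ) := by
      push_cast
      calc (n : ℝ) = u * z := huz.symm
        _ ≤ m * g := by gcongr
    exact_mod_cast h1
  · push_cast; linarith
  · have h1 : (((d + 1) * (2 ^ J * S * 4) : ℕ) : ℝ) ≤ s := by
      refine le_trans ?_ hsT
      push_cast
      rw [← hT]
      calc ((d : ℝ) + 1) * (T * S * 4) ≤ (2 * d) * (T * (2 * x) * 4) := by
            gcongr <;> linarith
        _ = 16 * (T * (x * d)) := by ring
        _ ≤ 2048 * (T * (x * d)) := by gcongr; norm_num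
        _ = 2048 * T * (x * d) := by ring
    exact_mod_cast h1
  · push_cast; linarith
  · push_cast; linarith
  · push_cast; linarith
  · push_cast; linarith
  · have h1 : 8 * (d * L) ≤ s := by
      have h2 : d * L ≤ x * d * L := by gcongr
      have h3 : 4096 * (x * d * L) ≤ C * (x * d * L) := by gcongr
      linarith
    calc 50 * (d * L) ^ 2 ≤ (8 * (d * L)) * (8 * (d * L)) := by nlinarith [sq_nonneg (d * L)]
      _ ≤ s * s := by gcongr

/-- The integers sent, which are positions of the sorting network, labels of packets, heights of
nodes and numbers of centers, are bounded by a power of `m * s`. -/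
theorem word_size_bounds {n d k m s S b c C J : ℕ} (hn : 1 ≤ n) (hk : k ≤ n) (hC : 2 ≤ C)
    (hnS : n ≤ m * S) (hS : 8 * S ≤ s) (hb : (d + 1) * (b * 4) ≤ s) (hcm : c ^ J ≤ m) {h : ℕ}
    (hh : h ≤ s * s) :
    b * c ^ J ≤ (m * s) ^ C ∧ 4 * n + 4 ≤ (m * s) ^ C ∧ h ≤ (m * s) ^ C ∧ k < (m * s) ^ C := by
  have hm : 0 < m := Nat.pos_of_ne_zero fun h => by subst h; omega
  have hs : 0 < s := Nat.pos_of_ne_zero fun h => by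
    obtain rfl : S = 0 := by omega
    omega
  have hms : 0 < m * s := Nat.mul_pos hm hs
  have h1 : m * s ≤ (m * s) ^ C := Nat.le_self_pow (by omega) _
  have h2 : s * s ≤ (m * s) ^ C := by
    have h1 : s ≤ m * s := Nat.le_mul_of_pos_left s hm
    calc s * s ≤ m * s * (m * s) := Nat.mul_le_mul h1 h1
      _ = (m * s) ^ 2 := (sq _).symm
      _ ≤ (m * s) ^ C := Nat.pow_le_pow_right hms hC
  have h3 : 8 * n ≤ m * s := by
    calc 8 * n ≤ 8 * (m * S) := Nat.mul_le_mul_left 8 hnS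
      _ = m * (8 * S) := by ring
      _ ≤ m * s := Nat.mul_le_mul_left m hS
  have h4 : b ≤ s := by
    refine le_trans ?_ hb
    calc b ≤ b * 4 := by omega
      _ ≤ (d + 1) * (b * 4) := Nat.le_mul_of_pos_left _ (Nat.succ_pos d)
  refine ⟨?_, by omega, hh.trans h2, by omega⟩
  calc b * c ^ J ≤ s * m := Nat.mul_le_mul h4 hcm
    _ = m * s := Nat.mul_comm s m
    _ ≤ (m * s) ^ C := h1

/-- The rounds for sorting, for distributing the points, for the value tables, for starting the tokens,
for moving them, and for collecting the centers. -/
theorem rounds_le {n d C J : ℕ} (hn : 2 ≤ n) (hd : 1 ≤ d) (hC : C = 2 ^ (2 * J + 12)) :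
    ((4 ^ J + (1 + (min n (maxDepth n d + Nat.clog 2 n) +
      (1 + (min n (maxDepth n d + Nat.clog 2 n) + 1)))) : ℕ) : ℝ) ≤ C * (d * Real.log n) := by
  have h1 := min_maxDepth_le hn hd
  have hl := half_le_log hn
  have hd' : (1 : ℝ) ≤ d := by exact_mod_cast hd
  generalize min n (maxDepth n d + Nat.clog 2 n) = b at h1 ⊢
  have hL : 1 / 2 ≤ d * Real.log n := hl.trans (le_mul_of_one_le_left (by linarith) hd')
  generalize (d : ℝ) * Real.log n = L at h1 hL ⊢
  have h2 : (C : ℝ) = 4096 * 4 ^ J := by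
    rw [hC, Nat.cast_pow, pow_add, pow_mul, mul_comm]
    norm_num
  have h3 : (1 : ℝ) ≤ 4 ^ J := one_le_pow₀ (by norm_num)
  rw [h2]
  push_cast
  have h4 : (4 : ℝ) ^ J * (1 / 2) ≤ 4 ^ J * L := mul_le_mul_of_nonneg_left hL (by positivity)
  have h5 : 1 * L ≤ (4 : ℝ) ^ J * L := mul_le_mul_of_nonneg_right h3 (by linarith)
  linarith

end Parameters

end PrivateKMedian

end

theorem theorem2 (δ γ : ℝ) (hγ : 0 < γ) (hγδ : γ < δ) (hδ : δ < 1) :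
    ∃ C : ℕ, 1 ≤ C ∧
      ∀ (n d k : ℕ) (ε Λ : ℝ) (F : Set ℝ) (ρ : ℝ → F),
        2 ≤ n → 1 ≤ d → (k : ℝ) ≤ (n : ℝ) ^ γ → 0 < ε → 0 < Λ →
        Measurable ρ → (∀ x : F, ρ x = x) →
        let m : ℕ := ⌈C * (n : ℝ) ^ (1 - δ + γ)⌉₊
        let s : ℕ := ⌈C * ((n : ℝ) ^ δ * d * Real.log n)⌉₊
        ∃ A : PrivateKMedian.MPCAlgorithm m (PrivateKMedian.Word ((m * s) ^ C) F),
          (A.rounds : ℝ) ≤ C * (d * Real.log n) ∧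
          ∀ P : Fin n → Fin d → F,
            (∀ i, ‖(WithLp.toLp 2 fun j => (P i j : ℝ) : EuclideanSpace ℝ (Fin d))‖ < Λ) →
            ∀ loc : Fin n → Fin m,
              (∀ i, (Finset.univ.filter fun p => loc p = i).card ≤ ⌈(n : ℝ) ^ δ⌉₊) →
              PrivateKMedian.Simulates A s k ε Λ ρ P loc := by
  obtain ⟨J, hJ, hJδ⟩ := PrivateKMedian.exists_exponent (hγ.trans hγδ)
  obtain ⟨C, hC⟩ : ∃ C : ℕ, C = 2 ^ (2 * J + 12) := ⟨_, rfl⟩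
  refine ⟨C, hC ▸ Nat.one_le_two_pow, ?_⟩
  intro n d k ε Λ F ρ hn hd hk hε hΛ hρm hρ m s
  have hm : m = ⌈C * (n : ℝ) ^ (1 - δ + γ)⌉₊ := rfl
  have hs : s = ⌈C * ((n : ℝ) ^ δ * d * Real.log n)⌉₊ := rfl
  clear_value m s
  have hn0 : (0 : ℝ) < n := by exact_mod_cast (by omega : 0 < n)
  have hn1 : (1 : ℝ) ≤ n := by exact_mod_cast (by omega : 1 ≤ n)
  have hkn : k ≤ n := by
    have h1 : (n : ℝ) ^ γ ≤ (n : ℝ) ^ (1 : ℝ) :=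
      Real.rpow_le_rpow_of_exponent_le hn1 (hγδ.trans hδ).le
    rw [Real.rpow_one] at h1
    exact_mod_cast hk.trans h1
  have hx : 0 < (n : ℝ) ^ δ := Real.rpow_pos_of_pos hn0 δ
  have hz : 0 < (n : ℝ) ^ (δ - γ) := Real.rpow_pos_of_pos hn0 _
  have hu : 1 ≤ (n : ℝ) ^ (1 - δ + γ) := Real.one_le_rpow hn1 (by linarith)
  have hC0 : 0 < C := hC ▸ Nat.two_pow_pos _
  have hC2 : 2 ≤ C := by
    rw [hC, pow_succ]
    exact Nat.le_mul_of_pos_left 2 (Nat.two_pow_pos _)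
  have hm0 : 0 < m := hm ▸ Nat.ceil_pos.2 (by positivity)
  obtain ⟨hnS, hmg, hS8, hs1, hs2, hs3, hs4, hs5, hs6⟩ :=
    PrivateKMedian.parameter_bounds (n := n) (d := d) (k := k) (m := m) (s := s)
      (S := ⌈(n : ℝ) ^ δ⌉₊) (g := ⌈(n : ℝ) ^ (δ - γ)⌉₊) (C := C) (J := J) (T := 2 ^ J)
      (by exact_mod_cast hd) (PrivateKMedian.half_le_log hn) rfl
      (by rw [hC, Nat.cast_pow, pow_add, Nat.mul_comm 2 J, pow_mul, mul_comm]; norm_num)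
      (Real.one_le_rpow hn1 hγ.le) (Real.one_le_rpow hn1 (sub_nonneg.2 hγδ.le)) hu
      (by rw [← Real.rpow_add hn0, add_sub_cancel])
      (by rw [← Real.rpow_add hn0, show 1 - δ + γ + (δ - γ) = 1 by ring, Real.rpow_one]) hk
      (Nat.le_ceil _) (Nat.ceil_lt_add_one hx.le).le (Nat.le_ceil _)
      (Nat.ceil_lt_add_one hz.le).le (hm ▸ Nat.le_ceil _) (hs ▸ Nat.le_ceil _)
  obtain ⟨c, hc, hcm, hmc⟩ := PrivateKMedian.exists_root hm0 (show J ≠ 0 by omega)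
  have hh : PrivateKMedian.maxDepth n d + Nat.clog 2 n + 2 ≤ s * s := by
    exact_mod_cast (PrivateKMedian.maxDepth_add_lt hn hd).trans hs6
  obtain ⟨hw1, hw2, hw3, hw4⟩ := PrivateKMedian.word_size_bounds (by omega) hkn hC2 hnS hS8 hs1 hcm
    hh
  have : NeZero m := ⟨hm0.ne'⟩
  have : NeZero ((m * s) ^ C) := ⟨by omega⟩
  obtain ⟨A, hA, hsim⟩ := PrivateKMedian.exists_simulation (S := ⌈(n : ℝ) ^ δ⌉₊)
    (B := (m * s) ^ C) (ρ := ρ) hn hd hε hΛ hρm hρ (Nat.ceil_pos.2 hx)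
    (Nat.le_mul_of_pos_left _ (Nat.two_pow_pos J)) hc
    (PrivateKMedian.two_mul_sq_le hn (by linarith) hJ hJδ (Nat.le_ceil _) (hC ▸ hm ▸ hcm)) hcm hnS
    (by
      rw [Nat.mul_right_comm]
      exact Nat.mul_le_mul_right _ hmc)
    hw1 (Nat.ceil_pos.2 hz) hmg hw2 (Nat.le_pow_clog one_lt_two n) (by omega) hw4 hs1 hs2 hs3 hs4
    hs5
  refine ⟨A, ?_, fun P hP loc hloc => hsim ⟨P, loc, hP, hloc⟩⟩
  rw [hA]
  exact PrivateKMedian.rounds_le hn hd hC
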